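/- Work in NBG set theory with a global well-ordering $\leqslant$ of the universe $V$ of sets, the classes being the subclasses of $V$ that are definable in $(V,\in,\leqslant)$ by a first-order formula with set parameters ("definable" always means this). An almost homomorphism is a map $f:\mathbb Z\to\mathbb Z$ such that $f(p+q)-f(p)-f(q)$ is bounded on $\mathbb Z\times\mathbb Z$. View $\mathbb R$ as the ordered field of Eudoxus reals: almost homomorphisms modulo maps with bounded range, with pointwise addition, multiplication induced by composition, and $[f]>0$ if and only if $\sup_{m\in\mathbb N}f(m)=+\infty$. Let $\mathcal L'=\{+,\cdot,\leqslant,0,1\}\cup\{P_R\}$, with a symbol $P_R$ for every $m\ge 1$ and every $R\subseteq\mathbb R^m$; $\mathbb R$ is an $\mathcal L'$-structure in the natural way. A hyperreal field is an ordered field ${}^*\mathbb R$ together with an expansion to an $\mathcal L'$-structure and an $\mathcal L'$-elementary embedding $\mathbb R\to{}^*\mathbb R$ that is not onto. It is definable if its base set and its $\mathcal L'$-structure (operations, and the relations $P_R$ uniformly in a set code of $R$) are definable classes; it may be a set or a proper class. Let $\Sigma$ be the class of all finite sets of ordinals. Call an ultrafilter $\mathcal F$ on the Boolean algebra of definable subclasses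 of $\Sigma$ definable if for every definable family $(X_a)_{a\in V}$ of subclasses of $\Sigma$ the class $\{a: X_a\in\mathcal F\}$ is definable. Then there is a non-principal definable ultrafilter $\mathcal F$ that contains $\hat\alpha=\{s\in\Sigma:\alpha\in s\}$ for every ordinal $\alpha$. For any such $\mathcal F$, let $A_0(\mathbb Z\times\Sigma,\mathbb Z)$ be the collection of all definable class functions $F:\mathbb Z\times\Sigma\to\mathbb Z$ such that $F(\cdot,s)$ is an almost homomorphism for every $s\in\Sigma$; let $F\sim_{\sigma\tau}G$ mean that $\{s\in\Sigma: F(\cdot,s)-G(\cdot,s)\text{ is bounded}\}\in\mathcal F$; and let $\mathbb R_0=A_0(\mathbb Z\times\Sigma,\mathbb Z)/\!\sim_{\sigma\tau}$, with addition induced by pointwise addition, multiplication induced by composition in the variable from $\mathbb Z$, and with $\leqslant$ or $P_R$ holding of $[F_1],\dots,[F_m]$ if and only if it holds in $\mathbb R$ of the classes of $F_1(\cdot,s),\dots,F_m(\cdot,s)$ for $\mathcal F$-almost all $s$. Then: (1) $\mathbb R_0$ is a class hyperreal field: it is a hyperreal field, it is not of the size of a set, and its $\mathcal L'$-structure is definable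 on codes, that is, for every definable family $(F_a)_{a\in X}$ of elements of $A_0(\mathbb Z\times\Sigma,\mathbb Z)$ indexed by a definable class $X$, the equality, the operations and the relations of $\mathbb R_0$ among the elements $[F_a]$ are definable classes of indices. (2) Every definable hyperreal field ${}^*\mathbb R$ admits an $\mathcal L'$-elementary embedding into $\mathbb R_0$, of the form $r\mapsto[F_r]$ for a definable family $(F_r)_{r\in{}^*\mathbb R}$ in $A_0(\mathbb Z\times\Sigma,\mathbb Z)$. -/

import Mathlib

open scoped FirstOrder

universe u

namespace ClassHyperreal

/-! ### Almost homomorphisms and the Eudoxus reals -/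

/-- `f : ℤ → ℤ` is an almost homomorphism. -/
def IsAlmostHom (f : ℤ → ℤ) : Prop :=
  ∃ C : ℤ, ∀ p q : ℤ, |f (p + q) - f p - f q| < C

/-- `f : ℤ → ℤ` has bounded range. -/
def IsBdd (f : ℤ → ℤ) : Prop :=
  ∃ C : ℤ, ∀ p : ℤ, |f p| < C

theorem IsBdd.add {f g : ℤ → ℤ} (hf : IsBdd f) (hg : IsBdd g) : IsBdd fun p => f p + g p := by
  obtain ⟨C, hC⟩ := hf
  obtain ⟨D, hD⟩ := hg
  exact ⟨C + D, fun p => (abs_add_le _ _).trans_lt (add_lt_add (hC p) (hD p))⟩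

theorem IsBdd.neg {f : ℤ → ℤ} (hf : IsBdd f) : IsBdd fun p => -f p := by
  obtain ⟨C, hC⟩ := hf
  exact ⟨C, fun p => by simpa using hC p⟩

theorem IsAlmostHom.add {f g : ℤ → ℤ} (hf : IsAlmostHom f) (hg : IsAlmostHom g) :
    IsAlmostHom fun p => f p + g p := by
  obtain ⟨C, hC⟩ := hf
  obtain ⟨D, hD⟩ := hg
  refine ⟨C + D, fun p q => ?_⟩
  have h := (abs_add_le _ _).trans_lt (add_lt_add (hC p q) (hD p q))
  refine (congrArg abs ?_).trans_lt h
  ring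

theorem IsAlmostHom.neg {f : ℤ → ℤ} (hf : IsAlmostHom f) : IsAlmostHom fun p => -f p := by
  obtain ⟨C, hC⟩ := hf
  refine ⟨C, fun p q => ?_⟩
  have h := hC p q
  rw [← abs_neg] at h
  convert h using 2
  ring_nf

theorem isAlmostHom_zero : IsAlmostHom fun _ => 0 := ⟨1, fun p q => by simp⟩

theorem isAlmostHom_id : IsAlmostHom fun p => p := ⟨1, fun p q => by simp⟩

theorem exists_bound_on (f : ℤ → ℤ) (C : ℤ) : ∃ M : ℤ, ∀ d : ℤ, |d| < C → |f d| < M := by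
  refine ⟨(∑ d ∈ Finset.Icc (-C) C, |f d|) + 1, fun d hd => ?_⟩
  have hm : d ∈ Finset.Icc (-C) C := by
    rw [Finset.mem_Icc]
    exact ⟨by linarith [(abs_lt.1 hd).1], by linarith [(abs_lt.1 hd).2]⟩
  have := Finset.single_le_sum (f := fun d => |f d|) (fun i _ => abs_nonneg (f i)) hm
  omega

/-- An almost homomorphism maps functions at bounded distance to functions at bounded distance. -/
theorem IsAlmostHom.comp_sub {f g h : ℤ → ℤ} (hf : IsAlmostHom f)
    (hgh : IsBdd fun p => g p - h p) : IsBdd fun p => f (g p) - f (h p) := by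
  obtain ⟨C, hC⟩ := hf
  obtain ⟨D, hD⟩ := hgh
  obtain ⟨M, hM⟩ := exists_bound_on f D
  refine ⟨C + M, fun p => ?_⟩
  have h1 := hC (h p) (g p - h p)
  have h2 := hM _ (hD p)
  rw [show h p + (g p - h p) = g p by ring] at h1
  have h3 := (abs_add_le _ _).trans_lt (add_lt_add h1 h2)
  refine (congrArg abs ?_).trans_lt h3
  ring

theorem IsAlmostHom.comp {f g : ℤ → ℤ} (hf : IsAlmostHom f) (hg : IsAlmostHom g) :
    IsAlmostHom fun p => f (g p) := by
  obtain ⟨C, hC⟩ := hf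
  obtain ⟨D, hD⟩ := hg
  obtain ⟨M, hM⟩ := exists_bound_on f D
  refine ⟨C + M + C, fun p q => ?_⟩
  have h1 := hC (g p + g q) (g (p + q) - g p - g q)
  have h2 := hM _ (hD p q)
  have h3 := hC (g p) (g q)
  rw [show g p + g q + (g (p + q) - g p - g q) = g (p + q) by ring] at h1
  have h4 := (abs_add_le _ _).trans_lt
    (add_lt_add ((abs_add_le _ _).trans_lt (add_lt_add h1 h2)) h3)
  refine (congrArg abs ?_).trans_lt h4
  ring

/-- The group of almost homomorphisms, under pointwise addition. -/
def almostHoms : AddSubgroup (ℤ → ℤ) where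
  carrier := {f | IsAlmostHom f}
  add_mem' hf hg := IsAlmostHom.add hf hg
  zero_mem' := isAlmostHom_zero
  neg_mem' hf := IsAlmostHom.neg hf

/-- The group of functions with bounded range. -/
def bddFuns : AddSubgroup (ℤ → ℤ) where
  carrier := {f | IsBdd f}
  add_mem' hf hg := IsBdd.add hf hg
  zero_mem' := ⟨1, fun p => by simp⟩
  neg_mem' hf := IsBdd.neg hf

/-- The Eudoxus reals: almost homomorphisms modulo functions with bounded range. -/
abbrev Eudoxus : Type := almostHoms ⧸ bddFuns.addSubgroupOf almostHoms

namespace Eudoxus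

/-- The class of an almost homomorphism. -/
def mk (f : ℤ → ℤ) (hf : IsAlmostHom f) : Eudoxus :=
  QuotientAddGroup.mk (⟨f, hf⟩ : almostHoms)

theorem mk_eq_mk {f g : ℤ → ℤ} {hf : IsAlmostHom f} {hg : IsAlmostHom g} :
    mk f hf = mk g hg ↔ IsBdd fun p => f p - g p := by
  have key : mk f hf = mk g hg ↔ IsBdd fun p => -f p + g p := by
    unfold mk
    rw [QuotientAddGroup.eq, AddSubgroup.mem_addSubgroupOf]
    rfl
  rw [key]
  constructor
  · intro h
    have := h.neg
    convert this using 2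
    ring
  · intro h
    have := h.neg
    convert this using 2
    ring

/-- Multiplication of Eudoxus reals is induced by composition. -/
def mul : Eudoxus → Eudoxus → Eudoxus :=
  Quotient.map₂ (fun f g : almostHoms => ⟨fun p => f.1 (g.1 p), f.2.comp g.2⟩) (by
    intro f f' hf g g' hg
    have hf' := (mk_eq_mk (hf := f.2) (hg := f'.2)).1 (Quotient.sound hf)
    have hg' := (mk_eq_mk (hf := g.2) (hg := g'.2)).1 (Quotient.sound hg)
    refine Quotient.exact ((mk_eq_mk (hf := f.2.comp g.2) (hg := f'.2.comp g'.2)).2 ?_)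
    have h1 : IsBdd fun p => f.1 (g.1 p) - f'.1 (g.1 p) := by
      obtain ⟨C, hC⟩ := hf'
      exact ⟨C, fun p => hC (g.1 p)⟩
    have h2 : IsBdd fun p => f'.1 (g.1 p) - f'.1 (g'.1 p) := IsAlmostHom.comp_sub f'.2 hg'
    have h3 := h1.add h2
    convert h3 using 2
    ring)

/-- The positive Eudoxus reals. -/
def IsPos (x : Eudoxus) : Prop :=
  ∃ (f : ℤ → ℤ) (hf : IsAlmostHom f), mk f hf = x ∧ ∀ C : ℤ, ∃ m : ℕ, C < f m

/-- The order of the Eudoxus reals. -/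
def le (x y : Eudoxus) : Prop := x = y ∨ IsPos (y - x)

end Eudoxus

/-! ### The language of ordered fields with all relations on the reals, and hyperreal fields -/

/-- The function symbols `0`, `1`, `+`, `·`. -/
inductive FieldFun : ℕ → Type
  | zero : FieldFun 0
  | one : FieldFun 0
  | add : FieldFun 2
  | mul : FieldFun 2

/-- The relation symbols: `≤`, and a symbol for each relation of positive arity on the reals. -/
inductive FullRel : ℕ → Type
  | le : FullRel 2
  | rel {m : ℕ} (R : Set (Fin (m + 1) → Eudoxus)) : FullRel (m + 1)

/-- The language of ordered fields, expanded by all finite-dimensional relations on the reals. -/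
def fullLang : FirstOrder.Language.{0, 0} := ⟨FieldFun, FullRel⟩

/-- The reals as a structure for the full language. -/
instance eudoxusStructure : fullLang.Structure Eudoxus where
  funMap {_} f := match f with
    | FieldFun.zero => fun _ => 0
    | FieldFun.one => fun _ => Eudoxus.mk (fun p => p) isAlmostHom_id
    | FieldFun.add => fun x => x 0 + x 1
    | FieldFun.mul => fun x => Eudoxus.mul (x 0) (x 1)
  RelMap {_} R := match R with
    | FullRel.le => fun x => Eudoxus.le (x 0) (x 1)
    | FullRel.rel R => fun x => x ∈ R

/-- The symbols `0`, `1`, `+`, `·`, `≤` are interpreted by the operations and the order of an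
ordered field. -/
def IsOrderedFieldStructure (A : Type*) [fullLang.Structure A] : Prop :=
  ∃ (_ : Field A) (_ : LinearOrder A) (_ : IsStrictOrderedRing A),
    (∀ x : Fin 0 → A, FirstOrder.Language.Structure.funMap (L := fullLang) FieldFun.zero x = 0) ∧
    (∀ x : Fin 0 → A, FirstOrder.Language.Structure.funMap (L := fullLang) FieldFun.one x = 1) ∧
    (∀ x : Fin 2 → A, FirstOrder.Language.Structure.funMap (L := fullLang) FieldFun.add x = x 0 + x 1) ∧
    (∀ x : Fin 2 → A, FirstOrder.Language.Structure.funMap (L := fullLang) FieldFun.mul x = x 0 * x 1) ∧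
    (∀ x : Fin 2 → A, FirstOrder.Language.Structure.RelMap (L := fullLang) FullRel.le x ↔ x 0 ≤ x 1)

/-- A hyperreal field, given together with its interpretation of the relations on the reals:
an ordered field which is a proper complete elementary extension of the reals. -/
def IsHyperreal (A : Type*) [fullLang.Structure A] : Prop :=
  IsOrderedFieldStructure A ∧
    ∃ e : Eudoxus ↪ₑ[fullLang] A, ¬ Function.Surjective e

/-! ### Definable classes

The universe of sets is `ZFSet`, with the membership relation and a global well-ordering `r`
(in strict form). The classes are the subclasses which are first-order definable, with sets as
parameters, from membership and the well-ordering. -/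

/-- The relation symbols `∈` and `≤` of the language of set theory with a global well-ordering. -/
inductive SetRel : ℕ → Type
  | mem : SetRel 2
  | le : SetRel 2

/-- The language of set theory with a global well-ordering. -/
def setLang : FirstOrder.Language.{0, 0} := ⟨fun _ => Empty, SetRel⟩

/-- The universe of sets as a structure. -/
@[reducible] def setStructure (r : ZFSet.{u} → ZFSet.{u} → Prop) : setLang.Structure ZFSet.{u} where
  funMap {_} f := f.elim
  RelMap {_} R := match R with
    | SetRel.mem => fun x => x 0 ∈ x 1
    | SetRel.le => fun x => r (x 0) (x 1) ∨ x 0 = x 1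

/-- The `n`-ary relation `P` between sets is first-order definable with parameters. -/
def IsDef (r : ZFSet.{u} → ZFSet.{u} → Prop) {n : ℕ} (P : (Fin n → ZFSet.{u}) → Prop) : Prop :=
  @Set.Definable ZFSet.{u} Set.univ setLang (setStructure r) (Fin n) {v | P v}

namespace IsDef

variable {r : ZFSet.{u} → ZFSet.{u} → Prop} {n : ℕ}

theorem congr {P Q : (Fin n → ZFSet.{u}) → Prop} (h : IsDef r P) (hPQ : ∀ v, Q v ↔ P v) :
    IsDef r Q := by
  have : Q = P := funext fun v => propext (hPQ v)
  rwa [this]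

theorem and {P Q : (Fin n → ZFSet.{u}) → Prop} (hP : IsDef r P) (hQ : IsDef r Q) :
    IsDef r fun v => P v ∧ Q v := by
  let _ := setStructure r
  exact Set.Definable.inter hP hQ

theorem or {P Q : (Fin n → ZFSet.{u}) → Prop} (hP : IsDef r P) (hQ : IsDef r Q) :
    IsDef r fun v => P v ∨ Q v := by
  let _ := setStructure r
  exact Set.Definable.union hP hQ

theorem not {P : (Fin n → ZFSet.{u}) → Prop} (hP : IsDef r P) : IsDef r fun v => ¬ P v := by
  let _ := setStructure r
  exact Set.Definable.compl hP

theorem imp {P Q : (Fin n → ZFSet.{u}) → Prop} (hP : IsDef r P) (hQ : IsDef r Q) :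
    IsDef r fun v => P v → Q v :=
  (hP.not.or hQ).congr fun _ => imp_iff_not_or

theorem iff {P Q : (Fin n → ZFSet.{u}) → Prop} (hP : IsDef r P) (hQ : IsDef r Q) :
    IsDef r fun v => P v ↔ Q v :=
  ((hP.imp hQ).and (hQ.imp hP)).congr fun _ => iff_iff_implies_and_implies

theorem subst {m : ℕ} {P : (Fin m → ZFSet.{u}) → Prop} (hP : IsDef r P) (f : Fin m → Fin n) :
    IsDef r fun v : Fin n → ZFSet.{u} => P fun i => v (f i) := by
  let _ := setStructure r
  exact Set.Definable.preimage_comp f hP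

theorem subst1 {P : (Fin 1 → ZFSet.{u}) → Prop} (hP : IsDef r P) (i : Fin n) :
    IsDef r fun v : Fin n → ZFSet.{u} => P ![v i] :=
  (hP.subst ![i]).congr fun v => by
    rw [show (fun k => v ((![i] : Fin 1 → Fin n) k)) = ![v i] from
      funext fun k => by fin_cases k; rfl]

theorem subst3 {P : (Fin 3 → ZFSet.{u}) → Prop} (hP : IsDef r P) (i j k : Fin n) :
    IsDef r fun v : Fin n → ZFSet.{u} => P ![v i, v j, v k] :=
  (hP.subst ![i, j, k]).congr fun v => by
    rw [show (fun l => v ((![i, j, k] : Fin 3 → Fin n) l)) = ![v i, v j, v k] from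
      funext fun l => by fin_cases l <;> rfl]

theorem ex {Q : (Fin n → ZFSet.{u}) → ZFSet.{u} → Prop}
    (h : IsDef r fun w : Fin (n + 1) → ZFSet.{u} => Q (fun i => w i.succ) (w 0)) :
    IsDef r fun v => ∃ x, Q v x := by
  let _ := setStructure r
  have := Set.Definable.image_comp (A := Set.univ) (L := setLang) h (Fin.succ : Fin n → Fin (n + 1))
  unfold IsDef
  convert this using 1
  ext v
  simp only [Set.mem_ofPred_eq, Set.mem_image]
  constructor
  · rintro ⟨x, hx⟩
    exact ⟨Fin.cons x v, by simpa using hx, by ext i; simp⟩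
  · rintro ⟨w, hw, rfl⟩
    exact ⟨w 0, hw⟩

theorem all {Q : (Fin n → ZFSet.{u}) → ZFSet.{u} → Prop}
    (h : IsDef r fun w : Fin (n + 1) → ZFSet.{u} => Q (fun i => w i.succ) (w 0)) :
    IsDef r fun v => ∀ x, Q v x :=
  ((ex (Q := fun v x => ¬ Q v x) h.not).not).congr fun v => by simp

theorem mem (i j : Fin n) : IsDef r fun v : Fin n → ZFSet.{u} => v i ∈ v j := by
  let _ := setStructure r
  refine ⟨FirstOrder.Language.Relations.formula₂ (L := setLang[[(Set.univ : Set ZFSet.{u})]])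
    (Sum.inl SetRel.mem) (FirstOrder.Language.Term.var i) (FirstOrder.Language.Term.var j), ?_⟩
  ext v
  simp only [Set.mem_ofPred_eq]
  rfl

theorem eq (i j : Fin n) : IsDef r fun v : Fin n → ZFSet.{u} => v i = v j :=
  (all (Q := fun v x => x ∈ v i ↔ x ∈ v j) ((mem 0 i.succ).iff (mem 0 j.succ))).congr
    fun _ => ⟨fun h x => by rw [h], fun h => ZFSet.ext h⟩

theorem eq_const (i : Fin n) (a : ZFSet.{u}) : IsDef r fun v : Fin n → ZFSet.{u} => v i = a := by
  let _ := setStructure r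
  refine ⟨FirstOrder.Language.Term.equal (FirstOrder.Language.Term.var i)
    (FirstOrder.Language.Constants.term (L := setLang[[(Set.univ : Set ZFSet.{u})]])
      (FirstOrder.Language.con setLang (⟨a, Set.mem_univ a⟩ : (Set.univ : Set ZFSet.{u})))), ?_⟩
  ext v
  simp [FirstOrder.Language.Formula.realize_equal]

theorem mem_const (i : Fin n) (a : ZFSet.{u}) : IsDef r fun v : Fin n → ZFSet.{u} => v i ∈ a :=
  (ex (Q := fun v x => x = a ∧ v i ∈ x) ((eq_const 0 a).and (mem i.succ 0))).congr
    fun _ => by simp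

theorem doubleton (i j k : Fin n) :
    IsDef r fun v : Fin n → ZFSet.{u} => v k = {v i, v j} :=
  (all (Q := fun v x => x ∈ v k ↔ (x = v i ∨ x = v j))
    ((mem 0 k.succ).iff ((eq 0 i.succ).or (eq 0 j.succ)))).congr
    fun _ => by simp [ZFSet.ext_iff]

theorem pair (i j k : Fin n) :
    IsDef r fun v : Fin n → ZFSet.{u} => v k = ZFSet.pair (v i) (v j) :=
  (ex (Q := fun v x => ∃ y, x = {v i, v i} ∧ y = {v i, v j} ∧ v k = {x, y})
    (ex (Q := fun w y => w 0 = {w i.succ, w i.succ} ∧ y = {w i.succ, w j.succ} ∧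
        w k.succ = {w 0, y})
      ((doubleton i.succ.succ i.succ.succ (Fin.succ 0)).and
        ((doubleton i.succ.succ j.succ.succ 0).and
          (doubleton (Fin.succ 0) 0 k.succ.succ))))).congr
    fun _ => by simp [ZFSet.pair]

theorem pair_mem_const (i j : Fin n) (a : ZFSet.{u}) :
    IsDef r fun v : Fin n → ZFSet.{u} => ZFSet.pair (v i) (v j) ∈ a :=
  (ex (Q := fun v x => x = ZFSet.pair (v i) (v j) ∧ x ∈ a)
    ((pair i.succ j.succ 0).and (mem_const 0 a))).congr fun _ => by simp

theorem triple_mem_const (i j k : Fin n) (a : ZFSet.{u}) :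
    IsDef r fun v : Fin n → ZFSet.{u} => ZFSet.pair (v i) (ZFSet.pair (v j) (v k)) ∈ a :=
  (ex (Q := fun v x => x = ZFSet.pair (v j) (v k) ∧ ZFSet.pair (v i) x ∈ a)
    ((pair j.succ k.succ 0).and (pair_mem_const i.succ 0 a))).congr fun _ => by simp

/-- A ternary relation whose graph is a set is definable. -/
theorem small3 {ι : Type} (a b c : ι → ZFSet.{u}) :
    IsDef r fun v : Fin 3 → ZFSet.{u} => ∃ i, v 0 = a i ∧ v 1 = b i ∧ v 2 = c i :=
  (triple_mem_const 0 1 2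
    (ZFSet.range fun i => ZFSet.pair (a i) (ZFSet.pair (b i) (c i)))).congr fun v => by
      rw [ZFSet.mem_range]
      refine exists_congr fun i => ?_
      rw [ZFSet.pair_inj, ZFSet.pair_inj, eq_comm (a := a i), eq_comm (a := b i),
        eq_comm (a := c i)]

end IsDef

/-! ### Coding integers and finite sequences by sets -/

/-- The von Neumann numeral of a natural number. -/
noncomputable def natCode (n : ℕ) : ZFSet.{u} := Ordinal.toZFSet (n : Ordinal.{u})

theorem natCode_injective : Function.Injective natCode.{u} := fun m n h => by
  simpa using Ordinal.toZFSet_injective h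

/-- The set which codes an integer. -/
noncomputable def intCode : ℤ → ZFSet.{u}
  | Int.ofNat n => ZFSet.pair (natCode 0) (natCode n)
  | Int.negSucc n => ZFSet.pair (natCode 1) (natCode n)

theorem intCode_injective : Function.Injective intCode.{u} := by
  intro m n h
  have h01 : natCode.{u} 0 ≠ natCode.{u} 1 := fun h => zero_ne_one (natCode_injective h)
  cases m <;> cases n <;>
    simp_all [intCode, ZFSet.pair_inj, natCode_injective.eq_iff, eq_comm]

/-- A finite sequence of sets as a set: the function `i ↦ x i` on the numeral `m`. -/
noncomputable def seqCode {m : ℕ} (x : Fin m → ZFSet.{u}) : ZFSet.{u} :=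
  ZFSet.range fun i : Fin m => ZFSet.pair (natCode i) (x i)

/-! ### Definable structures -/

/-- A structure, the elements of which are named by the elements of the class `X` (through
`name`), is definable: equality of the named elements, the operations and the relations are
definable classes of names. The function and relation symbols of a language form a set, and
are coded by sets through an injective map, on the choice of which nothing depends. -/
structure IsDefNamed (r : ZFSet.{u} → ZFSet.{u} → Prop) (L : FirstOrder.Language.{0, 0}) (X : Set ZFSet.{u})
    {A : Type*} [L.Structure A] (name : X → A) : Prop where
  eq_def : IsDef r fun v : Fin 2 → ZFSet.{u} => ∃ a b : X,
    v 0 = a ∧ v 1 = b ∧ name a = name b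
  fun_def : ∃ c : (Σ n, L.Functions n) → ZFSet.{u}, Function.Injective c ∧
    IsDef r fun v : Fin 3 → ZFSet.{u} => ∃ (n : ℕ) (f : L.Functions n) (a : Fin n → X) (b : X),
      v 0 = c ⟨n, f⟩ ∧ v 1 = seqCode (fun i => (a i : ZFSet.{u})) ∧ v 2 = b ∧
        FirstOrder.Language.Structure.funMap f (fun i => name (a i)) = name b
  rel_def : ∃ c : (Σ n, L.Relations n) → ZFSet.{u}, Function.Injective c ∧
    IsDef r fun v : Fin 2 → ZFSet.{u} => ∃ (n : ℕ) (R : L.Relations n) (a : Fin n → X),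
      v 0 = c ⟨n, R⟩ ∧ v 1 = seqCode (fun i => (a i : ZFSet.{u})) ∧
        FirstOrder.Language.Structure.RelMap R (fun i => name (a i))

/-- The class `D` is definable. -/
def IsDefClass (r : ZFSet.{u} → ZFSet.{u} → Prop) (D : Set ZFSet.{u}) : Prop :=
  IsDef r fun v : Fin 1 → ZFSet.{u} => v 0 ∈ D

/-- A definable structure: its base set is a definable class (possibly a set), and its operations
and relations are definable classes. -/
def IsDefStructure (r : ZFSet.{u} → ZFSet.{u} → Prop) (L : FirstOrder.Language.{0, 0}) (D : Set ZFSet.{u})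
    [L.Structure D] : Prop :=
  IsDefClass r D ∧ IsDefNamed r L D (fun d : D => d)

/-! ### Finite sets of ordinals and definable ultrafilters -/

/-- The class of all finite sets of ordinals. -/
def FinOrd : Set ZFSet.{u} :=
  {s | (s : Set ZFSet.{u}).Finite ∧ ∀ a ∈ s, a.IsOrdinal}

/-- A non-principal ultrafilter on the algebra of definable subclasses of the class of finite sets
of ordinals, which contains for each ordinal `α` the class of all `s` with `α ∈ s`, and is
definable: for every definable family of classes, the class of the indices of its members in the
ultrafilter is definable. -/
structure DefUltrafilter (r : ZFSet.{u} → ZFSet.{u} → Prop) where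
  carrier : Set (Set ZFSet.{u})
  subset_of_mem : ∀ X ∈ carrier, X ⊆ FinOrd
  def_of_mem : ∀ X ∈ carrier, IsDefClass r X
  univ_mem : FinOrd ∈ carrier
  empty_notMem : ∅ ∉ carrier
  inter_mem : ∀ X ∈ carrier, ∀ Y ∈ carrier, X ∩ Y ∈ carrier
  mem_of_superset : ∀ X ∈ carrier, ∀ Y, X ⊆ Y → Y ⊆ FinOrd → IsDefClass r Y → Y ∈ carrier
  mem_or_compl_mem : ∀ X, X ⊆ FinOrd → IsDefClass r X → X ∈ carrier ∨ FinOrd \ X ∈ carrier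
  nonprincipal : ∀ s, {s} ∉ carrier
  hat_mem : ∀ α : ZFSet.{u}, α.IsOrdinal → {s ∈ FinOrd | α ∈ s} ∈ carrier
  family_def : ∀ T : (Fin 2 → ZFSet.{u}) → Prop, IsDef r T →
    IsDefClass r {a | {s ∈ FinOrd | T ![a, s]} ∈ carrier}

instance (r : ZFSet.{u} → ZFSet.{u} → Prop) : Membership (Set ZFSet.{u}) (DefUltrafilter r) :=
  ⟨fun U X => X ∈ U.carrier⟩

theorem isDef_finOrd (r : ZFSet.{u} → ZFSet.{u} → Prop) : IsDefClass r FinOrd.{u} := by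
  have key : ∀ s : ZFSet.{u}, s ∈ FinOrd ↔
      (∀ A : ZFSet.{u}, (∀ e, (∀ w, ¬ w ∈ e) → e ∈ A) →
        (∀ t, t ∈ A → ∀ x, x ∈ s → ∀ z, (∀ w, w ∈ z ↔ (w = x ∨ w ∈ t)) → z ∈ A) → s ∈ A) ∧
      (∀ a, a ∈ s → (∀ b, b ∈ a → ∀ c, c ∈ b → c ∈ a) ∧
        (∀ b, b ∈ a → ∀ c, c ∈ b → ∀ d, d ∈ c → d ∈ b)) := by
    intro s
    refine and_congr ⟨fun hs A h0 h1 => ?_, fun h => ?_⟩ (forall₂_congr fun a _ => ?_)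
    · have main : ∀ t : Set ZFSet.{u}, t.Finite → t ⊆ (s : Set ZFSet.{u}) →
          ∃ z ∈ A, (z : Set ZFSet.{u}) = t := by
        intro t ht
        induction t, ht using Set.Finite.induction_on with
        | empty => exact fun _ => ⟨∅, h0 _ ZFSet.notMem_empty, by simp⟩
        | @insert x t _ _ ih =>
          intro hts
          obtain ⟨z, hz, rfl⟩ := ih ((Set.subset_insert _ _).trans hts)
          exact ⟨insert x z, h1 z hz x (hts (Set.mem_insert _ _)) _ (by simp), by simp⟩
      obtain ⟨z, hz, hzs⟩ := main _ hs subset_rfl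
      rwa [SetLike.coe_injective hzs] at hz
    · have := h (ZFSet.sep (fun t => (t : Set ZFSet.{u}).Finite) s.powerset)
        (fun e he => by
          rw [(ZFSet.eq_empty e).2 he]
          simp)
        (fun t ht x hx z hz => by
          rw [show z = insert x t from ZFSet.ext fun w => by rw [hz, ZFSet.mem_insert_iff] ]
          rw [ZFSet.mem_sep, ZFSet.mem_powerset] at ht ⊢
          refine ⟨fun w hw => ?_, ?_⟩
          · rcases ZFSet.mem_insert_iff.1 hw with rfl | hw
            · exact hx
            · exact ht.1 hw
          · simpa using ht.2.insert x)
      exact (ZFSet.mem_sep.1 this).2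
    · rw [ZFSet.isOrdinal_iff_forall_mem_isTransitive]
      exact Iff.rfl
  refine IsDef.congr (IsDef.and ?_ ?_) fun v => key (v 0)
  · refine IsDef.all (IsDef.imp (IsDef.all (IsDef.imp (IsDef.all (IsDef.not ?_)) ?_))
      (IsDef.imp (IsDef.all (IsDef.imp ?_ (IsDef.all (IsDef.imp ?_ (IsDef.all
        (IsDef.imp (IsDef.all (IsDef.iff ?_ (IsDef.or ?_ ?_))) ?_)))))) ?_))
    · exact IsDef.mem 0 1
    · exact IsDef.mem 0 1
    · exact IsDef.mem 0 1
    · exact IsDef.mem 0 3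
    · exact IsDef.mem 0 1
    · exact IsDef.eq 0 2
    · exact IsDef.mem 0 3
    · exact IsDef.mem 0 3
    · exact IsDef.mem 1 0
  · refine IsDef.all (IsDef.imp ?_ (IsDef.and
      (IsDef.all (IsDef.imp ?_ (IsDef.all (IsDef.imp ?_ ?_))))
      (IsDef.all (IsDef.imp ?_ (IsDef.all (IsDef.imp ?_ (IsDef.all (IsDef.imp ?_ ?_))))))))
    · exact IsDef.mem 0 1
    · exact IsDef.mem 0 1
    · exact IsDef.mem 0 1
    · exact IsDef.mem 0 2
    · exact IsDef.mem 0 1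
    · exact IsDef.mem 0 1
    · exact IsDef.mem 0 1
    · exact IsDef.mem 0 2

/-! ### Definable families of almost homomorphisms -/

/-- The graph of a class function from pairs of an integer and a finite set of ordinals to the
integers. -/
def graph (F : ℤ → FinOrd.{u} → ℤ) (v : Fin 3 → ZFSet.{u}) : Prop :=
  ∃ (p : ℤ) (s : FinOrd.{u}), v 0 = intCode p ∧ v 1 = s ∧ v 2 = intCode (F p s)

theorem graph_iff (F : ℤ → FinOrd.{u} → ℤ) (p : ℤ) (s : FinOrd.{u}) (x : ZFSet.{u}) :
    graph F ![intCode p, s, x] ↔ x = intCode (F p s) := by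
  constructor
  · rintro ⟨q, t, h1, h2, h3⟩
    obtain rfl := intCode_injective h1
    obtain rfl := Subtype.ext h2
    exact h3
  · rintro rfl
    exact ⟨p, s, rfl, rfl, rfl⟩

/-- The definable class functions `F` of an integer and a finite set of ordinals, with integer
values, such that each `F(·, s)` is an almost homomorphism. -/
@[ext] structure DefAlmostHom (r : ZFSet.{u} → ZFSet.{u} → Prop) where
  toFun : ℤ → FinOrd.{u} → ℤ
  isAlmostHom : ∀ s, IsAlmostHom fun p => toFun p s
  isDef : IsDef r (graph toFun)

namespace DefAlmostHom

variable {r : ZFSet.{u} → ZFSet.{u} → Prop}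

/-- The Eudoxus real given by `F(·, s)`. -/
def slice (F : DefAlmostHom r) (s : FinOrd.{u}) : Eudoxus :=
  Eudoxus.mk (fun p => F.toFun p s) (F.isAlmostHom s)

/-- The zero function. -/
def zero : DefAlmostHom r where
  toFun _ _ := 0
  isAlmostHom _ := isAlmostHom_zero
  isDef := by
    refine IsDef.congr (((IsDef.mem_const 0 (ZFSet.range intCode.{u})).and
      ((isDef_finOrd r).subst1 1)).and (IsDef.eq_const 2 (intCode 0))) fun v => ?_
    simp only [graph, ZFSet.mem_range, Matrix.cons_val_zero]
    constructor
    · rintro ⟨p, s, h0, h1, h2⟩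
      exact ⟨⟨⟨p, h0.symm⟩, h1 ▸ s.2⟩, h2⟩
    · rintro ⟨⟨⟨p, h0⟩, h1⟩, h2⟩
      exact ⟨p, ⟨v 1, h1⟩, h0.symm, rfl, h2⟩

/-- The projection to the integers. -/
def one : DefAlmostHom r where
  toFun p _ := p
  isAlmostHom _ := isAlmostHom_id
  isDef := by
    refine IsDef.congr (((IsDef.mem_const 0 (ZFSet.range intCode.{u})).and
      ((isDef_finOrd r).subst1 1)).and (IsDef.eq 2 0)) fun v => ?_
    simp only [graph, ZFSet.mem_range, Matrix.cons_val_zero]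
    constructor
    · rintro ⟨p, s, h0, h1, h2⟩
      exact ⟨⟨⟨p, h0.symm⟩, h1 ▸ s.2⟩, h2.trans h0.symm⟩
    · rintro ⟨⟨⟨p, h0⟩, h1⟩, h2⟩
      exact ⟨p, ⟨v 1, h1⟩, h0.symm, rfl, h2.trans h0.symm⟩

/-- Pointwise addition. -/
def add (F G : DefAlmostHom r) : DefAlmostHom r where
  toFun p s := F.toFun p s + G.toFun p s
  isAlmostHom s := (F.isAlmostHom s).add (G.isAlmostHom s)
  isDef := by
    refine IsDef.congr (IsDef.ex (Q := fun v a => ∃ b, graph F.toFun ![v 0, v 1, a] ∧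
        graph G.toFun ![v 0, v 1, b] ∧ ∃ i : ℤ × ℤ, a = intCode i.1 ∧ b = intCode i.2 ∧
          v 2 = intCode (i.1 + i.2))
      (IsDef.ex (Q := fun w b => graph F.toFun ![w 1, w 2, w 0] ∧
        graph G.toFun ![w 1, w 2, b] ∧ ∃ i : ℤ × ℤ, w 0 = intCode i.1 ∧ b = intCode i.2 ∧
          w 3 = intCode (i.1 + i.2))
      ((F.isDef.subst3 2 3 1).and ((G.isDef.subst3 2 3 0).and
        ((IsDef.small3 (fun i : ℤ × ℤ => intCode i.1) (fun i => intCode i.2)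
          (fun i => intCode (i.1 + i.2))).subst3 1 0 4))))) fun v => ?_
    constructor
    · rintro ⟨p, s, h0, h1, h2⟩
      refine ⟨intCode (F.toFun p s), intCode (G.toFun p s), ?_, ?_, (F.toFun p s, G.toFun p s),
        rfl, rfl, h2⟩
      · rw [h0, h1, graph_iff]
      · rw [h0, h1, graph_iff]
    · rintro ⟨a, b, ⟨p, s, h0, h1, h2⟩, h3, i, hi1, hi2, hi3⟩
      simp only [Matrix.cons_val_zero, Matrix.cons_val_one, Matrix.cons_val] at h0 h1 h2
      rw [h0, h1, graph_iff] at h3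
      obtain h4 := intCode_injective (hi1.symm.trans h2)
      obtain h5 := intCode_injective (hi2.symm.trans h3)
      exact ⟨p, s, h0, h1, by rw [hi3, h4, h5]⟩

/-- Composition in the integer variable. -/
def comp (F G : DefAlmostHom r) : DefAlmostHom r where
  toFun p s := F.toFun (G.toFun p s) s
  isAlmostHom s := (F.isAlmostHom s).comp (G.isAlmostHom s)
  isDef := by
    refine IsDef.congr (IsDef.ex (Q := fun v a => graph G.toFun ![v 0, v 1, a] ∧
        graph F.toFun ![a, v 1, v 2])
      ((G.isDef.subst3 1 2 0).and (F.isDef.subst3 0 2 3))) fun v => ?_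
    constructor
    · rintro ⟨p, s, h0, h1, h2⟩
      refine ⟨intCode (G.toFun p s), ?_, ?_⟩
      · rw [h0, h1, graph_iff]
      · rw [h1, graph_iff, h2]
    · rintro ⟨a, ⟨p, s, h0, h1, h2⟩, h3⟩
      simp only [Matrix.cons_val_zero, Matrix.cons_val_one, Matrix.cons_val] at h0 h1 h2
      rw [h2, h1, graph_iff] at h3
      exact ⟨p, s, h0, h1, h3⟩

/-- The class of all `s` such that `F(·, s) - G(·, s)` is bounded. -/
def agree (F G : DefAlmostHom r) : Set ZFSet.{u} :=
  {s | ∃ h : s ∈ FinOrd, IsBdd fun p => F.toFun p ⟨s, h⟩ - G.toFun p ⟨s, h⟩}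

theorem agree_subset (F G : DefAlmostHom r) : agree F G ⊆ FinOrd := fun _ h => h.1

theorem isDef_agree (F G : DefAlmostHom r) : IsDefClass r (agree F G) := by
  refine IsDef.congr (((isDef_finOrd r).subst1 0).and (IsDef.ex (Q := fun v k => ∀ p a b,
      graph F.toFun ![p, v 0, a] → graph G.toFun ![p, v 0, b] →
        ∃ i : {i : ℤ × ℤ × ℤ // |i.1 - i.2.1| < i.2.2},
          a = intCode i.1.1 ∧ b = intCode i.1.2.1 ∧ k = intCode i.1.2.2)
    (IsDef.all (IsDef.all (IsDef.all (IsDef.imp (F.isDef.subst3 2 4 1)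
      (IsDef.imp (G.isDef.subst3 2 4 0) ((IsDef.small3
        (fun i : {i : ℤ × ℤ × ℤ // |i.1 - i.2.1| < i.2.2} => intCode i.1.1)
        (fun i => intCode i.1.2.1) (fun i => intCode i.1.2.2)).subst3 1 0 3)))))))) fun v => ?_
  constructor
  · rintro ⟨h, C, hC⟩
    refine ⟨h, intCode C, ?_⟩
    rintro p a b ⟨q, s, h0, h1, h2⟩ h3
    simp only [Matrix.cons_val_zero, Matrix.cons_val_one, Matrix.cons_val] at h0 h1 h2
    have hs : s = ⟨v 0, h⟩ := Subtype.ext h1.symm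
    subst hs
    rw [h0] at h3
    have h4 := (graph_iff G.toFun q ⟨v 0, h⟩ b).1 h3
    exact ⟨⟨(_, _, C), hC q⟩, h2, h4, rfl⟩
  · rintro ⟨h, k, hk⟩
    have hv : v 0 ∈ FinOrd := h
    have key : ∀ p : ℤ, ∃ C, k = intCode C ∧
        |F.toFun p ⟨v 0, hv⟩ - G.toFun p ⟨v 0, hv⟩| < C := by
      intro p
      obtain ⟨⟨i, hi⟩, h1, h2, h3⟩ := hk (intCode p) _ _
        ((graph_iff F.toFun p ⟨v 0, hv⟩ _).2 rfl) ((graph_iff G.toFun p ⟨v 0, hv⟩ _).2 rfl)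
      rw [intCode_injective h1, intCode_injective h2]
      exact ⟨_, h3, hi⟩
    obtain ⟨C, hC, -⟩ := key 0
    refine ⟨hv, C, fun p => ?_⟩
    obtain ⟨D, hD, hlt⟩ := key p
    rwa [intCode_injective (hC.symm.trans hD)]

end DefAlmostHom

/-! ### The quotient -/

section Quotient

variable {r : ZFSet.{u} → ZFSet.{u} → Prop} (U : DefUltrafilter r)

/-- Two definable families are equivalent if the class of all `s` with `F(·, s) - G(·, s)` bounded
is in the ultrafilter. -/
def familySetoid : Setoid (DefAlmostHom r) where
  r F G := DefAlmostHom.agree F G ∈ U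
  iseqv := by
    refine ⟨fun F => ?_, fun {F G} h => ?_, fun {F G H} h1 h2 => ?_⟩
    · exact U.mem_of_superset _ U.univ_mem _ (fun s hs => ⟨hs, 1, fun p => by simp⟩)
        (DefAlmostHom.agree_subset _ _) (DefAlmostHom.isDef_agree _ _)
    · refine U.mem_of_superset _ h _ ?_ (DefAlmostHom.agree_subset _ _)
        (DefAlmostHom.isDef_agree _ _)
      rintro s ⟨hs, C, hC⟩
      exact ⟨hs, C, fun p => by simpa only [abs_sub_comm] using hC p⟩
    · refine U.mem_of_superset _ (U.inter_mem _ h1 _ h2) _ ?_ (DefAlmostHom.agree_subset _ _)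
        (DefAlmostHom.isDef_agree _ _)
      rintro s ⟨⟨hs, h3⟩, ⟨_, h4⟩⟩
      refine ⟨hs, ?_⟩
      have := h3.add h4
      convert this using 2
      ring

/-- The definable families of almost homomorphisms modulo the ultrafilter. -/
def Hyper : Type (u + 1) := Quotient (familySetoid U)

namespace Hyper

/-- The class of a definable family. -/
def mk (F : DefAlmostHom r) : Hyper U := Quotient.mk (familySetoid U) F

/-- Addition is pointwise. -/
def add : Hyper U → Hyper U → Hyper U :=
  Quotient.map₂ DefAlmostHom.add (by
    intro F F' hF G G' hG
    refine U.mem_of_superset _ (U.inter_mem _ hF _ hG) _ ?_ (DefAlmostHom.agree_subset _ _)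
      (DefAlmostHom.isDef_agree _ _)
    rintro s ⟨⟨hs, h1⟩, ⟨_, h2⟩⟩
    refine ⟨hs, ?_⟩
    have := h1.add h2
    convert this using 2
    simp only [DefAlmostHom.add]
    ring)

/-- Multiplication is composition in the integer variable. -/
def mul : Hyper U → Hyper U → Hyper U :=
  Quotient.map₂ DefAlmostHom.comp (by
    intro F F' hF G G' hG
    refine U.mem_of_superset _ (U.inter_mem _ hF _ hG) _ ?_ (DefAlmostHom.agree_subset _ _)
      (DefAlmostHom.isDef_agree _ _)
    rintro s ⟨⟨hs, h1⟩, ⟨_, h2⟩⟩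
    refine ⟨hs, ?_⟩
    have h3 : IsBdd fun p => F.toFun (G.toFun p ⟨s, hs⟩) ⟨s, hs⟩ -
        F'.toFun (G.toFun p ⟨s, hs⟩) ⟨s, hs⟩ := by
      obtain ⟨C, hC⟩ := h1
      exact ⟨C, fun p => hC _⟩
    have h4 := h3.add ((F'.isAlmostHom ⟨s, hs⟩).comp_sub h2)
    convert h4 using 2
    simp only [DefAlmostHom.comp]
    ring)

/-- The order and the relations on the reals hold of classes of families if they hold of the
Eudoxus reals given by the families at `s`, for ultrafilter many `s`. -/
instance : fullLang.Structure (Hyper U) where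
  funMap {_} f := match f with
    | FieldFun.zero => fun _ => mk U DefAlmostHom.zero
    | FieldFun.one => fun _ => mk U DefAlmostHom.one
    | FieldFun.add => fun x => add U (x 0) (x 1)
    | FieldFun.mul => fun x => mul U (x 0) (x 1)
  RelMap {n} R := fun x => ∃ F : Fin n → DefAlmostHom r, (∀ i, mk U (F i) = x i) ∧
    {s : ZFSet.{u} | ∃ h : s ∈ FinOrd, FirstOrder.Language.Structure.RelMap (L := fullLang) R
      (fun i => (F i).slice ⟨s, h⟩)} ∈ U

end Hyper

end Quotient

/-- `Φ` is a definable family, indexed by the class `X`, of definable families of almost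
homomorphisms: the class of all `(a, p, s, q)` with `Φ(a)(p, s) = q` is definable. -/
def IsDefFamily {r : ZFSet.{u} → ZFSet.{u} → Prop} (X : Set ZFSet.{u})
    (Φ : X → DefAlmostHom r) : Prop :=
  IsDef r fun v : Fin 4 → ZFSet.{u} => ∃ (a : X) (p : ℤ) (s : FinOrd.{u}),
    v 0 = a ∧ v 1 = intCode p ∧ v 2 = s ∧ v 3 = intCode ((Φ a).toFun p s)

end ClassHyperreal

namespace ClassHyperreal

/-! ### Further closure properties of definable relations. -/

namespace IsDef

variable {r : ZFSet.{u} → ZFSet.{u} → Prop} {n : ℕ}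

/-! Existence of the ultrafilter. There are countably many formulas, and finitely many parameters
can be packed into one set, so every definable family of classes is a subfamily of one of countably
many definable families `T n` (`exists_universal_families`). These are treated one after the other.
At stage `n` the members of `T n` are run through along a definable injection of the universe into
the ordinals, and a member is accepted exactly when it is consistent with the definable family
obtained so far and with the earlier decisions. Consistency means that finite intersections are
nonempty. Finite sets of indices are coded by finite sets of ordinals, so this is a first-order
condition, and the recursion produces a definable class of accepted indices (`exists_decision`). The
stages generate one proper filter. It decides every definable class, and on each definable family it
is given by a definable class of indices.

The hyperreals. The type of Eudoxus reals is small, so it can be coded by a set, and every function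
or relation on it can serve as a parameter. A definable family of almost homomorphisms is thus the
same as a definable map from finite sets of ordinals to the reals, and such maps may be composed
with arbitrary functions on the reals. This provides the Skolem functions for the theorem of Łoś
(`realize_boundedFormula`), which gives the elementary embedding of the reals. The field axioms are
checked pointwise through the slope of a Eudoxus real. The elements given by `s ↦ |s ∩ α|`, for `α`
an ordinal, are pairwise distinct, so the quotient is not small (`not_small`), and the embedding
cannot be onto. Definability on codes comes from the definability of the ultrafilter.

Universality. A finite set of ordinals `s` selects finitely many elements and relation symbols of a
definable hyperreal field. By elementarity this finite fragment has a copy in the reals, and the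
well-ordering chooses one definably. The element `d` is sent to the class of the map taking `s` to
the copy of `d` at `s`. Any given element or symbol is selected by almost all `s`, so all relations
are preserved (`exists_family_relMap_iff`). As every formula is equivalent to a relation symbol in
an elementary extension of the reals, this map is elementary. -/

theorem app1 {P : ZFSet.{u} → Prop} (h : IsDef r fun v : Fin 1 → ZFSet.{u} => P (v 0))
    (i : Fin n) : IsDef r fun v : Fin n → ZFSet.{u} => P (v i) :=
  h.subst ![i]

theorem app2 {P : ZFSet.{u} → ZFSet.{u} → Prop}
    (h : IsDef r fun v : Fin 2 → ZFSet.{u} => P (v 0) (v 1)) (i j : Fin n) :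
    IsDef r fun v : Fin n → ZFSet.{u} => P (v i) (v j) :=
  h.subst ![i, j]

theorem app3 {P : ZFSet.{u} → ZFSet.{u} → ZFSet.{u} → Prop}
    (h : IsDef r fun v : Fin 3 → ZFSet.{u} => P (v 0) (v 1) (v 2)) (i j k : Fin n) :
    IsDef r fun v : Fin n → ZFSet.{u} => P (v i) (v j) (v k) :=
  h.subst ![i, j, k]

theorem app4 {P : ZFSet.{u} → ZFSet.{u} → ZFSet.{u} → ZFSet.{u} → Prop}
    (h : IsDef r fun v : Fin 4 → ZFSet.{u} => P (v 0) (v 1) (v 2) (v 3)) (i j k l : Fin n) :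
    IsDef r fun v : Fin n → ZFSet.{u} => P (v i) (v j) (v k) (v l) :=
  h.subst ![i, j, k, l]

theorem const (p : Prop) : IsDef r fun _ : Fin n → ZFSet.{u} => p := by
  let _ := setStructure r
  by_cases hp : p
  · simp [IsDef, hp]
  · simp [IsDef, hp]

/-- The well-ordering is definable. -/
theorem rel [IsWellOrder ZFSet.{u} r] (i j : Fin n) :
    IsDef r fun v : Fin n → ZFSet.{u} => r (v i) (v j) := by
  have h : IsDef r fun v : Fin n → ZFSet.{u} => r (v i) (v j) ∨ v i = v j := by
    let _ := setStructure r
    refine ⟨FirstOrder.Language.Relations.formula₂ (L := setLang[[(Set.univ : Set ZFSet.{u})]])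
      (Sum.inl SetRel.le) (FirstOrder.Language.Term.var i) (FirstOrder.Language.Term.var j), ?_⟩
    ext v
    simp only [Set.mem_ofPred_eq]
    rfl
  refine (h.and (IsDef.eq i j).not).congr fun v => ?_
  constructor
  · intro h
    exact ⟨Or.inl h, fun he => irrefl_of r (v j) (he ▸ h)⟩
  · tauto

theorem pair_mem (i j k : Fin n) :
    IsDef r fun v : Fin n → ZFSet.{u} => ZFSet.pair (v i) (v j) ∈ v k :=
  (ex (Q := fun v x => x = ZFSet.pair (v i) (v j) ∧ x ∈ v k)
    ((pair i.succ j.succ 0).and (mem 0 k.succ))).congr fun _ => by simp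

theorem pair_const_mem (a : ZFSet.{u}) (j k : Fin n) :
    IsDef r fun v : Fin n → ZFSet.{u} => ZFSet.pair a (v j) ∈ v k :=
  (ex (Q := fun v x => x = a ∧ ZFSet.pair x (v j) ∈ v k)
    ((eq_const 0 a).and (pair_mem 0 j.succ k.succ))).congr fun _ => by simp

theorem const_mem (a : ZFSet.{u}) (i : Fin n) :
    IsDef r fun v : Fin n → ZFSet.{u} => a ∈ v i :=
  (ex (Q := fun v x => x = a ∧ x ∈ v i) ((eq_const 0 a).and (mem 0 i.succ))).congr
    fun _ => by simp

/-- A set is an ordinal exactly when its singleton belongs to `FinOrd`, which is already known to be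
definable. -/
theorem isOrdinal (i : Fin n) : IsDef r fun v : Fin n → ZFSet.{u} => (v i).IsOrdinal := by
  refine (ex (Q := fun v x => x = {v i, v i} ∧ x ∈ FinOrd)
    ((doubleton i.succ i.succ 0).and ((isDef_finOrd r).app1 0))).congr fun v => ?_
  simp [FinOrd]

end IsDef

/-- The class function `F` is definable. -/
def IsDefFun (r : ZFSet.{u} → ZFSet.{u} → Prop) (F : ZFSet.{u} → ZFSet.{u}) : Prop :=
  IsDef r fun v : Fin 2 → ZFSet.{u} => v 1 = F (v 0)

theorem IsDefFun.app {r : ZFSet.{u} → ZFSet.{u} → Prop} {n : ℕ} {F : ZFSet.{u} → ZFSet.{u}}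
    (h : IsDefFun r F) (i j : Fin n) : IsDef r fun v : Fin n → ZFSet.{u} => v j = F (v i) :=
  IsDef.subst (m := 2) h ![i, j]

/-! ### Definability of recursively defined relations and functions -/

section Recursion

variable {r : ZFSet.{u} → ZFSet.{u} → Prop} {R : ZFSet.{u} → ZFSet.{u} → Prop}

/-- A class which is defined by recursion along a definable well-founded set-like relation is
definable. -/
theorem isDef_of_recursion (hwf : WellFounded R)
    (hR : IsDef r fun v : Fin 2 → ZFSet.{u} => R (v 0) (v 1))
    (hcl : ∀ x, ∃ t : ZFSet.{u}, x ∈ t ∧ ∀ y ∈ t, ∀ z, R z y → z ∈ t)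
    {P : ZFSet.{u} → Prop} {G : ZFSet.{u} → ZFSet.{u} → Prop}
    (hG : IsDef r fun v : Fin 2 → ZFSet.{u} => G (v 0) (v 1))
    (hPG : ∀ x h, (∀ y, R y x → (y ∈ h ↔ P y)) → (G x h ↔ P x)) :
    IsDef r fun v : Fin 1 → ZFSet.{u} => P (v 0) := by
  -- The recursion is replaced by a set approximation: `h` obeys the recursion clause on a set `t`
  -- closed under predecessors. Well-founded induction shows that any such `h` agrees with `P` on
  -- `t`.
  have key : ∀ x, P x ↔ ∃ h t : ZFSet.{u}, x ∈ t ∧ (∀ y, y ∈ t → ∀ z, R z y → z ∈ t) ∧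
      (∀ y, y ∈ t → (y ∈ h ↔ G y h)) ∧ x ∈ h := by
    intro x
    constructor
    · intro hx
      obtain ⟨t, hxt, ht⟩ := hcl x
      refine ⟨ZFSet.sep P t, t, hxt, ht, fun y hy => ?_, ZFSet.mem_sep.2 ⟨hxt, hx⟩⟩
      rw [ZFSet.mem_sep, hPG y]
      · tauto
      · intro z hz
        rw [ZFSet.mem_sep]
        exact and_iff_right (ht y hy z hz)
    · rintro ⟨h, t, hxt, ht, hh, hx⟩
      have : ∀ y, y ∈ t → (y ∈ h ↔ P y) := by
        intro y
        induction y using hwf.induction with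
        | _ y ih =>
          intro hy
          rw [hh y hy]
          exact hPG y h fun z hz => ih z hz (ht y hy z hz)
      exact (this x hxt).1 hx
  refine IsDef.congr ?_ fun v => key (v 0)
  refine .ex (.ex (.and ?_ (.and (.all (.imp ?_ (.all (.imp ?_ ?_))))
    (.and (.all (.imp ?_ (.iff ?_ ?_))) ?_))))
  all_goals first | exact hR.app2 _ _ | exact hG.app2 _ _ | exact IsDef.mem _ _

/-- A class function which is defined by recursion along a definable well-founded set-like relation
is definable. -/
theorem isDef_graph_of_recursion (hwf : WellFounded R)
    (hR : IsDef r fun v : Fin 2 → ZFSet.{u} => R (v 0) (v 1))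
    (hcl : ∀ x, ∃ t : ZFSet.{u}, x ∈ t ∧ ∀ y ∈ t, ∀ z, R z y → z ∈ t)
    {F : ZFSet.{u} → ZFSet.{u}} {G : ZFSet.{u} → ZFSet.{u} → ZFSet.{u} → Prop}
    (hG : IsDef r fun v : Fin 3 → ZFSet.{u} => G (v 0) (v 1) (v 2))
    (hFG : ∀ x h, (∀ y, R y x → ∀ w, ZFSet.pair y w ∈ h ↔ w = F y) → ∀ w, G x h w ↔ w = F x) :
    IsDefFun r F := by
  have key : ∀ x u, u = F x ↔ ∃ h t : ZFSet.{u}, x ∈ t ∧ (∀ y, y ∈ t → ∀ z, R z y → z ∈ t) ∧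
      (∀ y, y ∈ t → ∀ w, (ZFSet.pair y w ∈ h ↔ G y h w)) ∧ ZFSet.pair x u ∈ h := by
    intro x u
    constructor
    · rintro rfl
      obtain ⟨t, hxt, ht⟩ := hcl x
      have hmem : ∀ y w, ZFSet.pair y w ∈ ZFSet.range (fun y : t => ZFSet.pair y.1 (F y.1)) ↔
          y ∈ t ∧ w = F y := by
        intro y w
        rw [ZFSet.mem_range]
        constructor
        · rintro ⟨z, hz⟩
          obtain ⟨rfl, rfl⟩ := ZFSet.pair_inj.1 hz
          exact ⟨z.2, rfl⟩
        · rintro ⟨hy, rfl⟩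
          exact ⟨⟨y, hy⟩, rfl⟩
      refine ⟨ZFSet.range (fun y : t => ZFSet.pair y.1 (F y.1)), t, hxt, ht, fun y hy w => ?_,
        (hmem _ _).2 ⟨hxt, rfl⟩⟩
      rw [hmem, hFG y]
      · exact and_iff_right hy
      · intro z hz w
        rw [hmem]
        exact and_iff_right (ht y hy z hz)
    · rintro ⟨h, t, hxt, ht, hh, hx⟩
      have : ∀ y, y ∈ t → ∀ w, (ZFSet.pair y w ∈ h ↔ w = F y) := by
        intro y
        induction y using hwf.induction with
        | _ y ih =>
          intro hy w
          rw [hh y hy]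
          exact hFG y h (fun z hz => ih z hz (ht y hy z hz)) w
      exact (this x hxt u).1 hx
  refine IsDef.congr ?_ fun v => key (v 0) (v 1)
  refine .ex (.ex (.and ?_ (.and (.all (.imp ?_ (.all (.imp ?_ ?_))))
    (.and (.all (.imp ?_ (.all (.iff ?_ ?_)))) ?_))))
  all_goals first | exact hR.app2 _ _ | exact hG.app3 _ _ _ | exact IsDef.mem _ _ |
    exact IsDef.pair_mem _ _ _

/-- The rank function of a definable well-founded set-like relation is definable. -/
theorem isDef_rank (hwf : WellFounded R)
    (hR : IsDef r fun v : Fin 2 → ZFSet.{u} => R (v 0) (v 1))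
    (hcl : ∀ x, ∃ t : ZFSet.{u}, x ∈ t ∧ ∀ y ∈ t, ∀ z, R z y → z ∈ t)
    {o : ZFSet.{u} → Ordinal.{u}} (ho : ∀ x α, α < o x ↔ ∃ y, R y x ∧ α ≤ o y) :
    IsDefFun r fun x => (o x).toZFSet := by
  -- The rank is the supremum of the successors of the ranks of the predecessors, so its elements
  -- are the ordinals below or equal to one of these.
  refine isDef_graph_of_recursion hwf hR hcl
    (G := fun x h w => ∀ z, z ∈ w ↔ ∃ y, R y x ∧ ∃ a, ZFSet.pair y a ∈ h ∧ (z ∈ a ∨ z = a)) ?_ ?_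
  · refine .all (.iff ?_ (.ex (.and ?_ (.ex (.and ?_ (.or ?_ ?_))))))
    all_goals first | exact hR.app2 _ _ | exact IsDef.mem _ _ |
      exact IsDef.pair_mem _ _ _ | exact IsDef.eq _ _
  · intro x h hh w
    rw [ZFSet.ext_iff]
    refine forall_congr' fun z => ?_
    have : z ∈ (o x).toZFSet ↔ ∃ y, R y x ∧ ∃ a, ZFSet.pair y a ∈ h ∧ (z ∈ a ∨ z = a) := by
      rw [Ordinal.mem_toZFSet_iff]
      constructor
      · rintro ⟨α, hα, rfl⟩
        obtain ⟨y, hy, hαy⟩ := (ho x α).1 hα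
        refine ⟨y, hy, _, (hh y hy _).2 rfl, ?_⟩
        rcases hαy.lt_or_eq with h | h
        · exact Or.inl (Ordinal.toZFSet_mem_toZFSet_iff.2 h)
        · exact Or.inr (by rw [h])
      · rintro ⟨y, hy, a, ha, hz⟩
        obtain rfl := (hh y hy a).1 ha
        rcases hz with hz | rfl
        · obtain ⟨α, hα, rfl⟩ := Ordinal.mem_toZFSet_iff.1 hz
          exact ⟨α, (ho x α).2 ⟨y, hy, hα.le⟩, rfl⟩
        · exact ⟨o y, (ho x _).2 ⟨y, hy, le_rfl⟩, rfl⟩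
    rw [this]

/-- A level of the cumulative hierarchy supplies the closed sets needed for recursion along any
relation that does not raise the rank. -/
theorem exists_mem_rank_closed (x : ZFSet.{u}) :
    ∃ t : ZFSet.{u}, x ∈ t ∧ ∀ y ∈ t, ∀ z : ZFSet.{u}, z.rank ≤ y.rank → z ∈ t := by
  refine ⟨ZFSet.vonNeumann (Order.succ x.rank), ZFSet.mem_vonNeumann_succ x, fun y hy z hz => ?_⟩
  rw [ZFSet.mem_vonNeumann] at hy ⊢
  exact hz.trans_lt hy

theorem isDef_zfRank :
    IsDefFun r fun x => x.rank.toZFSet := by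
  refine isDef_rank (R := fun x y => x ∈ y) ZFSet.mem_wf (IsDef.mem 0 1) (fun x => ?_)
    fun x α => ZFSet.lt_rank_iff
  obtain ⟨t, hx, ht⟩ := exists_mem_rank_closed x
  exact ⟨t, hx, fun y hy z hz => ht y hy z (ZFSet.rank_lt_of_mem hz).le⟩

end Recursion

/-! ### A definable enumeration of the universe by the ordinals -/

section Enumeration

variable {r : ZFSet.{u} → ZFSet.{u} → Prop}

theorem isDef_lt_of_isDef_graph {o : ZFSet.{u} → Ordinal.{u}}
    (h : IsDefFun r fun x => (o x).toZFSet) :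
    IsDef r fun v : Fin 2 → ZFSet.{u} => o (v 0) < o (v 1) := by
  refine IsDef.congr (P := fun v => ∃ a b, a = (o (v 0)).toZFSet ∧ b = (o (v 1)).toZFSet ∧ a ∈ b)
    (.ex (.ex (.and ?_ (.and ?_ ?_)))) fun v => by
      simp [Ordinal.toZFSet_mem_toZFSet_iff]
  · exact h.app _ _
  · exact h.app _ _
  · exact IsDef.mem _ _

theorem isDef_eq_of_isDef_graph {o : ZFSet.{u} → Ordinal.{u}}
    (h : IsDefFun r fun x => (o x).toZFSet) :
    IsDef r fun v : Fin 2 → ZFSet.{u} => o (v 0) = o (v 1) := by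
  refine IsDef.congr (P := fun v => ∃ a b, a = (o (v 0)).toZFSet ∧ b = (o (v 1)).toZFSet ∧ a = b)
    (.ex (.ex (.and ?_ (.and ?_ ?_)))) fun v => by
      simp [Ordinal.toZFSet_injective.eq_iff]
  · exact h.app _ _
  · exact h.app _ _
  · exact IsDef.eq _ _

/-- A global well-ordering yields a definable injection of the universe into the ordinals. -/
theorem exists_definable_enumeration (r : ZFSet.{u} → ZFSet.{u} → Prop) [IsWellOrder ZFSet.{u} r] :
    ∃ o : ZFSet.{u} → Ordinal.{u}, Function.Injective o ∧
      IsDefFun r fun x => (o x).toZFSet := by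
  -- The given well-ordering may have proper classes as initial segments. Comparing ranks first
  -- makes the initial segments sets, so that ordinals suffice to count along `R`.
  let R : ZFSet.{u} → ZFSet.{u} → Prop := fun x y =>
    x.rank < y.rank ∨ x.rank = y.rank ∧ r x y
  have hle : ∀ {x y}, R x y → x.rank ≤ y.rank := fun h => h.elim le_of_lt fun h => h.1.le
  have hwf : WellFounded R := by
    have := InvImage.wf (fun x : ZFSet.{u} => (x.rank, x))
      (WellFounded.prod_lex (wellFounded_lt (α := Ordinal.{u})) (IsWellFounded.wf (r := r)))
    refine this.mono ?_
    rintro x y (h | ⟨h1, h2⟩)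
    · exact Prod.Lex.left _ _ h
    · change Prod.Lex _ _ (x.rank, x) (y.rank, y)
      rw [h1]
      exact Prod.Lex.right _ h2
  have htri : ∀ x y, R x y ∨ x = y ∨ R y x := by
    intro x y
    rcases lt_trichotomy x.rank y.rank with h | h | h
    · exact Or.inl (Or.inl h)
    · rcases trichotomous_of r x y with h' | h' | h'
      · exact Or.inl (Or.inr ⟨h, h'⟩)
      · exact Or.inr (Or.inl h')
      · exact Or.inr (Or.inr (Or.inr ⟨h.symm, h'⟩))
    · exact Or.inr (Or.inr (Or.inl h))
  have hcl : ∀ x, ∃ t : ZFSet.{u}, x ∈ t ∧ ∀ y ∈ t, ∀ z, R z y → z ∈ t := fun x => by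
    obtain ⟨t, hx, ht⟩ := exists_mem_rank_closed x
    exact ⟨t, hx, fun y hy z hz => ht y hy z (hle hz)⟩
  have hsmall : ∀ x, Small.{u} {y // R y x} := fun x => by
    obtain ⟨t, hx, ht⟩ := hcl x
    have : Small.{u} (t : Set ZFSet.{u}) := ZFSet.small_coe t
    exact small_subset (s := (t : Set ZFSet.{u})) (t := {y | R y x}) fun y hy => ht x hx y hy
  let o : ZFSet.{u} → Ordinal.{u} :=
    hwf.fix fun x f => ⨆ y : {y // R y x}, Order.succ (f y.1 y.2)
  have ho : ∀ x α, α < o x ↔ ∃ y, R y x ∧ α ≤ o y := by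
    intro x α
    have : o x = ⨆ y : {y // R y x}, Order.succ (o y.1) := hwf.fix_eq _ x
    rw [this, Ordinal.lt_iSup_iff]
    simp
  have hlt : ∀ x y, R x y → o x < o y := fun x y h => (ho y _).2 ⟨x, h, le_rfl⟩
  refine ⟨o, fun x y hxy => ?_, isDef_rank hwf ?_ hcl ho⟩
  · rcases htri x y with h | h | h
    · exact absurd hxy (hlt x y h).ne
    · exact h
    · exact absurd hxy (hlt y x h).ne'
  · exact (isDef_lt_of_isDef_graph isDef_zfRank).or
      ((isDef_eq_of_isDef_graph isDef_zfRank).and (IsDef.rel 0 1))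

end Enumeration

/-! ### Countably many definable families suffice -/

section Families

variable {r : ZFSet.{u} → ZFSet.{u} → Prop}

/-- The set coded by the entries of `p` with first coordinate `a`. -/
noncomputable def fiber (p a : ZFSet.{u}) : ZFSet.{u} :=
  ZFSet.sep (fun w => ZFSet.pair a w ∈ p) (ZFSet.sUnion (ZFSet.sUnion p))

theorem mem_fiber {p a w : ZFSet.{u}} : w ∈ fiber p a ↔ ZFSet.pair a w ∈ p := by
  rw [fiber, ZFSet.mem_sep, and_iff_right_iff_imp]
  intro h
  refine ZFSet.mem_sUnion_of_mem (y := w) (z := {a, w}) (by simp) ?_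
  exact ZFSet.mem_sUnion_of_mem (by simp [ZFSet.pair]) h

/-- A disjoint union packs finitely many parameters into a single set, from which each of them is
recovered as a fiber. -/
theorem exists_fiber_eq {k : ℕ} (x : Fin k → ZFSet.{u}) :
    ∃ p : ZFSet.{u}, ∀ i : Fin k, fiber p (natCode i) = x i := by
  have : ∀ i : Fin k, Small.{u} (x i : Set ZFSet.{u}) := fun i => ZFSet.small_coe (x i)
  refine ⟨ZFSet.range fun j : Σ i : Fin k, (x i : Set ZFSet.{u}) =>
    ZFSet.pair (natCode j.1) j.2.1, fun i => ZFSet.ext fun w => ?_⟩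
  rw [mem_fiber, ZFSet.mem_range]
  constructor
  · rintro ⟨⟨j, y, hy⟩, h⟩
    obtain ⟨h1, rfl⟩ := ZFSet.pair_inj.1 h
    obtain rfl := Fin.ext (natCode_injective h1)
    exact hy
  · intro h
    exact ⟨⟨i, w, h⟩, rfl⟩

theorem isDefFun_fiber (a : ZFSet.{u}) : IsDefFun r fun p => fiber p a := by
  refine IsDef.congr (P := fun v => ∀ w, w ∈ v 1 ↔ ZFSet.pair a w ∈ v 0)
    (.all (.iff ?_ ?_)) fun v => by simp [ZFSet.ext_iff, mem_fiber]
  · exact IsDef.mem _ _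
  · exact IsDef.pair_const_mem _ _ _

/-- Countably many symbols give countably many formulas, which is why the ultrafilter can be built
in countably many stages. -/
instance : Countable setLang.Symbols := by
  have : Countable (Σ l, setLang.Functions l) :=
    Function.Injective.countable (f := fun x => (x.2 : Empty)) fun x => x.2.elim
  have : Countable (Σ l, setLang.Relations l) := by
    have : ∀ l, Countable (setLang.Relations l) := fun l =>
      Function.Injective.countable (β := Bool) (f := fun x : SetRel l => match x with
        | SetRel.mem => true
        | SetRel.le => false) (by rintro ⟨⟩ ⟨⟩ <;> simp <;> rfl)
    infer_instance
  unfold FirstOrder.Language.Symbols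
  infer_instance

/-- The binary relation defined by a formula from parameters coded by a set. -/
def codedRel (r : ZFSet.{u} → ZFSet.{u} → Prop)
    (φ : Σ k : ℕ, setLang.Formula (Fin k ⊕ Fin 2)) (a p s : ZFSet.{u}) : Prop :=
  @FirstOrder.Language.Formula.Realize setLang ZFSet.{u} (setStructure r) _ φ.2
    (Sum.elim (fun i => fiber p (natCode i)) ![a, s])

/-- The formula is fixed, so no truth predicate is involved: its parameters become `k` existentially
quantified variables, each pinned to a fiber of the code. -/
theorem isDef_codedRel (φ : Σ k : ℕ, setLang.Formula (Fin k ⊕ Fin 2)) :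
    IsDef r fun v : Fin 3 → ZFSet.{u} => codedRel r φ (v 0) (v 1) (v 2) := by
  obtain ⟨k, φ⟩ := φ
  let _ := setStructure r
  have h1 : ∀ i : Fin k, (Set.univ : Set ZFSet.{u}).Definable setLang
      {w : Fin 3 ⊕ Fin k → ZFSet.{u} | w (Sum.inr i) = fiber (w (Sum.inl 1)) (natCode i)} :=
    fun i => (isDefFun_fiber (r := r) (natCode i)).preimage_comp ![Sum.inl 1, Sum.inr i]
  have h2 : (Set.univ : Set ZFSet.{u}).Definable setLang
      {w : Fin k ⊕ Fin 2 → ZFSet.{u} | φ.Realize w} :=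
    (Set.empty_definable_iff.2 ⟨φ, rfl⟩).mono (Set.empty_subset _)
  have h3 := h2.preimage_comp
    (Sum.elim Sum.inr ![Sum.inl 0, Sum.inl 2] : Fin k ⊕ Fin 2 → Fin 3 ⊕ Fin k)
  have h4 := ((Set.definable_iInter_of_finite h1).inter h3).image_comp_sumInl_fin
  unfold IsDef
  convert h4 using 1
  ext v
  simp only [Set.mem_ofPred_eq, Set.mem_image, Set.mem_inter_iff, Set.mem_iInter, Set.mem_preimage]
  have hcomp : ∀ w : Fin 3 ⊕ Fin k → ZFSet.{u},
      (w ∘ (Sum.elim Sum.inr ![Sum.inl 0, Sum.inl 2] : Fin k ⊕ Fin 2 → Fin 3 ⊕ Fin k)) =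
        Sum.elim (fun i => w (Sum.inr i)) ![w (Sum.inl 0), w (Sum.inl 2)] := by
    intro w
    ext1 i
    rcases i with i | i
    · rfl
    · fin_cases i <;> rfl
  constructor
  · intro h
    refine ⟨Sum.elim v fun i => fiber (v 1) (natCode i), ⟨fun i => rfl, ?_⟩, rfl⟩
    rw [hcomp]
    exact h
  · rintro ⟨w, ⟨hw1, hw2⟩, rfl⟩
    rw [hcomp] at hw2
    simp only [hw1] at hw2
    exact hw2

/-- There are countably many definable families of which all definable families are subfamilies. -/
theorem exists_universal_families (r : ZFSet.{u} → ZFSet.{u} → Prop) :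
    ∃ T : ℕ → ZFSet.{u} → ZFSet.{u} → Prop,
      (∀ n, IsDef r fun v : Fin 2 → ZFSet.{u} => T n (v 0) (v 1)) ∧
      ∀ P : (Fin 2 → ZFSet.{u}) → Prop, IsDef r P →
        ∃ n p, ∀ a s, P ![a, s] ↔ T n (ZFSet.pair a p) s := by
  let J := Σ k : ℕ, setLang.Formula (Fin k ⊕ Fin 2)
  obtain ⟨e, he⟩ := exists_surjective_nat J
  -- The index of a member is a pair of the original index and the code of the parameters, so one
  -- family serves all choices of parameters.
  refine ⟨fun n z s => ∃ a p, z = ZFSet.pair a p ∧ codedRel r (e n) a p s, fun n => ?_, ?_⟩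
  · exact .ex (.ex (.and (IsDef.pair _ _ _) ((isDef_codedRel (e n)).app3 _ _ _)))
  · intro P hP
    let _ := setStructure r
    obtain ⟨A, -, hA⟩ := Set.definable_iff_finitely_definable.1 hP
    obtain ⟨φ, hφ⟩ := Set.definable_iff_exists_formula_sum.1 hA
    let f := A.equivFin
    obtain ⟨p, hp⟩ := exists_fiber_eq fun i => ((f.symm i : A) : ZFSet.{u})
    obtain ⟨n, hn⟩ := he ⟨A.card, φ.relabel (Sum.map f id)⟩
    refine ⟨n, p, fun a s => ?_⟩
    have h1 : P ![a, s] ↔ codedRel r (e n) a p s := by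
      have : P ![a, s] ↔ ![a, s] ∈ {v | P v} := Iff.rfl
      rw [this, hφ, hn, codedRel, FirstOrder.Language.Formula.realize_relabel]
      refine iff_of_eq (congrArg φ.Realize (funext fun i => ?_))
      rcases i with i | i
      · exact ((hp (f i)).trans (by simp)).symm
      · rfl
    rw [h1]
    constructor
    · exact fun h => ⟨a, p, rfl, h⟩
    · rintro ⟨a', p', h, h'⟩
      obtain ⟨rfl, rfl⟩ := ZFSet.pair_inj.1 h
      exact h'

end Families

/-! ### Existence of definable ultrafilters -/

section Ultrafilter

variable {r : ZFSet.{u} → ZFSet.{u} → Prop}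

/-- The filter on the class of finite sets of ordinals generated by a family of classes. -/
def familyFilter (B : ZFSet.{u} → ZFSet.{u} → Prop) : Filter ZFSet.{u} :=
  ⨅ i, Filter.principal {s | s ∈ FinOrd ∧ B i s}

theorem familyFilter_neBot_iff {B : ZFSet.{u} → ZFSet.{u} → Prop} :
    (familyFilter B).NeBot ↔ ∀ I : Set ZFSet.{u}, I.Finite → ∃ s ∈ FinOrd, ∀ i ∈ I, B i s := by
  rw [familyFilter, (Filter.hasBasis_iInf_principal_finite _).neBot_iff]
  constructor
  · intro h I hI
    -- The extra index `∅` forces `s` into `FinOrd` even if `I` is empty.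
    obtain ⟨s, hs⟩ := h (hI.insert ∅)
    simp only [Set.mem_iInter] at hs
    exact ⟨s, (hs ∅ (Set.mem_insert _ _)).1, fun i hi => (hs i (Set.mem_insert_of_mem _ hi)).2⟩
  · intro h I hI
    obtain ⟨s, hs, hs'⟩ := h I hI
    refine ⟨s, ?_⟩
    simp only [Set.mem_iInter]
    exact fun i hi => ⟨hs, hs' i hi⟩

/-- This and `finite_of_mem_finOrd` let a quantifier over finite sets of indices be replaced by one
over `FinOrd`, which is first-order. -/
theorem exists_finOrd_of_finite {o : ZFSet.{u} → Ordinal.{u}} (ho : Function.Injective o)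
    {I : Set ZFSet.{u}} (hI : I.Finite) : ∃ t ∈ FinOrd, ∀ i, (o i).toZFSet ∈ t ↔ i ∈ I := by
  have : Small.{u} I := by
    have := hI.to_subtype
    infer_instance
  refine ⟨ZFSet.range fun i : I => (o i).toZFSet, ⟨?_, ?_⟩, fun i => ?_⟩
  · have := hI.to_subtype
    rw [ZFSet.coe_range]
    exact Set.finite_range _
  · intro a ha
    obtain ⟨i, rfl⟩ := ZFSet.mem_range.1 ha
    exact ZFSet.isOrdinal_toZFSet _
  · rw [ZFSet.mem_range]
    constructor
    · rintro ⟨j, hj⟩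
      rw [← ho (Ordinal.toZFSet_injective hj)]
      exact j.2
    · intro hi
      exact ⟨⟨i, hi⟩, rfl⟩

theorem finite_of_mem_finOrd {o : ZFSet.{u} → Ordinal.{u}} (ho : Function.Injective o)
    {t : ZFSet.{u}} (ht : t ∈ FinOrd) : {i | (o i).toZFSet ∈ t}.Finite :=
  Set.Finite.preimage (f := fun i => (o i).toZFSet)
    (Ordinal.toZFSet_injective.comp ho).injOn ht.1

/-- The members of a definable family can be decided by a definable class, in such a way that they
generate a proper filter together with a given definable family. -/
theorem exists_decision {o : ZFSet.{u} → Ordinal.{u}} (ho : Function.Injective o)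
    (hdo : IsDefFun r fun x => (o x).toZFSet) {B T : ZFSet.{u} → ZFSet.{u} → Prop}
    (hB : IsDef r fun v : Fin 2 → ZFSet.{u} => B (v 0) (v 1))
    (hT : IsDef r fun v : Fin 2 → ZFSet.{u} => T (v 0) (v 1)) (hne : (familyFilter B).NeBot) :
    ∃ D : ZFSet.{u} → Prop, (IsDef r fun v : Fin 1 → ZFSet.{u} => D (v 0)) ∧
      (familyFilter fun i s => B i s ∧ (D i ↔ T i s)).NeBot := by
  have hwf : WellFounded fun x y => o x < o y := InvImage.wf o wellFounded_lt
  -- `G a E` says that the member of `T` at `a` is consistent with `B` and with the decisions `E`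
  -- made before `a`; the set `t` codes the finitely many conditions to be met.
  let G : ZFSet.{u} → (ZFSet.{u} → Prop) → Prop := fun a E => ∀ t, t ∈ FinOrd → ∃ s, s ∈ FinOrd ∧
    (∀ i, (o i).toZFSet ∈ t → B i s ∧ (o i < o a → (E i ↔ T i s))) ∧ T a s
  have hG : ∀ a E E', (∀ i, o i < o a → (E i ↔ E' i)) → (G a E ↔ G a E') := by
    intro a E E' h
    refine forall₂_congr fun t _ => exists_congr fun s => and_congr_right fun _ =>
      and_congr_left fun _ => forall₂_congr fun i _ => and_congr_right fun _ =>
      forall_congr' fun hi => ?_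
    rw [h i hi]
  let D : ZFSet.{u} → Prop := hwf.fix fun a E => G a fun i => ∃ h : o i < o a, E i h
  have hD : ∀ a, D a ↔ G a D := by
    intro a
    have : D a = G a fun i => ∃ _ : o i < o a, D i := hwf.fix_eq _ a
    rw [this]
    exact hG _ _ _ fun i hi => by simp [hi]
  refine ⟨D, ?_, ?_⟩
  · refine isDef_of_recursion hwf (isDef_lt_of_isDef_graph hdo) (fun x => ?_)
      (G := fun a h => G a fun i => i ∈ h) ?_ fun x h hh => ?_
    · have : Small.{u} {y | o y ≤ o x} := by
        have : Small.{u} (Set.Iic (o x)) := inferInstance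
        exact small_of_injective (β := Set.Iic (o x)) (f := fun y => ⟨o y.1, y.2⟩)
          fun y z h => Subtype.ext (ho (Subtype.ext_iff.1 h))
      refine ⟨ZFSet.range fun y : {y | o y ≤ o x} => y.1, ?_, ?_⟩
      · rw [ZFSet.mem_range]
        exact ⟨⟨x, le_refl (o x)⟩, rfl⟩
      · intro y hy z hz
        obtain ⟨y, rfl⟩ := ZFSet.mem_range.1 hy
        rw [ZFSet.mem_range]
        exact ⟨⟨z, hz.le.trans y.2⟩, rfl⟩
    · refine .all (.imp ?_ (.ex (.and ?_ (.and (.all (.imp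
        (.congr (P := fun v => ∃ a, a = (o (v 0)).toZFSet ∧ a ∈ v 2) (.ex (.and ?_ ?_))
          fun v => by simp) (.and ?_ (.imp ?_ (.iff ?_ ?_))))) ?_))))
      · exact (isDef_finOrd r).app1 _
      · exact (isDef_finOrd r).app1 _
      · exact hdo.app _ _
      · exact IsDef.mem 0 3
      · exact hB.app2 _ _
      · exact IsDef.app2 (P := fun x y => o x < o y) (isDef_lt_of_isDef_graph hdo) _ _
      · exact IsDef.mem _ _
      · exact hT.app2 _ _
      · exact hT.app2 _ _
    · rw [hD]
      exact hG _ _ _ hh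
  · have hbase := familyFilter_neBot_iff.1 hne
    -- The decisions up to and including `a` are consistent with `B`, by induction on `a`. Only
    -- finitely many conditions matter at a time, so limit stages cause no difficulty.
    have main : ∀ a, ∀ I : Set ZFSet.{u}, I.Finite →
        ∃ s ∈ FinOrd, ∀ i ∈ I, B i s ∧ (o i ≤ o a → (D i ↔ T i s)) := by
      intro a
      induction a using hwf.induction with
      | _ a ih =>
        have hlt : ∀ I : Set ZFSet.{u}, I.Finite →
            ∃ s ∈ FinOrd, ∀ i ∈ I, B i s ∧ (o i < o a → (D i ↔ T i s)) := by
          intro I hI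
          rcases ({i ∈ I | o i < o a}).eq_empty_or_nonempty with he | he
          · obtain ⟨s, hs, hs'⟩ := hbase I hI
            refine ⟨s, hs, fun i hi => ⟨hs' i hi, fun hia => ?_⟩⟩
            exact absurd (show i ∈ {i ∈ I | o i < o a} from ⟨hi, hia⟩) (by simp [he])
          -- The last index of `I` before `a` reduces the strict case to the induction hypothesis.
          · obtain ⟨b, hb, hmax⟩ := Set.exists_max_image _ o (hI.subset (Set.sep_subset _ _)) he
            obtain ⟨s, hs, hs'⟩ := ih b hb.2 I hI
            exact ⟨s, hs, fun i hi => ⟨(hs' i hi).1, fun hia => (hs' i hi).2 (hmax i ⟨hi, hia⟩)⟩⟩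
        intro I hI
        by_cases ha : D a
        · obtain ⟨t, ht, ht'⟩ := exists_finOrd_of_finite ho hI
          obtain ⟨s, hs, hs', hTs⟩ := (hD a).1 ha t ht
          refine ⟨s, hs, fun i hi => ⟨(hs' i ((ht' i).2 hi)).1, fun hia => ?_⟩⟩
          rcases hia.lt_or_eq with h | h
          · exact (hs' i ((ht' i).2 hi)).2 h
          · rw [ho h]
            exact iff_of_true ha hTs
        · have ha' := ha
          rw [hD] at ha'
          simp only [G, not_forall] at ha'
          obtain ⟨t, ht, hn⟩ := ha'
          -- The member at `a` was rejected because it is incompatible with the finitely many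
          -- conditions coded by `t`. Once these are imposed in addition to `I`, it must fail at
          -- `s`, as the negative decision requires.
          obtain ⟨s, hs, hs'⟩ := hlt _ (hI.union (finite_of_mem_finOrd ho ht))
          have hTs : ¬ T a s := fun h => hn ⟨s, hs, fun i hi => hs' i (Or.inr hi), h⟩
          refine ⟨s, hs, fun i hi => ⟨(hs' i (Or.inl hi)).1, fun hia => ?_⟩⟩
          rcases hia.lt_or_eq with h | h
          · exact (hs' i (Or.inl hi)).2 h
          · rw [ho h]
            exact iff_of_false ha hTs
    rw [familyFilter_neBot_iff]
    intro I hI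
    rcases I.eq_empty_or_nonempty with rfl | he
    · obtain ⟨s, hs, -⟩ := hbase ∅ hI
      exact ⟨s, hs, by simp⟩
    · obtain ⟨b, hb, hmax⟩ := Set.exists_max_image _ o hI he
      obtain ⟨s, hs, hs'⟩ := main b I hI
      exact ⟨s, hs, fun i hi => ⟨(hs' i hi).1, (hs' i hi).2 (hmax i hi)⟩⟩

theorem exists_defUltrafilter (r : ZFSet.{u} → ZFSet.{u} → Prop) [IsWellOrder ZFSet.{u} r] :
    Nonempty (DefUltrafilter r) := by
  obtain ⟨o, ho, hdo⟩ := exists_definable_enumeration r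
  obtain ⟨T, hT, hTu⟩ := exists_universal_families r
  let S := {B : ZFSet.{u} → ZFSet.{u} → Prop //
    (IsDef r fun v : Fin 2 → ZFSet.{u} => B (v 0) (v 1)) ∧ (familyFilter B).NeBot}
  have step : ∀ (n : ℕ) (B : S), ∃ (B' : S) (D : ZFSet.{u} → Prop),
      (IsDef r fun v : Fin 1 → ZFSet.{u} => D (v 0)) ∧
      B'.1 = fun i s => B.1 i s ∧ (D i ↔ T n i s) := by
    intro n B
    obtain ⟨D, hD, hne⟩ := exists_decision ho hdo B.2.1 (hT n) B.2.2
    refine ⟨⟨fun i s => B.1 i s ∧ (D i ↔ T n i s), ?_, hne⟩, D, hD, rfl⟩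
    exact B.2.1.and ((hD.app1 0).iff (hT n))
  choose next D hD hnext using step
  -- The initial family consists of the classes of all `s` containing a given ordinal; indices that
  -- are not ordinals impose no condition.
  let B₀ : S := ⟨fun i s => i.IsOrdinal → i ∈ s, (IsDef.isOrdinal 0).imp (IsDef.mem 0 1), by
    rw [familyFilter_neBot_iff]
    intro I hI
    have hf : {i ∈ I | i.IsOrdinal}.Finite := hI.subset (Set.sep_subset _ _)
    have : Small.{u} {i ∈ I | i.IsOrdinal} := by
      have := hf.to_subtype
      infer_instance
    refine ⟨ZFSet.range fun i : {i ∈ I | i.IsOrdinal} => i.1, ⟨?_, ?_⟩, fun i hi hio => ?_⟩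
    · have := hf.to_subtype
      rw [ZFSet.coe_range]
      exact Set.finite_range _
    · intro a ha
      obtain ⟨i, rfl⟩ := ZFSet.mem_range.1 ha
      exact i.2.2
    · rw [ZFSet.mem_range]
      exact ⟨⟨i, hi, hio⟩, rfl⟩⟩
  -- The sequence itself need not be definable: a definable family occurs inside a single `T n`,
  -- whose members are decided by the definable class `D n (B n)`.
  let B : ℕ → S := fun n => Nat.rec B₀ next n
  have hB : ∀ n, (B (n + 1)).1 = fun i s => (B n).1 i s ∧ (D n (B n) i ↔ T n i s) :=
    fun n => hnext n (B n)
  have hanti : Antitone fun n => familyFilter (B n).1 := by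
    refine antitone_nat_of_succ_le fun n => iInf_mono fun i => ?_
    rw [hB, Filter.principal_mono]
    exact fun s hs => ⟨hs.1, hs.2.1⟩
  have hne : (⨅ n, familyFilter (B n).1).NeBot :=
    Filter.iInf_neBot_of_directed hanti.directed_ge fun n => (B n).2.2
  set 𝓕 := ⨅ n, familyFilter (B n).1 with h𝓕
  have hmem : ∀ n i, {s | s ∈ FinOrd ∧ (B n).1 i s} ∈ 𝓕 := fun n i =>
    Filter.mem_iInf_of_mem n (Filter.mem_iInf_of_mem i (Filter.mem_principal_self _))
  have huniv : FinOrd ∈ 𝓕 := Filter.mem_of_superset (hmem 0 ∅) fun s hs => hs.1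
  have hdec : ∀ n i, (D n (B n) i → {s | s ∈ FinOrd ∧ T n i s} ∈ 𝓕) ∧
      (¬ D n (B n) i → {s | s ∈ FinOrd ∧ ¬ T n i s} ∈ 𝓕) := by
    intro n i
    have h := hmem (n + 1) i
    rw [hB] at h
    constructor
    · exact fun hd => Filter.mem_of_superset h fun s hs => ⟨hs.1, hs.2.2.1 hd⟩
    · exact fun hd => Filter.mem_of_superset h fun s hs => ⟨hs.1, fun ht => hd (hs.2.2.2 ht)⟩
  have hhat : ∀ α : ZFSet.{u}, α.IsOrdinal → {s ∈ FinOrd | α ∈ s} ∈ 𝓕 := fun α hα =>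
    Filter.mem_of_superset (hmem 0 α) fun s hs => ⟨hs.1, hs.2 hα⟩
  refine ⟨⟨{X | X ⊆ FinOrd ∧ IsDefClass r X ∧ X ∈ 𝓕}, fun X h => h.1, fun X h => h.2.1,
    ⟨subset_rfl, isDef_finOrd r, huniv⟩, fun h => hne.ne (Filter.empty_mem_iff_bot.1 h.2.2),
    fun X hX Y hY => ⟨Set.inter_subset_left.trans hX.1, hX.2.1.and hY.2.1,
      Filter.inter_mem hX.2.2 hY.2.2⟩,
    fun X hX Y hXY hY hdY => ⟨hY, hdY, Filter.mem_of_superset hX.2.2 hXY⟩,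
    fun X hX hdX => ?_, fun s hs => ?_, fun α hα => ?_, fun P hP => ?_⟩⟩
  -- A single class is treated as a constant family, so the index `∅` used below is arbitrary.
  · obtain ⟨n, p, hnp⟩ := hTu (fun v => v 1 ∈ X) (hdX.app1 1)
    by_cases hd : D n (B n) (ZFSet.pair ∅ p)
    · refine Or.inl ⟨hX, hdX, Filter.mem_of_superset ((hdec n _).1 hd) fun s hs => ?_⟩
      exact (hnp ∅ s).2 hs.2
    · refine Or.inr ⟨Set.sdiff_subset, (isDef_finOrd r).and hdX.not,
        Filter.mem_of_superset ((hdec n _).2 hd) fun s hs => ?_⟩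
      exact ⟨hs.1, fun h => hs.2 ((hnp ∅ s).1 h)⟩
  -- Some ordinal lies outside `s`, so the class required to contain that ordinal is disjoint from
  -- `{s}`.
  · obtain ⟨α, hα⟩ : ∃ α : Ordinal.{u}, α.toZFSet ∉ s := by
      refine ⟨s.rank, fun h => ?_⟩
      have := ZFSet.rank_lt_of_mem h
      simp at this
    refine hne.ne (Filter.empty_mem_iff_bot.1 (Filter.mem_of_superset
      (Filter.inter_mem hs.2.2 (hhat _ (ZFSet.isOrdinal_toZFSet α))) ?_))
    rintro t ⟨rfl, h⟩
    exact hα h.2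
  · exact ⟨Set.sep_subset _ _,
      (isDef_finOrd r).and (IsDef.const_mem α 0), hhat α hα⟩
  · obtain ⟨n, p, hnp⟩ := hTu P hP
    refine IsDef.congr (P := fun v => ∃ q z, q = p ∧ z = ZFSet.pair (v 0) q ∧ D n (B n) z)
      (.ex (.ex (.and (IsDef.eq_const _ _) (.and (IsDef.pair _ _ _) ((hD n (B n)).app1 _)))))
      fun v => ?_
    have hDv : (∃ q z, q = p ∧ z = ZFSet.pair (v 0) q ∧ D n (B n) z) ↔
        D n (B n) (ZFSet.pair (v 0) p) := by simp
    rw [hDv]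
    have hcl : IsDefClass r {s | s ∈ FinOrd ∧ P ![v 0, s]} := by
      refine (isDef_finOrd r).and (IsDef.congr (P := fun w => ∃ a, a = v 0 ∧ P ![a, w 0])
        (.ex (.and (IsDef.eq_const _ _) ?_)) fun w => by simp)
      exact IsDef.app2 (P := fun a s => P ![a, s]) (hP.congr fun v => by
        rw [show ![v 0, v 1] = v from funext fun i => by fin_cases i <;> rfl]) 0 1
    constructor
    · rintro ⟨-, -, h⟩
      by_contra hd
      refine hne.ne (Filter.empty_mem_iff_bot.1 (Filter.mem_of_superset
        (Filter.inter_mem h ((hdec n _).2 hd)) ?_))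
      rintro s ⟨h1, h2⟩
      exact h2.2 ((hnp _ _).1 h1.2)
    · intro hd
      exact ⟨Set.sep_subset _ _, hcl, Filter.mem_of_superset ((hdec n _).1 hd) fun s hs =>
        ⟨hs.1, (hnp _ _).2 hs.2⟩⟩

end Ultrafilter

/-! ### Definable maps into small types -/

/-- Well-order the type and send each element to its position, an ordinal. -/
theorem exists_smallCode (ι : Type) : ∃ c : ι → ZFSet.{u}, Function.Injective c := by
  refine ⟨fun i => Ordinal.toZFSet (Ordinal.typein (WellOrderingRel (α := ULift.{u} ι)) ⟨i⟩), ?_⟩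
  intro i j h
  have := Ordinal.typein_injective _ (Ordinal.toZFSet_injective h)
  exact congrArg ULift.down this

/-- An injective coding of the elements of a small type by sets. -/
noncomputable def smallCode (ι : Type) : ι → ZFSet.{u} := (exists_smallCode ι).choose

theorem smallCode_injective {ι : Type} : Function.Injective (smallCode.{u} ι) :=
  (exists_smallCode ι).choose_spec

theorem smallCode_inj {ι : Type} {x y : ι} : smallCode.{u} ι x = smallCode ι y ↔ x = y :=
  smallCode_injective.eq_iff

section

variable {r : ZFSet.{u} → ZFSet.{u} → Prop} {n : ℕ} {ι κ : Type}

theorem IsDef.forall_finite {α : Type*} [Finite α] {P : α → (Fin n → ZFSet.{u}) → Prop}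
    (h : ∀ i, IsDef r (P i)) : IsDef r fun v => ∀ i, P i v := by
  let _ := setStructure r
  have := Set.definable_iInter_of_finite h
  unfold IsDef
  convert this using 1
  ext v
  simp

/-- A relation with small graph is definable. -/
theorem IsDef.small2 (a b : ι → ZFSet.{u}) (j k : Fin n) :
    IsDef r fun v : Fin n → ZFSet.{u} => ∃ i, v j = a i ∧ v k = b i :=
  (IsDef.pair_mem_const j k (ZFSet.range fun i => ZFSet.pair (a i) (b i))).congr fun v => by
    rw [ZFSet.mem_range]
    refine exists_congr fun i => ?_
    rw [ZFSet.pair_inj, eq_comm (a := a i), eq_comm (a := b i)]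

theorem IsDef.small3' (a b c : ι → ZFSet.{u}) (j k l : Fin n) :
    IsDef r fun v : Fin n → ZFSet.{u} => ∃ i, v j = a i ∧ v k = b i ∧ v l = c i :=
  (IsDef.small3 a b c).app3 (P := fun x y z => ∃ i, x = a i ∧ y = b i ∧ z = c i) j k l

theorem IsDef.small1 (a : ι → ZFSet.{u}) (j : Fin n) :
    IsDef r fun v : Fin n → ZFSet.{u} => ∃ i, v j = a i :=
  (IsDef.mem_const j (ZFSet.range a)).congr fun v => by
    rw [ZFSet.mem_range]
    exact exists_congr fun i => eq_comm

/-- The map `h` from tuples of sets to a small type is definable. -/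
def IsDefMap (r : ZFSet.{u} → ZFSet.{u} → Prop) (h : (Fin n → ZFSet.{u}) → ι) : Prop :=
  IsDef r fun w : Fin (n + 1) → ZFSet.{u} => w 0 = smallCode ι (h fun i => w i.succ)

namespace IsDefMap

theorem graph {m : ℕ} {h : (Fin n → ZFSet.{u}) → ι} (hh : IsDefMap r h) (f : Fin n → Fin m)
    (k : Fin m) : IsDef r fun v : Fin m → ZFSet.{u} => v k = smallCode ι (h fun i => v (f i)) :=
  IsDef.subst (m := n + 1) hh (Fin.cons k f)

theorem subst {m : ℕ} {h : (Fin n → ZFSet.{u}) → ι} (hh : IsDefMap r h) (f : Fin n → Fin m) :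
    IsDefMap r fun v : Fin m → ZFSet.{u} => h fun i => v (f i) :=
  hh.graph (fun i => (f i).succ) 0

theorem app1 {h : ZFSet.{u} → ι} (hh : IsDefMap r fun v : Fin 1 → ZFSet.{u} => h (v 0))
    (i : Fin n) : IsDefMap r fun v : Fin n → ZFSet.{u} => h (v i) :=
  hh.subst ![i]

theorem app2 {h : ZFSet.{u} → ZFSet.{u} → ι}
    (hh : IsDefMap r fun v : Fin 2 → ZFSet.{u} => h (v 0) (v 1)) (i j : Fin n) :
    IsDefMap r fun v : Fin n → ZFSet.{u} => h (v i) (v j) :=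
  hh.subst ![i, j]

theorem graph0 {h : (Fin n → ZFSet.{u}) → ι} (hh : IsDefMap r h) :
    IsDef r fun w : Fin (n + 1) → ZFSet.{u} => w 0 = smallCode ι (h fun i => w i.succ) := hh

/-- No definability is asked of `Q`: its extension is a set of codes, which may be used as a
parameter. In the same way `comp` admits arbitrary functions between small types. -/
theorem prop {h : (Fin n → ZFSet.{u}) → ι} (hh : IsDefMap r h) (Q : ι → Prop) :
    IsDef r fun v => Q (h v) := by
  refine IsDef.congr (.ex (Q := fun v w => w = smallCode ι (h v) ∧ ∃ i : {i // Q i},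
    w = smallCode ι i.1) (hh.graph0.and (IsDef.small1 _ _))) fun v => ?_
  simp [smallCode_inj]

theorem comp {h : (Fin n → ZFSet.{u}) → ι} (hh : IsDefMap r h) (g : ι → κ) :
    IsDefMap r fun v => g (h v) := by
  refine IsDef.congr (.ex (Q := fun w x => x = smallCode ι (h fun i => w i.succ) ∧
    ∃ i : ι, x = smallCode ι i ∧ w 0 = smallCode κ (g i))
    ((hh.graph (fun i => i.succ.succ) 0).and (IsDef.small2 _ _ _ _))) fun v => ?_
  simp [smallCode_inj]

theorem prodMk {h : (Fin n → ZFSet.{u}) → ι} {g : (Fin n → ZFSet.{u}) → κ} (hh : IsDefMap r h)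
    (hg : IsDefMap r g) : IsDefMap r fun v => (h v, g v) := by
  refine IsDef.congr (.ex (Q := fun w x => ∃ y, x = smallCode ι (h fun i => w i.succ) ∧
    y = smallCode κ (g fun i => w i.succ) ∧ ∃ i : ι × κ, x = smallCode ι i.1 ∧
      y = smallCode κ i.2 ∧ w 0 = smallCode (ι × κ) i)
    (.ex ((hh.graph (fun i => i.succ.succ.succ) 1).and
      ((hg.graph (fun i => i.succ.succ.succ) 0).and (IsDef.small3' _ _ _ 1 0 2))))) fun v => ?_
  simp only [exists_and_left, exists_eq_left, Prod.exists, smallCode_inj]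
  simp

theorem pi {α : Type} [Finite α] {h : α → (Fin n → ZFSet.{u}) → ι} (hh : ∀ a, IsDefMap r (h a)) :
    IsDefMap r fun v a => h a v := by
  refine IsDef.congr (P := fun w => (∃ f : α → ι, w 0 = smallCode _ f) ∧
    ∀ a, ∃ x, x = smallCode ι (h a fun i => w i.succ) ∧ ∃ f : α → ι, w 0 = smallCode _ f ∧
      x = smallCode ι (f a)) (.and (IsDef.small1 _ _) (IsDef.forall_finite fun a =>
        .ex (((hh a).graph (fun i => i.succ.succ) 0).and (IsDef.small2 _ _ _ _)))) fun v => ?_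
  constructor
  · intro hv
    exact ⟨⟨_, hv⟩, fun a => ⟨_, rfl, _, hv, rfl⟩⟩
  · rintro ⟨⟨f, hf⟩, h'⟩
    rw [hf, smallCode_inj]
    funext a
    obtain ⟨x, hx, g, hg, hx'⟩ := h' a
    rw [hf, smallCode_inj] at hg
    rw [hx, smallCode_inj] at hx'
    rw [hg]
    exact hx'.symm

/-- A map into the subsets of a small type is definable if membership in its values is. -/
theorem ofMem {h : (Fin n → ZFSet.{u}) → Set κ}
    (hh : IsDef r fun w : Fin (n + 1) → ZFSet.{u} =>
      ∃ k, w 0 = smallCode κ k ∧ k ∈ h fun i => w i.succ) : IsDefMap r h := by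
  have hsub := hh.subst (n := n + 1 + 1) (Fin.cons 0 fun i => i.succ.succ)
  refine IsDef.congr (P := fun w => (∃ S : Set κ, w 0 = smallCode _ S) ∧
    ∀ x, (∃ k, x = smallCode κ k ∧ k ∈ h fun i => w i.succ) ↔
      ∃ i : {i : Set κ × κ // i.2 ∈ i.1}, w 0 = smallCode _ i.1.1 ∧ x = smallCode κ i.1.2)
    (.and (IsDef.small1 _ _) (.all (.iff ?_ (IsDef.small2 _ _ _ _)))) fun w => ?_
  · refine hsub.congr fun w => ?_
    simp
  · constructor
    · intro hw
      refine ⟨⟨_, hw⟩, fun x => ⟨?_, ?_⟩⟩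
      · rintro ⟨k, hx, hk⟩
        exact ⟨⟨(_, k), hk⟩, hw, hx⟩
      · rintro ⟨⟨⟨S, k⟩, hk⟩, hS, hx⟩
        rw [hw, smallCode_inj] at hS
        dsimp only at hS hk
        subst hS
        exact ⟨k, hx, hk⟩
    · rintro ⟨⟨S, hS⟩, h'⟩
      rw [hS, smallCode_inj]
      ext k
      constructor
      · intro hk
        obtain ⟨k', h1, h2⟩ := (h' (smallCode κ k)).2 ⟨⟨(S, k), hk⟩, hS, rfl⟩
        rwa [smallCode_injective h1]
      · intro hk
        obtain ⟨⟨⟨S', k'⟩, hk'⟩, h1, h2⟩ := (h' (smallCode κ k)).1 ⟨k, rfl, hk⟩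
        rw [hS, smallCode_inj] at h1
        dsimp only at h1 h2 hk'
        rw [h1, smallCode_injective h2]
        exact hk'

end IsDefMap

end

/-! ### Definable families of almost homomorphisms as definable maps into the reals -/

namespace DefAlmostHom

variable {r : ZFSet.{u} → ZFSet.{u} → Prop}

open Classical in
/-- The Eudoxus real given by `F(·, s)`, with value `0` if `s` is not a finite set of ordinals. -/
noncomputable def value (F : DefAlmostHom r) (s : ZFSet.{u}) : Eudoxus :=
  if h : s ∈ FinOrd then F.slice ⟨s, h⟩ else 0

theorem value_of_mem (F : DefAlmostHom r) {s : ZFSet.{u}} (h : s ∈ FinOrd) :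
    F.value s = F.slice ⟨s, h⟩ := dif_pos h

open Classical in
/-- The values of a family, with value `0` outside of the index class. -/
noncomputable def familyValue {X : Set ZFSet.{u}} (Φ : X → DefAlmostHom r) (a s : ZFSet.{u}) :
    Eudoxus :=
  if h : a ∈ X then (Φ ⟨a, h⟩).value s else 0

theorem familyValue_coe {X : Set ZFSet.{u}} (Φ : X → DefAlmostHom r) (a : X) (s : ZFSet.{u}) :
    familyValue Φ a s = (Φ a).value s := dif_pos a.2

open Classical in
/-- The class of an almost homomorphism given by its graph. -/
noncomputable def ofGraph (S : Set (ℤ × ℤ)) : Eudoxus :=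
  if h : ∃ f : ℤ → ℤ, IsAlmostHom f ∧ S = {x | f x.1 = x.2} then
    Eudoxus.mk h.choose h.choose_spec.1 else 0

theorem ofGraph_eq {f : ℤ → ℤ} (hf : IsAlmostHom f) :
    ofGraph {x | f x.1 = x.2} = Eudoxus.mk f hf := by
  have h : ∃ g : ℤ → ℤ, IsAlmostHom g ∧ {x : ℤ × ℤ | f x.1 = x.2} = {x | g x.1 = x.2} :=
    ⟨f, hf, rfl⟩
  have hc : h.choose = f := by
    funext p
    have : (p, f p) ∈ {x : ℤ × ℤ | f x.1 = x.2} := rfl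
    rw [h.choose_spec.2] at this
    exact this
  rw [ofGraph, dif_pos h]
  congr

theorem ofGraph_empty : ofGraph ∅ = 0 := by
  refine dif_neg ?_
  rintro ⟨f, -, h⟩
  have : ((0 : ℤ), f 0) ∈ {x : ℤ × ℤ | f x.1 = x.2} := rfl
  rw [← h] at this
  exact this

/-- The graph of an almost homomorphism is a subset of `ℤ × ℤ`, hence an element of a small type
that depends definably on the index and on `s`. Passing to its class is the function `ofGraph`
between small types; the empty graph accounts for the default value `0`. -/
theorem isDefMap_familyValue {X : Set ZFSet.{u}} {Φ : X → DefAlmostHom r} (hΦ : IsDefFamily X Φ) :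
    IsDefMap r fun v : Fin 2 → ZFSet.{u} => familyValue Φ (v 0) (v 1) := by
  have h : IsDefMap r fun v : Fin 2 → ZFSet.{u} => {x : ℤ × ℤ |
      ∃ (a : X) (p : ℤ) (s : FinOrd.{u}), v 0 = a ∧ intCode.{u} x.1 = intCode p ∧ v 1 = s ∧
        intCode.{u} x.2 = intCode ((Φ a).toFun p s)} := by
    refine IsDefMap.ofMem (IsDef.congr (P := fun w => ∃ p q,
      (∃ (a : X) (p' : ℤ) (s : FinOrd.{u}), w 1 = a ∧ p = intCode p' ∧ w 2 = s ∧
        q = intCode ((Φ a).toFun p' s)) ∧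
      ∃ x : ℤ × ℤ, w 0 = smallCode _ x ∧ p = intCode x.1 ∧ q = intCode x.2)
      (.ex (.ex (.and (hΦ.app4 (P := fun a p s q => ∃ (a' : X) (p' : ℤ) (s' : FinOrd.{u}),
        a = a' ∧ p = intCode p' ∧ s = s' ∧ q = intCode ((Φ a').toFun p' s')) 3 1 4 0)
        (IsDef.small3' _ _ _ 2 1 0)))) fun w => ?_)
    constructor
    · rintro ⟨x, hx, h⟩
      exact ⟨intCode x.1, intCode x.2, h, x, hx, rfl, rfl⟩
    · rintro ⟨p, q, h, x, hx, rfl, rfl⟩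
      exact ⟨x, hx, h⟩
  refine (congrArg (IsDefMap r) (funext fun v => ?_)).mp (h.comp ofGraph)
  by_cases ha : v 0 ∈ X
  · by_cases hs : v 1 ∈ FinOrd
    · have : {x : ℤ × ℤ | ∃ (a : X) (p : ℤ) (s : FinOrd.{u}), v 0 = a ∧
          intCode.{u} x.1 = intCode p ∧ v 1 = s ∧
          intCode.{u} x.2 = intCode ((Φ a).toFun p s)} =
          {x : ℤ × ℤ | (Φ ⟨v 0, ha⟩).toFun x.1 ⟨v 1, hs⟩ = x.2} := by
        ext x
        constructor
        · rintro ⟨a, p, s, h1, h2, h3, h4⟩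
          obtain rfl : a = ⟨v 0, ha⟩ := Subtype.ext h1.symm
          obtain rfl : s = ⟨v 1, hs⟩ := Subtype.ext h3.symm
          rw [← intCode_injective h2] at h4
          exact (intCode_injective h4).symm
        · intro h
          exact ⟨⟨v 0, ha⟩, x.1, ⟨v 1, hs⟩, rfl, rfl, rfl, congrArg _ (Eq.symm h)⟩
      rw [this, familyValue, dif_pos ha, value_of_mem _ hs]
      exact ofGraph_eq ((Φ ⟨v 0, ha⟩).isAlmostHom ⟨v 1, hs⟩)
    · rw [familyValue, dif_pos ha, value, dif_neg hs, ← ofGraph_empty]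
      refine congrArg ofGraph (Set.eq_empty_of_forall_notMem ?_)
      rintro x ⟨a, p, s, -, -, h, -⟩
      exact hs (h ▸ s.2)
  · rw [familyValue, dif_neg ha, ← ofGraph_empty]
    refine congrArg ofGraph (Set.eq_empty_of_forall_notMem ?_)
    rintro x ⟨a, p, s, h, -⟩
    exact ha (h ▸ a.2)

theorem isDefMap_value (F : DefAlmostHom r) :
    IsDefMap r fun v : Fin 1 → ZFSet.{u} => F.value (v 0) := by
  have hF : IsDefFamily (Set.univ : Set ZFSet.{u}) fun _ => F := by
    refine (F.isDef.subst3 1 2 3).congr fun v => ?_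
    constructor
    · rintro ⟨a, p, s, -, h⟩
      exact ⟨p, s, h⟩
    · rintro ⟨p, s, h⟩
      exact ⟨⟨v 0, trivial⟩, p, s, rfl, h⟩
  refine (congrArg (IsDefMap r) (funext fun v => ?_)).mp
    ((isDefMap_familyValue hF).app2 (n := 1) 0 0)
  exact dif_pos (Set.mem_univ (v 0))

/-- A representative of a Eudoxus real. -/
noncomputable def rep (x : Eudoxus) : ℤ → ℤ := (Quotient.out x : almostHoms).1

theorem isAlmostHom_rep (x : Eudoxus) : IsAlmostHom (rep x) := (Quotient.out x : almostHoms).2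

theorem mk_rep (x : Eudoxus) : Eudoxus.mk (rep x) (isAlmostHom_rep x) = x := Quotient.out_eq x

/-- The converse passage, from definable maps into the reals to definable families: one fixed choice
of representatives, which is a set, turns values into almost homomorphisms. -/
theorem isDef_graph_rep (H : ZFSet.{u} → ZFSet.{u} → Eudoxus)
    (hH : IsDefMap r fun v : Fin 2 → ZFSet.{u} => H (v 0) (v 1)) {X : Set ZFSet.{u}}
    (hX : IsDefClass r X) :
    IsDef r fun v : Fin 4 → ZFSet.{u} => ∃ (a : X) (p : ℤ) (s : FinOrd.{u}),
      v 0 = a ∧ v 1 = intCode p ∧ v 2 = s ∧ v 3 = intCode (rep (H a s) p) := by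
  refine IsDef.congr (P := fun v => v 0 ∈ X ∧ v 2 ∈ FinOrd ∧
    ∃ e, e = smallCode _ (H (v 0) (v 2)) ∧ ∃ i : Eudoxus × ℤ, e = smallCode _ i.1 ∧
      v 1 = intCode i.2 ∧ v 3 = intCode (rep i.1 i.2)) (.and (hX.app1 0)
      (.and ((isDef_finOrd r).app1 2) (.ex (.and ((hH.app2 1 3).graph id 0)
        (IsDef.small3' _ _ _ 0 2 4))))) fun v => ?_
  constructor
  · rintro ⟨a, p, s, h0, h1, h2, h3⟩
    rw [h0, h2]
    exact ⟨a.2, s.2, _, rfl, (_, p), rfl, h1, h3⟩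
  · rintro ⟨ha, hs, e, rfl, ⟨x, p⟩, hx, h1, h3⟩
    refine ⟨⟨_, ha⟩, p, ⟨_, hs⟩, rfl, h1, rfl, ?_⟩
    rw [h3, smallCode_injective hx]

/-- A definable map from sets to the reals, as a definable family of almost homomorphisms. -/
noncomputable def ofMap (h : ZFSet.{u} → Eudoxus)
    (hh : IsDefMap r fun v : Fin 1 → ZFSet.{u} => h (v 0)) : DefAlmostHom r where
  toFun p s := rep (h s) p
  isAlmostHom s := isAlmostHom_rep (h s)
  isDef := by
    have := isDef_graph_rep (r := r) (fun _ s => h s) (hh.app1 1) (X := Set.univ) (IsDef.const True)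
    refine (this.subst (n := 3) ![0, 0, 1, 2]).congr fun v => ?_
    constructor
    · rintro ⟨p, s, h⟩
      exact ⟨⟨v 0, trivial⟩, p, s, rfl, h⟩
    · rintro ⟨a, p, s, -, h⟩
      exact ⟨p, s, h⟩

theorem value_ofMap (h : ZFSet.{u} → Eudoxus)
    (hh : IsDefMap r fun v : Fin 1 → ZFSet.{u} => h (v 0)) {s : ZFSet.{u}} (hs : s ∈ FinOrd) :
    (ofMap h hh).value s = h s := by
  rw [value_of_mem _ hs]
  exact mk_rep (h s)

theorem value_zero (s : ZFSet.{u}) : (zero : DefAlmostHom r).value s = 0 := by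
  by_cases hs : s ∈ FinOrd
  · rw [value_of_mem _ hs]
    rfl
  · exact dif_neg hs

theorem value_add (F G : DefAlmostHom r) (s : ZFSet.{u}) :
    (F.add G).value s = F.value s + G.value s := by
  by_cases hs : s ∈ FinOrd
  · simp only [value_of_mem _ hs]
    rfl
  · simp [value, hs]

theorem agree_eq (F G : DefAlmostHom r) :
    agree F G = {s | s ∈ FinOrd ∧ F.value s = G.value s} := by
  ext s
  constructor
  · rintro ⟨hs, h⟩
    refine ⟨hs, ?_⟩
    rw [value_of_mem _ hs, value_of_mem _ hs]
    exact Eudoxus.mk_eq_mk.2 h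
  · rintro ⟨hs, h⟩
    rw [value_of_mem _ hs, value_of_mem _ hs] at h
    exact ⟨hs, Eudoxus.mk_eq_mk.1 h⟩

end DefAlmostHom

/-! ### The Eudoxus reals are an ordered field -/

theorem IsAlmostHom.abs_natMul_sub_le {f : ℤ → ℤ} {C : ℤ}
    (hC : ∀ p q : ℤ, |f (p + q) - f p - f q| < C) (k : ℕ) (n : ℤ) :
    |f ((k + 1 : ℕ) * n) - (k + 1 : ℕ) * f n| ≤ k * C := by
  induction k with
  | zero => simp
  | succ k ih =>
    have h := hC ((k + 1 : ℕ) * n) n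
    have h2 := abs_add_le (f ((k + 1 : ℕ) * n + n) - f ((k + 1 : ℕ) * n) - f n)
      (f ((k + 1 : ℕ) * n) - (k + 1 : ℕ) * f n)
    have e1 : ((k + 1 + 1 : ℕ) : ℤ) * n = (k + 1 : ℕ) * n + n := by push_cast; ring
    rw [e1]
    have e2 : f ((k + 1 : ℕ) * n + n) - ((k + 1 + 1 : ℕ) : ℤ) * f n =
        (f ((k + 1 : ℕ) * n + n) - f ((k + 1 : ℕ) * n) - f n) +
          (f ((k + 1 : ℕ) * n) - (k + 1 : ℕ) * f n) := by push_cast; ring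
    rw [e2]
    push_cast at *
    linarith

/-- An almost homomorphism is at bounded distance from a linear map. -/
theorem IsAlmostHom.exists_slope {f : ℤ → ℤ} (hf : IsAlmostHom f) :
    ∃ (l C : ℝ), ∀ n : ℤ, |(f n : ℝ) - l * n| ≤ C := by
  obtain ⟨C, hC⟩ := hf
  have hC0 : 0 < C := (abs_nonneg _).trans_lt (hC 0 0)
  -- Comparing both sides with the value of `f` at the common multiple `(m + 1) * (n + 1)` shows
  -- that each lower estimate of the slope is at most each upper estimate. The slope is the supremum
  -- of the lower ones.
  have key : ∀ m n : ℕ, ((f (m + 1 : ℕ) - C : ℤ) : ℝ) / (m + 1 : ℕ) ≤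
      ((f (n + 1 : ℕ) + C : ℤ) : ℝ) / (n + 1 : ℕ) := by
    intro m n
    rw [div_le_div_iff₀ (by positivity) (by positivity)]
    have h1 := abs_le.1 (IsAlmostHom.abs_natMul_sub_le hC m (n + 1 : ℕ))
    have h2 := abs_le.1 (IsAlmostHom.abs_natMul_sub_le hC n (m + 1 : ℕ))
    rw [mul_comm ((n + 1 : ℕ) : ℤ) ((m + 1 : ℕ) : ℤ)] at h2
    have : (f (m + 1 : ℕ) - C) * (n + 1 : ℕ) ≤ (f (n + 1 : ℕ) + C) * (m + 1 : ℕ) := by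
      push_cast at *
      nlinarith
    exact_mod_cast this
  have hbdd : BddAbove (Set.range fun m : ℕ => ((f (m + 1 : ℕ) - C : ℤ) : ℝ) / (m + 1 : ℕ)) :=
    ⟨_, by rintro _ ⟨m, rfl⟩; exact key m 0⟩
  let l : ℝ := ⨆ m : ℕ, ((f (m + 1 : ℕ) - C : ℤ) : ℝ) / (m + 1 : ℕ)
  have hpos : ∀ n : ℕ, |(f (n + 1 : ℕ) : ℝ) - l * (n + 1 : ℕ)| ≤ C := by
    intro n
    have h1 : ((f (n + 1 : ℕ) - C : ℤ) : ℝ) / (n + 1 : ℕ) ≤ l := le_ciSup hbdd n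
    have h2 : l ≤ ((f (n + 1 : ℕ) + C : ℤ) : ℝ) / (n + 1 : ℕ) := ciSup_le fun m => key m n
    rw [div_le_iff₀ (by positivity)] at h1
    rw [le_div_iff₀ (by positivity)] at h2
    rw [abs_le]
    push_cast at *
    constructor <;> linarith
  have h0 : |(f 0 : ℝ)| ≤ C := by
    have h := (hC 0 0).le
    simp only [add_zero, sub_self, zero_sub, abs_neg] at h
    exact_mod_cast h
  -- At negative arguments three errors add up: the one at `-n`, the defect of additivity for `n`
  -- and `-n`, and `|f 0|`.
  refine ⟨l, 3 * C, fun n => ?_⟩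
  rcases lt_trichotomy n 0 with h | rfl | h
  · obtain ⟨k, rfl⟩ : ∃ k : ℕ, n = -((k + 1 : ℕ) : ℤ) := ⟨(-n - 1).toNat, by push_cast; omega⟩
    have h1 := abs_le.1 (hpos k)
    have h2 := hC (-((k + 1 : ℕ) : ℤ)) ((k + 1 : ℕ) : ℤ)
    rw [neg_add_cancel] at h2
    have h3 : |(f 0 : ℝ) - f (-((k + 1 : ℕ) : ℤ)) - f ((k + 1 : ℕ) : ℤ)| < C := by exact_mod_cast h2
    have h3 := abs_lt.1 h3
    have h0 := abs_le.1 h0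
    rw [abs_le]
    push_cast at *
    constructor <;> linarith
  · have : (0 : ℝ) < C := by exact_mod_cast hC0
    simp only [Int.cast_zero, mul_zero, sub_zero]
    linarith
  · obtain ⟨k, rfl⟩ : ∃ k : ℕ, n = ((k + 1 : ℕ) : ℤ) := ⟨(n - 1).toNat, by push_cast; omega⟩
    have : (0 : ℝ) < C := by exact_mod_cast hC0
    have := hpos k
    push_cast at *
    linarith

theorem eq_zero_of_forall_abs_mul_le {a C : ℝ} (h : ∀ n : ℕ, |a * n| ≤ C) : a = 0 := by
  by_contra ha
  obtain ⟨n, hn⟩ := exists_nat_gt (C / |a|)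
  rw [div_lt_iff₀ (abs_pos.2 ha)] at hn
  have := h n
  rw [abs_mul, Nat.abs_cast] at this
  linarith

namespace Eudoxus

/-- The slope of a Eudoxus real. -/
noncomputable def toReal (x : Eudoxus) : ℝ :=
  (DefAlmostHom.isAlmostHom_rep x).exists_slope.choose

theorem toReal_spec (x : Eudoxus) :
    ∃ C : ℝ, ∀ n : ℤ, |(DefAlmostHom.rep x n : ℝ) - x.toReal * n| ≤ C :=
  (DefAlmostHom.isAlmostHom_rep x).exists_slope.choose_spec

/-- The slope was read off from a chosen representative; any other one is at bounded distance from
it. -/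
theorem exists_abs_sub_le {f : ℤ → ℤ} (hf : IsAlmostHom f) :
    ∃ C : ℝ, ∀ n : ℤ, |(f n : ℝ) - (mk f hf).toReal * n| ≤ C := by
  obtain ⟨C, hC⟩ := toReal_spec (mk f hf)
  obtain ⟨D, hD⟩ := mk_eq_mk.1 (DefAlmostHom.mk_rep (mk f hf))
  refine ⟨C + D, fun n => ?_⟩
  have h1 : |(DefAlmostHom.rep (mk f hf) n : ℝ) - f n| < D := by exact_mod_cast hD n
  rw [abs_sub_comm] at h1
  exact (abs_sub_le _ _ _).trans ((add_le_add h1.le (hC n)).trans (add_comm _ _).le)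

theorem toReal_eq {f : ℤ → ℤ} (hf : IsAlmostHom f) {l C : ℝ}
    (h : ∀ n : ℕ, |(f n : ℝ) - l * n| ≤ C) : (mk f hf).toReal = l := by
  obtain ⟨D, hD⟩ := exists_abs_sub_le hf
  rw [← sub_eq_zero]
  refine eq_zero_of_forall_abs_mul_le (C := D + C) fun n => ?_
  have h1 := hD n
  rw [abs_sub_comm] at h1
  have := (abs_sub_le _ _ _).trans (add_le_add h1 (h n))
  push_cast at this
  rwa [← sub_mul] at this

theorem toReal_injective : Function.Injective toReal := by
  intro x y h
  rw [← DefAlmostHom.mk_rep x, ← DefAlmostHom.mk_rep y, mk_eq_mk]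
  obtain ⟨C, hC⟩ := toReal_spec x
  obtain ⟨D, hD⟩ := toReal_spec y
  obtain ⟨E, hE⟩ := exists_int_gt (C + D)
  refine ⟨E, fun n => ?_⟩
  have h1 := hD n
  rw [abs_sub_comm, ← h] at h1
  have h2 := (abs_sub_le _ _ _).trans (add_le_add (hC n) h1)
  have h3 := h2.trans_lt hE
  exact_mod_cast h3

theorem toReal_surjective : Function.Surjective toReal := by
  intro l
  have hf : IsAlmostHom fun n : ℤ => ⌊l * n⌋ := by
    refine ⟨3, fun p q => ?_⟩
    rw [abs_lt]
    have h1 := Int.floor_le (l * p)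
    have h2 := Int.floor_le (l * q)
    have h3 := Int.floor_le (l * (p + q : ℤ))
    have h4 := Int.lt_floor_add_one (l * p)
    have h5 := Int.lt_floor_add_one (l * q)
    have h6 := Int.lt_floor_add_one (l * (p + q : ℤ))
    push_cast at *
    constructor
    · have : (-3 : ℝ) < ⌊l * (p + q)⌋ - ⌊l * p⌋ - ⌊l * q⌋ := by linarith
      exact_mod_cast this
    · have : (⌊l * (p + q)⌋ - ⌊l * p⌋ - ⌊l * q⌋ : ℝ) < 3 := by linarith
      exact_mod_cast this
  refine ⟨mk _ hf, toReal_eq hf (C := 1) fun n => ?_⟩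
  have h1 := Int.floor_le (l * n)
  have h2 := Int.lt_floor_add_one (l * n)
  rw [abs_le]
  push_cast
  constructor <;> linarith

theorem toReal_add (x y : Eudoxus) : (x + y).toReal = x.toReal + y.toReal := by
  obtain ⟨C, hC⟩ := toReal_spec x
  obtain ⟨D, hD⟩ := toReal_spec y
  have : x + y = mk _ ((DefAlmostHom.isAlmostHom_rep x).add (DefAlmostHom.isAlmostHom_rep y)) := by
    conv_lhs => rw [← DefAlmostHom.mk_rep x, ← DefAlmostHom.mk_rep y]
    rfl
  rw [this]
  refine toReal_eq _ (C := C + D) fun n => ?_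
  have := (abs_add_le _ _).trans (add_le_add (hC n) (hD n))
  refine (congrArg abs ?_).trans_le this
  push_cast
  ring

theorem toReal_mul (x y : Eudoxus) : (mul x y).toReal = x.toReal * y.toReal := by
  obtain ⟨C, hC⟩ := toReal_spec x
  obtain ⟨D, hD⟩ := toReal_spec y
  have : mul x y =
      mk _ ((DefAlmostHom.isAlmostHom_rep x).comp (DefAlmostHom.isAlmostHom_rep y)) := by
    conv_lhs => rw [← DefAlmostHom.mk_rep x, ← DefAlmostHom.mk_rep y]
    rfl
  rw [this]
  -- `C` is the error of the outer map at the inner value, and the error `D` of the inner map is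
  -- multiplied by the outer slope.
  refine toReal_eq _ (C := C + |x.toReal| * D) fun n => ?_
  have h1 := hC (DefAlmostHom.rep y n)
  have h2 := mul_le_mul_of_nonneg_left (hD n) (abs_nonneg x.toReal)
  rw [← abs_mul] at h2
  refine (congrArg abs ?_).trans_le ((abs_add_le _ _).trans (add_le_add h1 h2))
  push_cast
  ring

theorem toReal_zero : (0 : Eudoxus).toReal = 0 := by
  have := toReal_add 0 0
  rw [add_zero] at this
  linarith

theorem toReal_one : (mk (fun p => p) isAlmostHom_id).toReal = 1 :=
  toReal_eq _ (C := 0) fun n => by simp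

theorem toReal_neg (x : Eudoxus) : (-x).toReal = -x.toReal := by
  have := toReal_add x (-x)
  rw [add_neg_cancel, toReal_zero] at this
  linarith

theorem isPos_iff (x : Eudoxus) : IsPos x ↔ 0 < x.toReal := by
  constructor
  · rintro ⟨f, hf, rfl, h⟩
    obtain ⟨C, hC⟩ := exists_abs_sub_le hf
    by_contra hn
    obtain ⟨K, hK⟩ := exists_int_gt C
    obtain ⟨m, hm⟩ := h K
    have h1 := (abs_le.1 (hC m)).2
    have h2 : (K : ℝ) < f m := by exact_mod_cast hm
    have h3 : (mk f hf).toReal * (m : ℤ) ≤ 0 :=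
      mul_nonpos_of_nonpos_of_nonneg (not_lt.1 hn) (by simp)
    linarith
  · intro h
    refine ⟨_, _, DefAlmostHom.mk_rep x, fun K => ?_⟩
    obtain ⟨C, hC⟩ := toReal_spec x
    obtain ⟨m, hm⟩ := exists_nat_gt ((K + C) / x.toReal)
    rw [div_lt_iff₀ h] at hm
    have h1 := (abs_le.1 (hC m)).1
    refine ⟨m, ?_⟩
    have : (K : ℝ) < DefAlmostHom.rep x m := by
      push_cast at h1
      linarith
    exact_mod_cast this

theorem le_iff (x y : Eudoxus) : le x y ↔ x.toReal ≤ y.toReal := by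
  rw [le, isPos_iff, sub_eq_add_neg, toReal_add, toReal_neg, ← sub_eq_add_neg, sub_pos, le_iff_lt_or_eq,
    toReal_injective.eq_iff, or_comm]

/-- The real number with the given slope. -/
noncomputable def ofReal : ℝ → Eudoxus := Function.surjInv toReal_surjective

theorem toReal_ofReal (x : ℝ) : (ofReal x).toReal = x := Function.surjInv_eq toReal_surjective x

end Eudoxus

/-! ### Definable properties of almost all finite sets of ordinals -/

/-- The property `P` holds for almost all finite sets of ordinals. -/
def DefUltrafilter.Ev {r : ZFSet.{u} → ZFSet.{u} → Prop} (U : DefUltrafilter r)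
    (P : ZFSet.{u} → Prop) : Prop :=
  {s | s ∈ FinOrd ∧ P s} ∈ U

namespace DefUltrafilter

variable {r : ZFSet.{u} → ZFSet.{u} → Prop} {U : DefUltrafilter r} {P Q : ZFSet.{u} → Prop}

theorem Ev.mono (hP : U.Ev P) (hQ : IsDef r fun v : Fin 1 → ZFSet.{u} => Q (v 0))
    (h : ∀ s ∈ FinOrd, P s → Q s) : U.Ev Q :=
  U.mem_of_superset _ hP _ (fun s hs => ⟨hs.1, h s hs.1 hs.2⟩) (fun _ hs => hs.1)
    ((isDef_finOrd r).and hQ)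

theorem Ev.and (hP : U.Ev P) (hQ : U.Ev Q) : U.Ev fun s => P s ∧ Q s := by
  have := U.inter_mem _ hP _ hQ
  have e : {s | s ∈ FinOrd ∧ P s} ∩ {s | s ∈ FinOrd ∧ Q s} = {s | s ∈ FinOrd ∧ P s ∧ Q s} := by
    ext s
    simp only [Set.mem_inter_iff, Set.mem_ofPred_eq]
    tauto
  rwa [e] at this

theorem ev_of_forall (hP : IsDef r fun v : Fin 1 → ZFSet.{u} => P (v 0))
    (h : ∀ s ∈ FinOrd, P s) : U.Ev P :=
  U.mem_of_superset _ U.univ_mem _ (fun s hs => ⟨hs, h s hs⟩) (fun _ hs => hs.1)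
    ((isDef_finOrd r).and hP)

theorem Ev.exists (hP : U.Ev P) : ∃ s ∈ FinOrd, P s := by
  by_contra h
  refine U.empty_notMem ?_
  have e : {s | s ∈ FinOrd ∧ P s} = ∅ := Set.eq_empty_of_forall_notMem fun s hs => h ⟨s, hs.1, hs.2⟩
  exact e ▸ hP

theorem ev_congr (h : ∀ s ∈ FinOrd, P s ↔ Q s) : U.Ev P ↔ U.Ev Q := by
  have e : {s | s ∈ FinOrd ∧ P s} = {s | s ∈ FinOrd ∧ Q s} := by
    ext s
    exact and_congr_right fun hs => h s hs
  rw [Ev, e]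
  rfl

theorem ev_not (hP : IsDef r fun v : Fin 1 → ZFSet.{u} => P (v 0)) :
    (U.Ev fun s => ¬ P s) ↔ ¬ U.Ev P := by
  constructor
  · intro h h'
    obtain ⟨s, -, h1, h2⟩ := (h.and h').exists
    exact h1 h2
  · intro h
    rcases U.mem_or_compl_mem {s | s ∈ FinOrd ∧ P s} (fun _ hs => hs.1)
      ((isDef_finOrd r).and hP) with h' | h'
    · exact absurd h' h
    · have e : FinOrd \ {s | s ∈ FinOrd ∧ P s} = {s | s ∈ FinOrd ∧ ¬ P s} := by
        ext s
        simp only [Set.mem_sdiff, Set.mem_ofPred_eq]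
        tauto
      rwa [e] at h'

theorem ev_imp (hP : IsDef r fun v : Fin 1 → ZFSet.{u} => P (v 0))
    (hQ : IsDef r fun v : Fin 1 → ZFSet.{u} => Q (v 0)) :
    (U.Ev fun s => P s → Q s) ↔ (U.Ev P → U.Ev Q) := by
  constructor
  · exact fun h h' => (h.and h').mono hQ fun s _ hs => hs.1 hs.2
  · intro h
    by_cases hp : U.Ev P
    · exact (h hp).mono (hP.imp hQ) fun s _ hs _ => hs
    · exact ((ev_not hP).2 hp).mono (hP.imp hQ) fun s _ hs hs' => absurd hs' hs

theorem ev_hat {α : ZFSet.{u}} (hα : α.IsOrdinal) : U.Ev fun s => α ∈ s := U.hat_mem α hα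

theorem ev_forall_finite {α : Type*} [Finite α] {P : α → ZFSet.{u} → Prop}
    (hP : ∀ a, IsDef r fun v : Fin 1 → ZFSet.{u} => P a (v 0)) (h : ∀ a, U.Ev (P a)) :
    U.Ev fun s => ∀ a, P a s := by
  by_contra hn
  rw [← ev_not (IsDef.forall_finite hP)] at hn
  have key : ∀ I : Finset α, U.Ev fun s => (∀ a ∈ I, P a s) ∧ ¬ ∀ a, P a s := by
    intro I
    classical
    induction I using Finset.induction_on with
    | empty => exact (ev_congr fun s _ => by simp).1 hn
    | insert a I _ ih =>
      refine (ev_congr fun s _ => ?_).1 ((h a).and ih)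
      rw [Finset.forall_mem_insert, and_assoc]
  have := Fintype.ofFinite α
  obtain ⟨s, -, h1, h2⟩ := (key Finset.univ).exists
  exact h2 fun a => h1 a (Finset.mem_univ a)

theorem isDef_ev {n : ℕ} {T : ZFSet.{u} → ZFSet.{u} → Prop}
    (hT : IsDef r fun v : Fin 2 → ZFSet.{u} => T (v 0) (v 1)) (i : Fin n) :
    IsDef r fun v : Fin n → ZFSet.{u} => U.Ev (T (v i)) :=
  (show IsDef r fun v : Fin 1 → ZFSet.{u} => U.Ev (T (v 0)) from
    U.family_def (fun v => T (v 0) (v 1)) hT).app1 (P := fun a => U.Ev (T a)) i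

/-- Definability of the ultrafilter concerns families with one index; a pair of indices is packed
into one. -/
theorem isDef_ev₂ {n : ℕ} {T : ZFSet.{u} → ZFSet.{u} → ZFSet.{u} → Prop}
    (hT : IsDef r fun v : Fin 3 → ZFSet.{u} => T (v 0) (v 1) (v 2)) (i j : Fin n) :
    IsDef r fun v : Fin n → ZFSet.{u} => U.Ev (T (v i) (v j)) := by
  refine IsDef.congr (P := fun v => ∃ z, z = ZFSet.pair (v i) (v j) ∧
    U.Ev fun s => ∃ a b, z = ZFSet.pair a b ∧ T a b s) (.ex (.and (IsDef.pair _ _ _)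
      (isDef_ev (T := fun z s => ∃ a b, z = ZFSet.pair a b ∧ T a b s)
        (.ex (.ex (.and (IsDef.pair _ _ _) (hT.app3 _ _ _)))) _))) fun v => ?_
  rw [exists_eq_left]
  refine ev_congr fun s _ => ?_
  simp only [ZFSet.pair_inj]
  constructor
  · exact fun h => ⟨_, _, ⟨rfl, rfl⟩, h⟩
  · rintro ⟨a, b, ⟨rfl, rfl⟩, h⟩
    exact h

theorem isDef_ev₃ {n : ℕ} {T : ZFSet.{u} → ZFSet.{u} → ZFSet.{u} → ZFSet.{u} → Prop}
    (hT : IsDef r fun v : Fin 4 → ZFSet.{u} => T (v 0) (v 1) (v 2) (v 3)) (i j k : Fin n) :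
    IsDef r fun v : Fin n → ZFSet.{u} => U.Ev (T (v i) (v j) (v k)) := by
  refine IsDef.congr (P := fun v => ∃ z, z = ZFSet.pair (v i) (v j) ∧
    U.Ev fun s => ∃ a b, z = ZFSet.pair a b ∧ T a b (v k) s) (.ex (.and (IsDef.pair _ _ _)
      (isDef_ev₂ (T := fun z c s => ∃ a b, z = ZFSet.pair a b ∧ T a b c s)
        (.ex (.ex (.and (IsDef.pair _ _ _) (hT.app4 _ _ _ _)))) _ _))) fun v => ?_
  rw [exists_eq_left]
  refine ev_congr fun s _ => ?_
  simp only [ZFSet.pair_inj]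
  constructor
  · exact fun h => ⟨_, _, ⟨rfl, rfl⟩, h⟩
  · rintro ⟨a, b, ⟨rfl, rfl⟩, h⟩
    exact h

end DefUltrafilter

/-! ### The theorem of Łoś -/

namespace Hyper

open FirstOrder.Language DefAlmostHom

variable {r : ZFSet.{u} → ZFSet.{u} → Prop} {U : DefUltrafilter r}

theorem exists_mk_eq (x : Hyper U) : ∃ F, mk U F = x := Quotient.exists_rep x

theorem mk_eq_mk {F G : DefAlmostHom r} :
    mk U F = mk U G ↔ U.Ev fun s => F.value s = G.value s := by
  rw [DefUltrafilter.Ev, ← agree_eq]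
  exact Quotient.eq (r := familySetoid U)

theorem isDefMap_values {α : Type} [Finite α] (F : α → DefAlmostHom r) :
    IsDefMap r fun v : Fin 1 → ZFSet.{u} => fun a => (F a).value (v 0) :=
  IsDefMap.pi fun a => isDefMap_value (F a)

theorem isDef_values {α : Type} [Finite α] (F : α → DefAlmostHom r)
    (Q : (α → Eudoxus) → Prop) :
    IsDef r fun v : Fin 1 → ZFSet.{u} => Q fun a => (F a).value (v 0) :=
  (isDefMap_values F).prop Q

/-- The structure asks for some representatives of the arguments. Finitely many changes of
representative affect the values only outside a class in the ultrafilter, so any representatives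
will do. -/
theorem relMap_mk {n : ℕ} (R : fullLang.Relations n) (F : Fin n → DefAlmostHom r) :
    Structure.RelMap (L := fullLang) R (fun i => mk U (F i)) ↔
      U.Ev fun s => Structure.RelMap (L := fullLang) R fun i => (F i).value s := by
  have key : ∀ G : Fin n → DefAlmostHom r, {s : ZFSet.{u} | ∃ h : s ∈ FinOrd,
      Structure.RelMap (L := fullLang) R (fun i => (G i).slice ⟨s, h⟩)} =
      {s | s ∈ FinOrd ∧ Structure.RelMap (L := fullLang) R fun i => (G i).value s} := by
    intro G
    ext s
    simp only [Set.mem_ofPred_eq, ← exists_prop]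
    refine exists_congr fun hs => ?_
    simp only [value_of_mem _ hs]
  constructor
  · rintro ⟨G, hG, h⟩
    rw [key G] at h
    have h1 := DefUltrafilter.ev_forall_finite (U := U)
      (P := fun i s => (G i).value s = (F i).value s)
      (fun i => ((isDefMap_value (G i)).prodMk (isDefMap_value (F i))).prop fun x => x.1 = x.2)
      fun i => mk_eq_mk.1 (hG i)
    refine (DefUltrafilter.Ev.and (U := U) h h1).mono (isDef_values F _) fun s _ hs => ?_
    simp only [← hs.2]
    exact hs.1
  · intro h
    refine ⟨F, fun i => rfl, ?_⟩
    rw [key F]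
    exact h

theorem value_one {s : ZFSet.{u}} (hs : s ∈ FinOrd) :
    (one : DefAlmostHom r).value s = Eudoxus.mk (fun p => p) isAlmostHom_id :=
  value_of_mem _ hs

theorem value_comp (F G : DefAlmostHom r) {s : ZFSet.{u}} (hs : s ∈ FinOrd) :
    (F.comp G).value s = Eudoxus.mul (F.value s) (G.value s) := by
  simp only [value_of_mem _ hs]
  rfl

theorem exists_funMap_mk {n : ℕ} (f : fullLang.Functions n) (F : Fin n → DefAlmostHom r) :
    ∃ G, Structure.funMap (L := fullLang) f (fun i => mk U (F i)) = mk U G ∧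
      ∀ s ∈ FinOrd, G.value s = Structure.funMap (L := fullLang) f fun i => (F i).value s := by
  cases f with
  | zero => exact ⟨zero, rfl, fun s _ => value_zero s⟩
  | one => exact ⟨one, rfl, fun s hs => value_one hs⟩
  | add => exact ⟨(F 0).add (F 1), rfl, fun s _ => value_add _ _ s⟩
  | mul => exact ⟨(F 0).comp (F 1), rfl, fun s hs => value_comp _ _ hs⟩

theorem exists_realize_mk {α : Type} (t : fullLang.Term α) (F : α → DefAlmostHom r) :
    ∃ G, t.realize (fun i => mk U (F i)) = mk U G ∧
      ∀ s ∈ FinOrd, G.value s = t.realize fun i => (F i).value s := by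
  induction t with
  | var i => exact ⟨F i, rfl, fun s _ => rfl⟩
  | func f t ih =>
    choose G hG hG' using ih
    obtain ⟨H, hH, hH'⟩ := exists_funMap_mk (U := U) f G
    refine ⟨H, ?_, fun s hs => ?_⟩
    · rw [← hH]
      exact congrArg _ (funext hG)
    · rw [hH' s hs]
      exact congrArg _ (funext fun i => hG' i s hs)

theorem exists_ofMap (h : ZFSet.{u} → Eudoxus)
    (hh : IsDefMap r fun v : Fin 1 → ZFSet.{u} => h (v 0)) :
    ∃ F : DefAlmostHom r, ∀ s ∈ FinOrd, F.value s = h s :=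
  ⟨ofMap h hh, fun _ hs => value_ofMap h hh hs⟩

/-- This is an induction on the formula. Satisfaction in the reals is a predicate on a small type of
tuples, so every class of `s` that occurs is definable; implication uses that the ultrafilter
decides such classes, and the universal quantifier uses Skolem functions. -/
theorem realize_boundedFormula {α : Type} [Finite α] {n : ℕ} (φ : fullLang.BoundedFormula α n)
    (F : α → DefAlmostHom r) (G : Fin n → DefAlmostHom r) :
    φ.Realize (fun a => mk U (F a)) (fun i => mk U (G i)) ↔
      U.Ev fun s => φ.Realize (fun a => (F a).value s) fun i => (G i).value s := by
  have hdef : ∀ {n : ℕ} (φ : fullLang.BoundedFormula α n) (G : Fin n → DefAlmostHom r),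
      IsDef r fun v : Fin 1 → ZFSet.{u} =>
        φ.Realize (fun a => (F a).value (v 0)) fun i => (G i).value (v 0) := fun φ G =>
    ((isDefMap_values F).prodMk (isDefMap_values G)).prop fun x => φ.Realize x.1 x.2
  have hterm : ∀ {n : ℕ} (t : fullLang.Term (α ⊕ Fin n)) (G : Fin n → DefAlmostHom r), ∃ H,
      t.realize (Sum.elim (fun a => mk U (F a)) fun i => mk U (G i)) = mk U H ∧ ∀ s ∈ FinOrd,
        H.value s = t.realize (Sum.elim (fun a => (F a).value s) fun i => (G i).value s) := by
    intro n t G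
    obtain ⟨H, h1, h2⟩ := exists_realize_mk (U := U) t (Sum.elim F G)
    refine ⟨H, ?_, fun s hs => ?_⟩
    · rw [← h1]
      congr 1
      ext1 i
      cases i <;> rfl
    · rw [h2 s hs]
      congr 1
      ext1 i
      cases i <;> rfl
  induction φ with
  | falsum => exact ⟨fun h => h.elim, fun h => by obtain ⟨s, -, h⟩ := h.exists; exact h⟩
  | equal t₁ t₂ =>
    obtain ⟨H₁, h1, h1'⟩ := hterm t₁ G
    obtain ⟨H₂, h2, h2'⟩ := hterm t₂ G
    simp only [BoundedFormula.Realize]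
    rw [h1, h2, mk_eq_mk]
    exact DefUltrafilter.ev_congr fun s hs => by rw [h1' s hs, h2' s hs]
  | rel R ts =>
    choose H h1 h2 using fun i => hterm (ts i) G
    simp only [BoundedFormula.Realize]
    simp only [h1]
    rw [relMap_mk]
    exact DefUltrafilter.ev_congr fun s hs => by simp only [h2 _ s hs]
  | imp φ ψ ih1 ih2 =>
    simp only [BoundedFormula.realize_imp]
    exact (imp_congr (ih1 G) (ih2 G)).trans (DefUltrafilter.ev_imp (hdef φ G) (hdef ψ G)).symm
  | @all n φ ih =>
    simp only [BoundedFormula.realize_all]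
    have hsnoc : ∀ H : DefAlmostHom r,
        (φ.Realize (fun a => mk U (F a)) (Fin.snoc (fun i => mk U (G i)) (mk U H)) ↔
          U.Ev fun s => φ.Realize (fun a => (F a).value s)
            (Fin.snoc (fun i => (G i).value s) (H.value s))) := by
      intro H
      have h := ih (Fin.snoc G H)
      have e1 : (fun i => mk U ((Fin.snoc G H : Fin (n + 1) → DefAlmostHom r) i)) =
          Fin.snoc (fun i => mk U (G i)) (mk U H) := Fin.comp_snoc (mk U) G H
      have e2 : ∀ s, (fun i => ((Fin.snoc G H : Fin (n + 1) → DefAlmostHom r) i).value s) =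
          Fin.snoc (fun i => (G i).value s) (H.value s) := fun s =>
        Fin.comp_snoc (fun F : DefAlmostHom r => F.value s) G H
      simp only [e1, e2] at h
      exact h
    constructor
    · intro h
      by_contra hn
      rw [← DefUltrafilter.ev_not (hdef φ.all G)] at hn
      -- Counterexamples are chosen as a function of the tuple of reals and not of `s`. The choice
      -- is then a set, and its composition with the definable map of values is again definable.
      have hch : ∀ x : (α → Eudoxus) × (Fin n → Eudoxus), ∃ y,
          (¬ ∀ z, φ.Realize x.1 (Fin.snoc x.2 z)) → ¬ φ.Realize x.1 (Fin.snoc x.2 y) := by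
        intro x
        by_cases hx : ∀ z, φ.Realize x.1 (Fin.snoc x.2 z)
        · exact ⟨0, fun h => absurd hx h⟩
        · obtain ⟨y, hy⟩ := not_forall.1 hx
          exact ⟨y, fun _ => hy⟩
      choose g hg using hch
      obtain ⟨H, hH⟩ := exists_ofMap
        (fun s => g (fun a => (F a).value s, fun i => (G i).value s))
        (((isDefMap_values F).prodMk (isDefMap_values G)).comp g)
      obtain ⟨s, hs, h1, h2⟩ := (hn.and ((hsnoc H).1 (h (mk U H)))).exists
      rw [hH s hs] at h2
      exact hg (fun a => (F a).value s, fun i => (G i).value s) h1 h2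
    · intro h x
      obtain ⟨H, rfl⟩ := exists_mk_eq x
      rw [hsnoc]
      have hd := ((isDefMap_values F).prodMk ((isDefMap_values G).prodMk (isDefMap_value H))).prop
        fun x => φ.Realize x.1 (Fin.snoc x.2.1 x.2.2)
      exact h.mono hd fun s _ hs => hs _

theorem realize_formula {α : Type} [Finite α] (φ : fullLang.Formula α) (F : α → DefAlmostHom r) :
    φ.Realize (fun a => mk U (F a)) ↔ U.Ev fun s => φ.Realize fun a => (F a).value s := by
  have h := realize_boundedFormula (U := U) φ F (Fin.elim0 : Fin 0 → DefAlmostHom r)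
  have e : ∀ (v : α → Hyper U) (w : Fin 0 → Hyper U),
      φ.Realize v ↔ BoundedFormula.Realize φ v w := fun v w =>
    iff_of_eq (congrArg (BoundedFormula.Realize φ v) (Subsingleton.elim _ _))
  have e' : ∀ (v : α → Eudoxus) (w : Fin 0 → Eudoxus),
      φ.Realize v ↔ BoundedFormula.Realize φ v w := fun v w =>
    iff_of_eq (congrArg (BoundedFormula.Realize φ v) (Subsingleton.elim _ _))
  exact (e _ _).trans (h.trans (DefUltrafilter.ev_congr fun s _ => (e' _ _).symm))

theorem isDefMap_const {n : ℕ} {ι : Type} (x : ι) :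
    IsDefMap r fun _ : Fin n → ZFSet.{u} => x := IsDef.eq_const _ _

variable (U) in
/-- The canonical elementary embedding of the reals. -/
noncomputable def embedding : Eudoxus ↪ₑ[fullLang] Hyper U where
  toFun x := mk U (ofMap (fun _ => x) (isDefMap_const x))
  map_formula' {n} φ x := by
    refine (realize_formula φ fun i => ofMap (fun _ => x i) (isDefMap_const (x i))).trans ?_
    have : ∀ s ∈ FinOrd, (φ.Realize (fun i => (ofMap (r := r) (fun _ => x i)
        (isDefMap_const (x i))).value s) ↔ φ.Realize x) := fun s hs => by
      simp only [value_ofMap _ _ hs]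
    rw [DefUltrafilter.ev_congr this]
    constructor
    · intro h
      obtain ⟨s, -, h⟩ := h.exists
      exact h
    · exact fun h => DefUltrafilter.ev_of_forall (IsDef.const _) fun _ _ => h

/-! ### The ordered field of hyperreals -/

theorem mk_eq_mk_iff_toReal {F G : DefAlmostHom r} :
    mk U F = mk U G ↔ U.Ev fun s => (F.value s).toReal = (G.value s).toReal := by
  rw [mk_eq_mk]
  exact DefUltrafilter.ev_congr fun s _ => Eudoxus.toReal_injective.eq_iff.symm

/-- Identities between hyperreals thus reduce to identities between real numbers at each `s`. -/
theorem mk_eq_mk_of_toReal {F G : DefAlmostHom r}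
    (h : ∀ s ∈ FinOrd, (F.value s).toReal = (G.value s).toReal) : mk U F = mk U G :=
  mk_eq_mk.2 (DefUltrafilter.ev_of_forall
    (((isDefMap_value F).prodMk (isDefMap_value G)).prop fun x => x.1 = x.2)
    fun s hs => Eudoxus.toReal_injective (h s hs))

theorem exists_real_map (g : ℝ → ℝ) (F : DefAlmostHom r) :
    ∃ G : DefAlmostHom r, ∀ s ∈ FinOrd, (G.value s).toReal = g (F.value s).toReal := by
  obtain ⟨G, hG⟩ := exists_ofMap (fun s => Eudoxus.ofReal (g (F.value s).toReal))
    ((isDefMap_value F).comp fun x => Eudoxus.ofReal (g x.toReal))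
  exact ⟨G, fun s hs => by rw [hG s hs, Eudoxus.toReal_ofReal]⟩

/-- The image of a family under a map on the reals. -/
noncomputable def realMap (g : ℝ → ℝ) (F : DefAlmostHom r) : DefAlmostHom r :=
  (exists_real_map g F).choose

theorem toReal_realMap (g : ℝ → ℝ) (F : DefAlmostHom r) {s : ZFSet.{u}} (hs : s ∈ FinOrd) :
    ((realMap g F).value s).toReal = g (F.value s).toReal :=
  (exists_real_map g F).choose_spec s hs

theorem toReal_add (F G : DefAlmostHom r) (s : ZFSet.{u}) :
    ((F.add G).value s).toReal = (F.value s).toReal + (G.value s).toReal := by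
  rw [value_add, Eudoxus.toReal_add]

theorem toReal_comp (F G : DefAlmostHom r) {s : ZFSet.{u}} (hs : s ∈ FinOrd) :
    ((F.comp G).value s).toReal = (F.value s).toReal * (G.value s).toReal := by
  rw [value_comp _ _ hs, Eudoxus.toReal_mul]

theorem toReal_zero (s : ZFSet.{u}) : ((zero : DefAlmostHom r).value s).toReal = 0 := by
  rw [value_zero, Eudoxus.toReal_zero]

theorem toReal_one {s : ZFSet.{u}} (hs : s ∈ FinOrd) :
    ((one : DefAlmostHom r).value s).toReal = 1 := by
  rw [value_one hs, Eudoxus.toReal_one]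

theorem isDef_toReal (F G : DefAlmostHom r) (Q : ℝ → ℝ → Prop) :
    IsDef r fun v : Fin 1 → ZFSet.{u} => Q (F.value (v 0)).toReal (G.value (v 0)).toReal :=
  ((isDefMap_value F).prodMk (isDefMap_value G)).prop fun x => Q x.1.toReal x.2.toReal

theorem mk_zero_ne_one : mk U zero ≠ mk U one := by
  intro h
  obtain ⟨s, hs, h⟩ := (mk_eq_mk_iff_toReal.1 h).exists
  rw [toReal_zero, toReal_one hs] at h
  exact zero_ne_one h

variable (U) in
/-- The field of hyperreals. -/
@[reducible] noncomputable def field : Field (Hyper U) :=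
  let _ : Add (Hyper U) := ⟨add U⟩
  let _ : Mul (Hyper U) := ⟨mul U⟩
  let _ : Zero (Hyper U) := ⟨mk U zero⟩
  let _ : One (Hyper U) := ⟨mk U one⟩
  -- Negation and inversion act on representatives picked by `Quotient.out`, which avoids a proof of
  -- independence of the representative.
  let _ : Neg (Hyper U) := ⟨fun x => mk U (realMap (fun t => -t) (Quotient.out x : DefAlmostHom r))⟩
  let _ : Inv (Hyper U) := ⟨fun x => mk U (realMap (fun t => t⁻¹) (Quotient.out x : DefAlmostHom r))⟩
  Field.ofMinimalAxioms (Hyper U)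
  (by
    rintro ⟨F⟩ ⟨G⟩ ⟨H⟩
    refine mk_eq_mk_of_toReal (F := (F.add G).add H) (G := F.add (G.add H)) fun s hs => ?_
    simp only [toReal_add]
    ring)
  (by
    rintro ⟨F⟩
    refine mk_eq_mk_of_toReal (F := zero.add F) (G := F) fun s hs => ?_
    simp only [toReal_add, toReal_zero]
    ring)
  (by
    intro x
    have h : mk U (Quotient.out x : DefAlmostHom r) = x := Quotient.out_eq x
    change add U (mk U (realMap (fun t => -t) (Quotient.out x : DefAlmostHom r))) x = mk U zero
    generalize (Quotient.out x : DefAlmostHom r) = F at h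
    subst h
    refine mk_eq_mk_of_toReal (F := (realMap (fun t => -t) F).add F) (G := zero) fun s hs => ?_
    rw [toReal_add, toReal_realMap _ _ hs, toReal_zero]
    ring)
  (by
    rintro ⟨F⟩ ⟨G⟩ ⟨H⟩
    refine mk_eq_mk_of_toReal (F := (F.comp G).comp H) (G := F.comp (G.comp H)) fun s hs => ?_
    simp only [toReal_comp _ _ hs]
    ring)
  (by
    rintro ⟨F⟩ ⟨G⟩
    refine mk_eq_mk_of_toReal (F := F.comp G) (G := G.comp F) fun s hs => ?_
    simp only [toReal_comp _ _ hs]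
    ring)
  (by
    rintro ⟨F⟩
    refine mk_eq_mk_of_toReal (F := one.comp F) (G := F) fun s hs => ?_
    simp only [toReal_comp _ _ hs, toReal_one hs]
    ring)
  (by
    intro x hx
    have h : mk U (Quotient.out x : DefAlmostHom r) = x := Quotient.out_eq x
    change mul U x (mk U (realMap (fun t => t⁻¹) (Quotient.out x : DefAlmostHom r))) = mk U one
    change x ≠ mk U zero at hx
    generalize (Quotient.out x : DefAlmostHom r) = F at h
    subst h
    rw [ne_eq, mk_eq_mk_iff_toReal,
      ← DefUltrafilter.ev_not (isDef_toReal F zero fun x y => x = y)] at hx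
    refine (mk_eq_mk_iff_toReal (F := F.comp (realMap (fun t => t⁻¹) F)) (G := one)).2
      (hx.mono (isDef_toReal _ _ fun x y => x = y) fun s hs h0 => ?_)
    rw [toReal_zero] at h0
    rw [toReal_comp _ _ hs, toReal_realMap _ _ hs, toReal_one hs, mul_inv_cancel₀ h0])
  (by
    refine mk_eq_mk_iff_toReal.2 ?_
    have h : mk U (Quotient.out (mk U zero) : DefAlmostHom r) = mk U zero := Quotient.out_eq _
    -- The representative picked for `0` need vanish only for almost all `s`, so the pointwise
    -- identity is available only there.
    refine (mk_eq_mk_iff_toReal.1 h).mono (isDef_toReal _ _ fun x y => x = y) fun s hs h0 => ?_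
    refine (toReal_realMap _ _ hs).trans ?_
    rw [toReal_zero] at h0 ⊢
    exact inv_eq_zero.2 h0)
  (by
    rintro ⟨F⟩ ⟨G⟩ ⟨H⟩
    refine mk_eq_mk_of_toReal (F := F.comp (G.add H)) (G := (F.comp G).add (F.comp H))
      fun s hs => ?_
    simp only [toReal_comp _ _ hs, toReal_add]
    ring)
  ⟨_, _, mk_zero_ne_one⟩

/-- The order of the hyperreals. -/
def HLe (x y : Hyper U) : Prop := Structure.RelMap (L := fullLang) FullRel.le ![x, y]

theorem hLe_mk {F G : DefAlmostHom r} :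
    HLe (mk U F) (mk U G) ↔ U.Ev fun s => (F.value s).toReal ≤ (G.value s).toReal := by
  have h := relMap_mk (U := U) FullRel.le ![F, G]
  have e : (fun i => mk U ((![F, G] : Fin 2 → DefAlmostHom r) i)) = ![mk U F, mk U G] := by
    funext i
    fin_cases i <;> rfl
  rw [e] at h
  exact h.trans (DefUltrafilter.ev_congr fun s _ => Eudoxus.le_iff _ _)

variable (U) in
open Classical in
/-- The linear order of the hyperreals. -/
@[reducible] noncomputable def linearOrder : LinearOrder (Hyper U) where
  le := HLe
  le_refl := by
    rintro ⟨F⟩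
    exact hLe_mk.2 (DefUltrafilter.ev_of_forall (isDef_toReal _ _ fun x y => x ≤ y)
      fun s _ => le_rfl)
  le_trans := by
    rintro ⟨F⟩ ⟨G⟩ ⟨H⟩ h1 h2
    exact hLe_mk.2 (((hLe_mk.1 h1).and (hLe_mk.1 h2)).mono (isDef_toReal _ _ fun x y => x ≤ y)
      fun s _ h => h.1.trans h.2)
  le_antisymm := by
    rintro ⟨F⟩ ⟨G⟩ h1 h2
    exact mk_eq_mk_iff_toReal.2 (((hLe_mk.1 h1).and (hLe_mk.1 h2)).mono
      (isDef_toReal _ _ fun x y => x = y) fun s _ h => h.1.antisymm h.2)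
  le_total := by
    rintro ⟨F⟩ ⟨G⟩
    by_cases h : HLe (mk U F) (mk U G)
    · exact Or.inl h
    · refine Or.inr (hLe_mk.2 ?_)
      rw [hLe_mk, ← DefUltrafilter.ev_not (isDef_toReal _ _ fun x y => x ≤ y)] at h
      exact h.mono (isDef_toReal _ _ fun x y => x ≤ y) fun s _ h => (not_le.1 h).le
  toDecidableLE := Classical.decRel _

theorem isOrderedFieldStructure : IsOrderedFieldStructure (Hyper U) := by
  let _ := field U
  let _ := linearOrder U
  have hlt : ∀ F G : DefAlmostHom r,
      mk U F < mk U G ↔ U.Ev fun s => (F.value s).toReal < (G.value s).toReal := by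
    intro F G
    rw [← not_le]
    have : mk U G ≤ mk U F ↔ _ := hLe_mk
    rw [this, ← DefUltrafilter.ev_not (isDef_toReal _ _ fun x y => x ≤ y)]
    exact DefUltrafilter.ev_congr fun s _ => not_le
  have : IsOrderedAddMonoid (Hyper U) := by
    refine { add_le_add_left := ?_ }
    rintro ⟨F⟩ ⟨G⟩ h ⟨H⟩
    refine (hLe_mk (F := F.add H) (G := G.add H)).2 ((hLe_mk.1 h).mono
      (isDef_toReal _ _ fun x y => x ≤ y) fun s _ h => ?_)
    simp only [toReal_add]
    linarith
  have : ZeroLEOneClass (Hyper U) := ⟨hLe_mk.2 (DefUltrafilter.ev_of_forall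
    (isDef_toReal _ _ fun x y => x ≤ y) fun s hs => by
      rw [toReal_zero, toReal_one hs]
      exact zero_le_one)⟩
  refine ⟨field U, linearOrder U, IsStrictOrderedRing.of_mul_pos ?_, fun _ => rfl, fun _ => rfl,
    fun _ => rfl, fun _ => rfl, fun x => ?_⟩
  · rintro ⟨F⟩ ⟨G⟩ h1 h2
    refine (hlt zero (F.comp G)).2 ((((hlt zero F).1 h1).and ((hlt zero G).1 h2)).mono
      (isDef_toReal _ _ fun x y => x < y) fun s hs h => ?_)
    simp only [toReal_zero] at h ⊢
    rw [toReal_comp _ _ hs]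
    exact mul_pos h.1 h.2
  · change _ ↔ HLe (x 0) (x 1)
    rw [HLe, show ![x 0, x 1] = x from funext fun i => by fin_cases i <;> rfl]

/-! ### The size of the hyperreals -/

/-- The intersection with `α` ranges over the power set of `α`, so the cardinality function on these
subsets is a set and may be used as a parameter. -/
theorem isDefMap_ncard (α : ZFSet.{u}) : IsDefMap r fun v : Fin 1 → ZFSet.{u} =>
    ({x | x ∈ v 0 ∧ x ∈ α} : Set ZFSet.{u}).ncard := by
  have : Small.{u} (α.powerset : Set ZFSet.{u}) := ZFSet.small_coe α.powerset
  refine IsDef.congr (P := fun w => ∃ y, (∀ z, z ∈ y ↔ z ∈ w 1 ∧ z ∈ α) ∧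
    ZFSet.pair y (w 0) ∈ ZFSet.range fun y : (α.powerset : Set ZFSet.{u}) =>
      ZFSet.pair y.1 (smallCode ℕ (y.1 : Set ZFSet.{u}).ncard))
    (.ex (.and (.all (.iff (IsDef.mem 0 1) (.and (IsDef.mem 0 3) (IsDef.mem_const 0 α))))
      (IsDef.pair_mem_const 0 1 _))) fun w => ?_
  have hset : ∀ y : ZFSet.{u}, (∀ z, z ∈ y ↔ z ∈ w 1 ∧ z ∈ α) →
      (y : Set ZFSet.{u}) = {x | x ∈ w 1 ∧ x ∈ α} := fun y hy => Set.ext hy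
  simp only [ZFSet.mem_range, ZFSet.pair_inj]
  constructor
  · intro h
    have hy : ∀ z, z ∈ ZFSet.sep (fun x => x ∈ w 1) α ↔ z ∈ w 1 ∧ z ∈ α := fun z => by
      rw [ZFSet.mem_sep, and_comm]
    generalize ZFSet.sep (fun x => x ∈ w 1) α = y at hy
    refine ⟨y, hy, ⟨y, ZFSet.mem_powerset.2 fun z hz => ((hy z).1 hz).2⟩, rfl, ?_⟩
    rw [h, hset y hy]
    rfl
  · rintro ⟨y, hy, y', rfl, h⟩
    rw [← h, hset _ hy]
    rfl

/-- For `α < β` and every `s` containing `α`, the finite set `s ∩ α` is a proper subset of `s ∩ β`,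
as `α` belongs only to the latter. The counting functions thus inject the ordinals into the
hyperreals. -/
theorem not_small : ¬ Small.{u} (Hyper U) := by
  intro hs
  let N : Ordinal.{u} → ZFSet.{u} → ℕ := fun α s =>
    ({x | x ∈ s ∧ x ∈ α.toZFSet} : Set ZFSet.{u}).ncard
  choose F hF using fun α : Ordinal.{u} => exists_ofMap (r := r)
    (fun s => Eudoxus.ofReal (N α s)) ((isDefMap_ncard α.toZFSet).comp fun n => Eudoxus.ofReal n)
  have hne : ∀ α β : Ordinal.{u}, α < β → mk U (F α) ≠ mk U (F β) := by
    intro α β hαβ h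
    obtain ⟨s, hs, h1, h2⟩ := ((mk_eq_mk_iff_toReal.1 h).and
      (DefUltrafilter.ev_hat (ZFSet.isOrdinal_toZFSet α))).exists
    rw [hF α s hs, hF β s hs, Eudoxus.toReal_ofReal, Eudoxus.toReal_ofReal] at h1
    refine absurd (Nat.cast_injective h1) (ne_of_lt ?_)
    refine Set.ncard_lt_ncard ⟨fun x hx => ⟨hx.1, Ordinal.toZFSet_monotone hαβ.le hx.2⟩,
      fun hsub => ?_⟩ (hs.1.subset fun x hx => hx.1)
    exact ZFSet.mem_irrefl _ (hsub ⟨h2, Ordinal.toZFSet_mem_toZFSet_iff.2 hαβ⟩).2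
  have hinj : Function.Injective fun α => mk U (F α) := by
    intro α β h
    rcases lt_trichotomy α β with h' | h' | h'
    · exact absurd h (hne α β h')
    · exact h'
    · exact absurd h.symm (hne β α h')
  exact not_small_ordinal.{u, u} (small_of_injective hinj)

/-- The canonical embedding is not onto by size: the reals form a small type. -/
theorem isHyperreal : IsHyperreal (Hyper U) := by
  refine ⟨isOrderedFieldStructure, embedding U, fun h => not_small (U := U) ?_⟩
  exact small_of_surjective h

end Hyper

/-! ### Finite sequences of sets -/

theorem mem_natCode {n : ℕ} {z : ZFSet.{u}} : z ∈ natCode n ↔ ∃ i : Fin n, z = natCode i := by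
  rw [natCode, Ordinal.mem_toZFSet_iff]
  constructor
  · rintro ⟨a, ha, rfl⟩
    obtain ⟨m, rfl⟩ := Ordinal.lt_omega0.1 (ha.trans (Ordinal.natCast_lt_omega0 n))
    exact ⟨⟨m, by exact_mod_cast ha⟩, rfl⟩
  · rintro ⟨i, rfl⟩
    exact ⟨(i : ℕ), by exact_mod_cast i.2, rfl⟩

theorem pair_mem_seqCode {n : ℕ} {x : Fin n → ZFSet.{u}} {a b : ZFSet.{u}} :
    ZFSet.pair a b ∈ seqCode x ↔ ∃ i : Fin n, a = natCode i ∧ b = x i := by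
  rw [seqCode, ZFSet.mem_range]
  refine exists_congr fun i => ?_
  rw [ZFSet.pair_inj, eq_comm, eq_comm (a := x i)]

theorem natCode_pair_mem_seqCode {n : ℕ} {x : Fin n → ZFSet.{u}} {i : Fin n} {b : ZFSet.{u}} :
    ZFSet.pair (natCode i) b ∈ seqCode x ↔ b = x i := by
  rw [pair_mem_seqCode]
  constructor
  · rintro ⟨j, hj, rfl⟩
    rw [Fin.ext (natCode_injective hj)]
  · rintro rfl
    exact ⟨i, rfl, rfl⟩

theorem le_of_seqCode_eq {m n : ℕ} {x : Fin m → ZFSet.{u}} {y : Fin n → ZFSet.{u}}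
    (h : seqCode x = seqCode y) : m ≤ n := by
  by_contra hn
  have h1 : ZFSet.pair (natCode n) (x ⟨n, not_le.1 hn⟩) ∈ seqCode x :=
    natCode_pair_mem_seqCode (i := ⟨n, not_le.1 hn⟩).2 rfl
  rw [h, pair_mem_seqCode] at h1
  obtain ⟨i, hi, -⟩ := h1
  exact absurd (natCode_injective hi) i.2.ne'

theorem seqCode_injective {n : ℕ} : Function.Injective (seqCode.{u} (m := n)) := by
  intro x y h
  funext i
  rw [← natCode_pair_mem_seqCode, ← h, natCode_pair_mem_seqCode]

section

variable {r : ZFSet.{u} → ZFSet.{u} → Prop} {N : ℕ}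

theorem isDef_seq {X : Set ZFSet.{u}} (hX : IsDefClass r X) (i : Fin N) :
    IsDef r fun v : Fin N → ZFSet.{u} =>
      ∃ (n : ℕ) (a : Fin n → X), v i = seqCode fun l => (a l : ZFSet.{u}) := by
  refine IsDef.congr (P := fun v => ∃ k, (∃ n : ℕ, k = natCode n) ∧
    (∀ z, z ∈ v i → ∃ j x, j ∈ k ∧ x ∈ X ∧ z = ZFSet.pair j x) ∧
    ∀ j, j ∈ k → ∃ x, ZFSet.pair j x ∈ v i ∧ ∀ y, ZFSet.pair j y ∈ v i → y = x)
    (.ex (.and (IsDef.small1 _ _) (.and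
      (.all (.imp (IsDef.mem _ _) (.ex (.ex (.and (IsDef.mem 1 3)
        (.and (hX.app1 0) (IsDef.pair _ _ _)))))))
      (.all (.imp (IsDef.mem 0 1) (.ex (.and (IsDef.pair_mem _ _ _)
        (.all (.imp (IsDef.pair_mem _ _ _) (IsDef.eq 0 1)))))))))) fun v => ?_
  constructor
  · rintro ⟨n, a, h⟩
    rw [h]
    refine ⟨_, ⟨n, rfl⟩, fun z hz => ?_, fun j hj => ?_⟩
    · obtain ⟨l, rfl⟩ := ZFSet.mem_range.1 hz
      exact ⟨_, _, mem_natCode.2 ⟨l, rfl⟩, (a l).2, rfl⟩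
    · obtain ⟨l, rfl⟩ := mem_natCode.1 hj
      exact ⟨a l, natCode_pair_mem_seqCode.2 rfl, fun y hy => natCode_pair_mem_seqCode.1 hy⟩
  · rintro ⟨_, ⟨n, rfl⟩, h1, h2⟩
    choose x hx hx' using fun l : Fin n => h2 (natCode l) (mem_natCode.2 ⟨l, rfl⟩)
    have hX : ∀ l, x l ∈ X := by
      intro l
      obtain ⟨j, y, -, hy, he⟩ := h1 _ (hx l)
      rw [(ZFSet.pair_inj.1 he).2]
      exact hy
    refine ⟨n, fun l => ⟨x l, hX l⟩, ZFSet.ext fun z => ⟨fun hz => ?_, fun hz => ?_⟩⟩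
    · obtain ⟨j, y, hj, -, rfl⟩ := h1 z hz
      obtain ⟨l, rfl⟩ := mem_natCode.1 hj
      exact natCode_pair_mem_seqCode.2 (hx' l y hz)
    · obtain ⟨l, rfl⟩ := ZFSet.mem_range.1 hz
      exact hx l

/-- The relations which hold of the values of a definable map at the entries of a finite sequence
are definable, uniformly in a code of the relation and in the sequence. -/
theorem isDef_seq_rel {ι κ : Type} {β : ℕ → Type} {X : Set ZFSet.{u}} (hX : IsDefClass r X)
    (c : (Σ n, β n) → ZFSet.{u}) (Q : ∀ n, β n → (Fin n → ι) → κ → Prop)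
    {h : ZFSet.{u} → ZFSet.{u} → ι}
    (hh : IsDefMap r fun v : Fin 2 → ZFSet.{u} => h (v 0) (v 1))
    {g : (Fin N → ZFSet.{u}) → κ} (hg : IsDefMap r g) (i j k : Fin N) :
    IsDef r fun v : Fin N → ZFSet.{u} => ∃ (n : ℕ) (R : β n) (a : Fin n → X),
      v i = c ⟨n, R⟩ ∧ v j = seqCode (fun l => (a l : ZFSet.{u})) ∧
        Q n R (fun l => h (a l) (v k)) (g v) := by
  -- The values along the sequence are collected in `y`, again a sequence code. What remains is a
  -- relation between the codes of a symbol, of a finite sequence in `ι` and of an element of `κ`;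
  -- its extension is a set.
  refine IsDef.congr (P := fun v =>
    (∃ (n : ℕ) (a : Fin n → X), v j = seqCode fun l => (a l : ZFSet.{u})) ∧
    ∃ y t, (∀ z, z ∈ y ↔ ∃ p x w, ZFSet.pair p x ∈ v j ∧ w = smallCode ι (h x (v k)) ∧
        z = ZFSet.pair p w) ∧ t = smallCode κ (g v) ∧
      ∃ q : {q : (Σ n, β n × (Fin n → ι)) × κ // Q q.1.1 q.1.2.1 q.1.2.2 q.2},
        v i = c ⟨q.1.1.1, q.1.1.2.1⟩ ∧ y = seqCode (fun l => smallCode ι (q.1.1.2.2 l)) ∧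
          t = smallCode κ q.1.2)
    (.and (isDef_seq hX _) (.ex (.ex (.and (.all (.iff (IsDef.mem 0 2) (.ex (.ex (.ex
      (.and (IsDef.pair_mem _ _ _) (.and ((hh.app2 1 k.succ.succ.succ.succ.succ.succ).graph id 0)
        (IsDef.pair _ _ _)))))))) (.and (hg.graph (fun l => l.succ.succ) 0)
          (IsDef.small3' _ _ _ i.succ.succ 1 0)))))) fun v => ?_
  have key : ∀ {n : ℕ} (a : Fin n → X) (y : ZFSet.{u}),
      v j = seqCode (fun l => (a l : ZFSet.{u})) →
      ((∀ z, z ∈ y ↔ ∃ p x w, ZFSet.pair p x ∈ v j ∧ w = smallCode ι (h x (v k)) ∧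
        z = ZFSet.pair p w) ↔ y = seqCode fun l => smallCode ι (h (a l) (v k))) := by
    intro n a y ha
    rw [ZFSet.ext_iff]
    refine forall_congr' fun z => ?_
    rw [ha, seqCode.eq_1 (fun l => smallCode ι _), ZFSet.mem_range]
    have : (∃ p x w, ZFSet.pair p x ∈ seqCode (fun l => (a l : ZFSet.{u})) ∧
        w = smallCode ι (h x (v k)) ∧ z = ZFSet.pair p w) ↔
        ∃ l : Fin n, ZFSet.pair (natCode l) (smallCode ι (h (a l) (v k))) = z := by
      constructor
      · rintro ⟨p, x, w, hpx, rfl, rfl⟩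
        obtain ⟨l, rfl, rfl⟩ := pair_mem_seqCode.1 hpx
        exact ⟨l, rfl⟩
      · rintro ⟨l, rfl⟩
        exact ⟨_, _, _, natCode_pair_mem_seqCode.2 rfl, rfl, rfl⟩
    rw [this]
  constructor
  · rintro ⟨n, R, a, hi, hj, hQ⟩
    exact ⟨⟨n, a, hj⟩, _, _, (key a _ hj).2 rfl, rfl, ⟨(⟨n, R, _⟩, _), hQ⟩, hi, rfl, rfl⟩
  · rintro ⟨⟨n, a, hj⟩, y, t, hy, ht, ⟨⟨⟨n', R, b⟩, q⟩, hQ⟩, hi, hy', ht'⟩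
    rw [key a y hj] at hy
    dsimp only at hi hy' ht' hQ
    rw [hy] at hy'
    obtain rfl : n = n' := (le_of_seqCode_eq hy').antisymm (le_of_seqCode_eq hy'.symm)
    obtain rfl : (fun l => h (a l) (v k)) = b :=
      funext fun l => smallCode_injective (congrFun (seqCode_injective hy') l)
    rw [ht, smallCode_inj] at ht'
    subst ht'
    exact ⟨n, R, a, hi, hj, hQ⟩

end

/-- Symbol and arguments can be read off from their codes, so decodings obtained at different `s`
coincide. -/
theorem sigma_seq_unique {β : ℕ → Type} {X : Set ZFSet.{u}} {c : (Σ n, β n) → ZFSet.{u}}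
    (hc : Function.Injective c) {n n' : ℕ} {R : β n} {R' : β n'} {a : Fin n → X} {a' : Fin n' → X}
    (hR : c ⟨n, R⟩ = c ⟨n', R'⟩)
    (ha : seqCode (fun l => (a l : ZFSet.{u})) = seqCode fun l => (a' l : ZFSet.{u})) :
    (⟨n, R, a⟩ : Σ n, β n × (Fin n → X)) = ⟨n', R', a'⟩ := by
  obtain ⟨rfl, h⟩ := Sigma.mk.inj_iff.1 (hc hR)
  obtain rfl := eq_of_heq h
  obtain rfl : a = a' := funext fun l => Subtype.ext (congrFun (seqCode_injective ha) l)
  rfl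

/-! ### The structure of the hyperreals is definable on codes -/

namespace Hyper

open FirstOrder.Language DefAlmostHom

variable {r : ZFSet.{u} → ZFSet.{u} → Prop} {U : DefUltrafilter r}

/-- By definition of the quotient, a fact about the named elements says that the corresponding fact
about the values in the reals holds for almost all `s`. The latter is definable uniformly in the
codes, so the definability of the ultrafilter applies. -/
theorem isDefNamed {X : Set ZFSet.{u}} {Φ : X → DefAlmostHom r} (hX : IsDefClass r X)
    (hΦ : IsDefFamily X Φ) : IsDefNamed r fullLang X fun a => mk U (Φ a) := by
  have hv := isDefMap_familyValue hΦ
  refine ⟨?_, ⟨smallCode _, smallCode_injective, ?_⟩, ⟨smallCode _, smallCode_injective, ?_⟩⟩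
  · refine IsDef.congr (P := fun v => v 0 ∈ X ∧ v 1 ∈ X ∧
      U.Ev fun s => familyValue Φ (v 0) s = familyValue Φ (v 1) s)
      (.and (hX.app1 0) (.and (hX.app1 1) (DefUltrafilter.isDef_ev₂
        (T := fun a b s => familyValue Φ a s = familyValue Φ b s)
        (((hv.app2 0 2).prodMk (hv.app2 1 2)).prop fun x => x.1 = x.2) 0 1))) fun v => ?_
    constructor
    · rintro ⟨a, b, h0, h1, h⟩
      rw [h0, h1]
      simp only [familyValue_coe]
      exact ⟨a.2, b.2, mk_eq_mk.1 h⟩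
    · rintro ⟨h0, h1, h⟩
      refine ⟨⟨_, h0⟩, ⟨_, h1⟩, rfl, rfl, mk_eq_mk.2 ?_⟩
      simp only [← familyValue_coe]
      exact h
  · let T : ZFSet.{u} → ZFSet.{u} → ZFSet.{u} → ZFSet.{u} → Prop := fun f A b s =>
      ∃ (n : ℕ) (f' : fullLang.Functions n) (a : Fin n → X), f = smallCode (Σ n, fullLang.Functions n) ⟨n, f'⟩ ∧
        A = seqCode (fun l => (a l : ZFSet.{u})) ∧
        Structure.funMap f' (fun l => familyValue Φ (a l) s) = familyValue Φ b s
    have hT : IsDef r fun v : Fin 4 → ZFSet.{u} => T (v 0) (v 1) (v 2) (v 3) :=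
      isDef_seq_rel hX (smallCode (Σ n, fullLang.Functions n))
        (fun n f y (t : Eudoxus) => Structure.funMap f y = t) hv (hv.app2 2 3) 0 1 3
    refine IsDef.congr (P := fun v => v 2 ∈ X ∧ U.Ev (T (v 0) (v 1) (v 2)))
      (.and (hX.app1 2) (DefUltrafilter.isDef_ev₃ hT 0 1 2)) fun v => ?_
    constructor
    · rintro ⟨n, f, a, b, h0, h1, h2, h⟩
      refine ⟨h2 ▸ b.2, ?_⟩
      obtain ⟨G, hG, hG'⟩ := exists_funMap_mk (U := U) f fun l => Φ (a l)
      refine (mk_eq_mk.1 (hG.symm.trans h)).mono ?_ fun s hs he => ⟨n, f, a, h0, h1, ?_⟩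
      · exact (IsDef.congr (P := fun w => ∃ x y z, x = v 0 ∧ y = v 1 ∧ z = v 2 ∧ T x y z (w 0))
          (.ex (.ex (.ex (.and (IsDef.eq_const _ _) (.and (IsDef.eq_const _ _)
            (.and (IsDef.eq_const _ _) (hT.app4 _ _ _ _))))))) fun w => by simp)
      · rw [h2, familyValue_coe, ← he, hG' s hs]
        simp only [familyValue_coe]
    · rintro ⟨h2, h⟩
      -- One `s` suffices to decode the symbol and the arguments, since the decoding does not depend
      -- on `s`.
      obtain ⟨s, -, n, f, a, h0, h1, -⟩ := h.exists
      refine ⟨n, f, a, ⟨_, h2⟩, h0, h1, rfl, ?_⟩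
      obtain ⟨G, hG, hG'⟩ := exists_funMap_mk (U := U) f fun l => Φ (a l)
      rw [hG, mk_eq_mk]
      refine h.mono (((isDefMap_value _).prodMk (isDefMap_value _)).prop fun x => x.1 = x.2)
        fun s hs hTs => ?_
      obtain ⟨n', f', a', h0', h1', he⟩ := hTs
      cases sigma_seq_unique smallCode_injective (h0.symm.trans h0') (h1.symm.trans h1')
      rw [hG' s hs, ← familyValue_coe Φ ⟨v 2, h2⟩, ← he]
      simp only [familyValue_coe]
  · let T : ZFSet.{u} → ZFSet.{u} → ZFSet.{u} → Prop := fun R A s =>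
      ∃ (n : ℕ) (R' : fullLang.Relations n) (a : Fin n → X), R = smallCode (Σ n, fullLang.Relations n) ⟨n, R'⟩ ∧
        A = seqCode (fun l => (a l : ZFSet.{u})) ∧
        Structure.RelMap R' (fun l => familyValue Φ (a l) s)
    have hT : IsDef r fun v : Fin 3 → ZFSet.{u} => T (v 0) (v 1) (v 2) :=
      isDef_seq_rel hX (smallCode (Σ n, fullLang.Relations n))
        (fun n R y (_ : Unit) => Structure.RelMap R y) hv (isDefMap_const ()) 0 1 2
    refine IsDef.congr (P := fun v => U.Ev (T (v 0) (v 1)))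
      (DefUltrafilter.isDef_ev₂ hT 0 1) fun v => ?_
    constructor
    · rintro ⟨n, R, a, h0, h1, h⟩
      refine ((relMap_mk R fun l => Φ (a l)).1 h).mono ?_ fun s hs he => ⟨n, R, a, h0, h1, ?_⟩
      · exact (IsDef.congr (P := fun w => ∃ x y, x = v 0 ∧ y = v 1 ∧ T x y (w 0))
          (.ex (.ex (.and (IsDef.eq_const _ _) (.and (IsDef.eq_const _ _)
            (hT.app3 _ _ _))))) fun w => by simp)
      · simp only [familyValue_coe]
        exact he
    · intro h
      obtain ⟨s, -, n, R, a, h0, h1, -⟩ := h.exists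
      refine ⟨n, R, a, h0, h1, (relMap_mk R fun l => Φ (a l)).2 ?_⟩
      refine h.mono (isDef_values _ _) fun s hs hTs => ?_
      obtain ⟨n', R', a', h0', h1', he⟩ := hTs
      cases sigma_seq_unique smallCode_injective (h0.symm.trans h0') (h1.symm.trans h1')
      simp only [familyValue_coe] at he
      exact he

end Hyper

open FirstOrder.Language

/-! ### Formulas and relations on the reals -/

section Elementary

variable {M : Type*} [fullLang.Structure M]

/-- In an elementary extension of the reals, each formula is equivalent to the relation symbol for
the relation on the reals which it defines. -/
theorem realize_iff_relMap (e : Eudoxus ↪ₑ[fullLang] M) {m : ℕ}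
    (ψ : fullLang.Formula (Fin (m + 1))) (x : Fin (m + 1) → M) :
    ψ.Realize x ↔ Structure.RelMap (L := fullLang) (FullRel.rel {y | ψ.Realize y}) x := by
  let R : fullLang.Relations (m + 1) := FullRel.rel {y | ψ.Realize y}
  let χ : fullLang.Formula (Fin (m + 1)) := ψ.iff (R.formula Term.var)
  -- This sentence states the equivalence for all tuples. It holds in the reals by the choice of the
  -- relation, and elementarity transfers it to `M`.
  let θ : fullLang.Formula Empty :=
    Formula.iAlls (Fin (m + 1)) (χ.relabel (Sum.inr : Fin (m + 1) → Empty ⊕ Fin (m + 1)))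
  have hθ : ∀ {N : Type _} [fullLang.Structure N] (v : Empty → N),
      θ.Realize v ↔ ∀ y : Fin (m + 1) → N, ψ.Realize y ↔ Structure.RelMap R y := by
    intro N _ v
    simp only [θ, χ, Formula.realize_iAlls, Formula.realize_relabel, Formula.realize_iff,
      Formula.realize_rel]
    rfl
  have h0 : ∀ v : Empty → Eudoxus, θ.Realize v := by
    intro v
    simp only [θ, χ, Formula.realize_iAlls, Formula.realize_relabel, Formula.realize_iff,
      Formula.realize_rel]
    exact fun y => Iff.rfl
  exact (hθ _).1 ((e.map_formula θ Empty.elim).2 (h0 _)) x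

/-- A finite part of an elementary extension of the reals can be copied in the reals, with respect
to finitely many relations. -/
theorem exists_finite_approximation (e : Eudoxus ↪ₑ[fullLang] M) {S : Set M} (hS : S.Finite)
    {K : Set (Σ n, fullLang.Relations n)} (hK : K.Finite) :
    ∃ y : M → Eudoxus, ∀ ρ ∈ K, ∀ a : Fin ρ.1 → M, (∀ i, a i ∈ S) →
      (Structure.RelMap ρ.2 a ↔ Structure.RelMap ρ.2 fun i => y (a i)) := by
  classical
  have := hS.to_subtype
  have := hK.to_subtype
  -- These are the finitely many literals of the diagram of `S` for the symbols in `K`. That they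
  -- have a common solution is a first-order sentence true in `M`, hence in the reals.
  let lit : (Σ ρ : K, Fin ρ.1.1 → S) → fullLang.Formula S := fun q =>
    if Structure.RelMap q.1.1.2 (fun i => (q.2 i : M)) then
      q.1.1.2.formula fun i => Term.var (q.2 i)
    else ∼(q.1.1.2.formula fun i => Term.var (q.2 i))
  let θ : fullLang.Formula Empty :=
    Formula.iExs S ((Formula.iInf lit).relabel (Sum.inr : S → Empty ⊕ S))
  have hM : θ.Realize (Empty.elim : Empty → M) := by
    rw [Formula.realize_iExs]
    refine ⟨fun s => s, ?_⟩
    rw [Formula.realize_relabel, Formula.realize_iInf]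
    intro q
    by_cases hq : Structure.RelMap q.1.1.2 (fun i => (q.2 i : M))
    · simp only [lit, if_pos hq, Formula.realize_rel]
      exact hq
    · simp only [lit, if_neg hq, Formula.realize_not, Formula.realize_rel]
      exact hq
  have hR : θ.Realize (Empty.elim : Empty → Eudoxus) := by
    rw [← e.map_formula θ, Subsingleton.elim (e ∘ Empty.elim) Empty.elim]
    exact hM
  rw [Formula.realize_iExs] at hR
  obtain ⟨z, hz⟩ := hR
  rw [Formula.realize_relabel, Formula.realize_iInf] at hz
  refine ⟨fun m => if h : m ∈ S then z ⟨m, h⟩ else 0, fun ρ hρ a ha => ?_⟩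
  have h := hz ⟨⟨ρ, hρ⟩, fun i => ⟨a i, ha i⟩⟩
  simp only [ha, dite_true]
  by_cases hq : Structure.RelMap ρ.2 a
  · simp only [lit, if_pos hq, Formula.realize_rel] at h
    exact iff_of_true hq h
  · simp only [lit, if_neg hq, Formula.realize_not, Formula.realize_rel] at h
    exact iff_of_false hq h

end Elementary

/-! ### Set codes of finite real-valued functions -/

section Entry

variable {r : ZFSet.{u} → ZFSet.{u} → Prop}

/-- The value at `x` of the real-valued function coded by `G`. -/
noncomputable def entry (x G : ZFSet.{u}) : Eudoxus :=
  Classical.epsilon fun k => ZFSet.pair x (smallCode Eudoxus k) ∈ G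

/-- The set of candidate values depends definably on `x` and `G`, and picking one of them is a fixed
function on the subsets of the reals. -/
theorem isDefMap_entry : IsDefMap r fun v : Fin 2 → ZFSet.{u} => entry (v 0) (v 1) := by
  have h : IsDefMap r fun v : Fin 2 → ZFSet.{u} =>
      {k : Eudoxus | ZFSet.pair (v 0) (smallCode Eudoxus k) ∈ v 1} := by
    refine IsDefMap.ofMem (IsDef.congr (P := fun w => (∃ k, w 0 = smallCode Eudoxus k) ∧
      ZFSet.pair (w 1) (w 0) ∈ w 2) (.and (IsDef.small1 _ _) (IsDef.pair_mem _ _ _)) fun w => ?_)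
    constructor
    · rintro ⟨k, hk, h⟩
      refine ⟨⟨k, hk⟩, ?_⟩
      rw [hk]
      exact h
    · rintro ⟨⟨k, hk⟩, h⟩
      refine ⟨k, hk, ?_⟩
      rw [hk] at h
      exact h
  exact h.comp fun S => Classical.epsilon fun k => k ∈ S

theorem exists_entry_eq {S : Set ZFSet.{u}} (hS : S.Finite) (y : ZFSet.{u} → Eudoxus) :
    ∃ G : ZFSet.{u}, ∀ x ∈ S, entry x G = y x := by
  have : Small.{u} S := by
    have := hS.to_subtype
    infer_instance
  refine ⟨ZFSet.range fun x : S => ZFSet.pair x.1 (smallCode Eudoxus (y x)), fun x hx => ?_⟩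
  have h : ∀ k, ZFSet.pair x (smallCode Eudoxus k) ∈ ZFSet.range (fun x : S =>
      ZFSet.pair x.1 (smallCode Eudoxus (y x))) ↔ k = y x := by
    intro k
    rw [ZFSet.mem_range]
    constructor
    · rintro ⟨z, hz⟩
      obtain ⟨h1, h2⟩ := ZFSet.pair_inj.1 hz
      rw [← h1, smallCode_injective h2]
    · rintro rfl
      exact ⟨⟨x, hx⟩, rfl⟩
  have := Classical.epsilon_spec
    (p := fun k => ZFSet.pair x (smallCode Eudoxus k) ∈ ZFSet.range (fun x : S =>
      ZFSet.pair x.1 (smallCode Eudoxus (y x)))) ⟨y x, (h _).2 rfl⟩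
  exact (h _).1 this

/-- A definable choice of a member of each member of a definable family of classes. -/
theorem exists_isDefFun_choice [IsWellOrder ZFSet.{u} r] {P : ZFSet.{u} → ZFSet.{u} → Prop}
    (hP : IsDef r fun v : Fin 2 → ZFSet.{u} => P (v 0) (v 1)) :
    ∃ F : ZFSet.{u} → ZFSet.{u}, IsDefFun r F ∧ ∀ s, (∃ G, P s G) → P s (F s) := by
  have hwf : WellFounded r := IsWellFounded.wf
  -- The witness is the least one in the well-ordering, and `∅` if there is none, so that the choice
  -- is a total function with a definable graph.
  have key : ∀ s, ∃ G, (P s G ∧ ∀ G', r G' G → ¬ P s G') ∨ (¬ (∃ G', P s G') ∧ G = ∅) := by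
    intro s
    by_cases h : ∃ G', P s G'
    · exact ⟨hwf.min {G | P s G} h, Or.inl ⟨hwf.min_mem _ h,
        fun G' hG' hP' => hwf.not_lt_min {G | P s G} hP' hG'⟩⟩
    · exact ⟨∅, Or.inr ⟨h, rfl⟩⟩
  choose F hF using key
  refine ⟨F, IsDef.congr (P := fun v => (P (v 0) (v 1) ∧ ∀ G', r G' (v 1) → ¬ P (v 0) G') ∨
    (¬ (∃ G', P (v 0) G') ∧ v 1 = ∅)) (.or (.and hP (.all (.imp (IsDef.rel _ _)
      (.not (hP.app2 _ _))))) (.and (.not (.ex (hP.app2 _ _))) (IsDef.eq_const _ _))) fun v => ?_,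
    fun s h => ?_⟩
  · constructor
    · intro h
      rw [h]
      exact hF (v 0)
    · rintro (⟨h1, h2⟩ | ⟨h1, h2⟩)
      · rcases hF (v 0) with ⟨h3, h4⟩ | ⟨h3, -⟩
        · rcases trichotomous_of r (v 1) (F (v 0)) with h | h | h
          · exact absurd h1 (h4 _ h)
          · exact h
          · exact absurd h3 (h2 _ h)
        · exact absurd ⟨_, h1⟩ h3
      · rcases hF (v 0) with ⟨h3, -⟩ | ⟨-, h3⟩
        · exact absurd ⟨_, h3⟩ h1
        · rw [h2, h3]
  · rcases hF s with h' | h'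
    · exact h'.1
    · exact absurd h h'.1

end Entry

/-! ### Universality -/

namespace Hyper

open DefAlmostHom

variable {r : ZFSet.{u} → ZFSet.{u} → Prop}

/-- The elements of a definable elementary extension of the reals can be named by a definable family
of almost homomorphisms, in such a way that all relations are preserved. -/
theorem exists_family_relMap_iff [IsWellOrder ZFSet.{u} r] (U : DefUltrafilter r)
    {D : Set ZFSet.{u}} [fullLang.Structure D] (hD : IsDefStructure r fullLang D)
    (e : Eudoxus ↪ₑ[fullLang] D) :
    ∃ Φ : D → DefAlmostHom r, IsDefFamily D Φ ∧
      ∀ (n : ℕ) (R : fullLang.Relations n) (a : Fin n → D),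
        Structure.RelMap R (fun i => mk U (Φ (a i))) ↔ Structure.RelMap R a := by
  obtain ⟨o, ho, hdo⟩ := exists_definable_enumeration r
  obtain ⟨hDc, -, -, c, hc, hrel⟩ := hD
  let RelD : ZFSet.{u} → ZFSet.{u} → Prop := fun C A =>
    ∃ (n : ℕ) (R : fullLang.Relations n) (a : Fin n → D), C = c ⟨n, R⟩ ∧
      A = seqCode (fun i => (a i : ZFSet.{u})) ∧ Structure.RelMap R fun i => a i
  let Sat : ZFSet.{u} → ZFSet.{u} → ZFSet.{u} → Prop := fun C A G =>
    ∃ (n : ℕ) (R : fullLang.Relations n) (a : Fin n → D), C = c ⟨n, R⟩ ∧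
      A = seqCode (fun i => (a i : ZFSet.{u})) ∧ Structure.RelMap R fun i => entry (a i) G
  have hSat : IsDef r fun v : Fin 3 → ZFSet.{u} => Sat (v 0) (v 1) (v 2) :=
    isDef_seq_rel hDc c (fun n R y (_ : Unit) => Structure.RelMap R y) isDefMap_entry
      (isDefMap_const ()) 0 1 2
  -- A set is selected by `s` if its ordinal is an element of `s`. This applies both to elements of
  -- the field and to codes of relation symbols.
  let In : ZFSet.{u} → ZFSet.{u} → Prop := fun x s => (o x).toZFSet ∈ s
  have hIn : IsDef r fun v : Fin 2 → ZFSet.{u} => In (v 0) (v 1) :=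
    IsDef.congr (P := fun v => ∃ a, a = (o (v 0)).toZFSet ∧ a ∈ v 1)
      (.ex (.and (hdo.app _ _) (IsDef.mem 0 2))) fun v => by simp [In]
  -- `G` codes a real-valued function that copies into the reals the part of the structure selected
  -- by `s`. If `A` is not a sequence code for a tuple from `D`, both sides of the equivalence are
  -- false.
  let Good : ZFSet.{u} → ZFSet.{u} → Prop := fun s G => ∀ C A, In C s →
    (∀ p x, ZFSet.pair p x ∈ A → In x s) → (RelD C A ↔ Sat C A G)
  have hGood : IsDef r fun v : Fin 2 → ZFSet.{u} => Good (v 0) (v 1) := by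
    refine .all (.all (.imp (hIn.app2 1 2) (.imp (.all (.all (.imp (IsDef.pair_mem 1 0 2)
      (hIn.app2 0 4)))) (.iff ?_ (hSat.app3 1 0 3)))))
    exact IsDef.app2 (P := RelD) hrel 1 0
  have hGood_iff : ∀ {s G : ZFSet.{u}}, Good s G → ∀ {n : ℕ} (R : fullLang.Relations n)
      (a : Fin n → D), In (c ⟨n, R⟩) s → (∀ i, In (a i) s) →
      (Structure.RelMap R a ↔ Structure.RelMap R fun i => entry (a i) G) := by
    intro s G h n R a hR ha
    have h := h (c ⟨n, R⟩) (seqCode fun i => (a i : ZFSet.{u})) hR fun p x hp => by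
      obtain ⟨i, -, rfl⟩ := pair_mem_seqCode.1 hp
      exact ha i
    constructor
    · intro hRa
      obtain ⟨n', R', a', h0, h1, h'⟩ := h.1 ⟨n, R, a, rfl, rfl, hRa⟩
      cases sigma_seq_unique hc h0 h1
      exact h'
    · intro hRa
      obtain ⟨n', R', a', h0, h1, h'⟩ := h.2 ⟨n, R, a, rfl, rfl, hRa⟩
      cases sigma_seq_unique hc h0 h1
      exact h'
  have hex : ∀ s ∈ FinOrd, ∃ G, Good s G := by
    intro s hs
    have hfin := finite_of_mem_finOrd ho hs
    obtain ⟨y, hy⟩ := exists_finite_approximation e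
      (hfin.preimage (Subtype.val_injective (p := (· ∈ D))).injOn) (hfin.preimage hc.injOn)
    classical
    obtain ⟨G, hG⟩ := exists_entry_eq hfin fun x => if h : x ∈ D then y ⟨x, h⟩ else 0
    refine ⟨G, fun C A hC hA => ?_⟩
    have key : ∀ {n : ℕ} (R : fullLang.Relations n) (a : Fin n → D), C = c ⟨n, R⟩ →
        A = seqCode (fun i => (a i : ZFSet.{u})) →
        ((Structure.RelMap R fun i => a i) ↔ Structure.RelMap R fun i => entry (a i) G) := by
      intro n R a hCR hAa
      have ha : ∀ i, In (a i) s := fun i => hA (natCode i) (a i) (by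
        rw [hAa]
        exact natCode_pair_mem_seqCode.2 rfl)
      have hE : (fun i => entry (a i) G) = fun i => y (a i) := funext fun i => by
        rw [hG _ (ha i), dif_pos (a i).2]
      rw [hE]
      exact hy ⟨n, R⟩ (show In (c ⟨n, R⟩) s from hCR ▸ hC) a ha
    refine exists_congr fun n => exists_congr fun R => exists_congr fun a =>
      and_congr_right fun h1 => and_congr_right fun h2 => key R a h1 h2
  obtain ⟨F, hF, hFG⟩ := exists_isDefFun_choice hGood
  have hH : IsDefMap r fun v : Fin 2 → ZFSet.{u} => entry (v 0) (F (v 1)) :=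
    IsDef.congr (P := fun w => ∃ G, G = F (w 2) ∧ w 0 = smallCode _ (entry (w 1) G))
      (.ex (.and (hF.app _ _) ((isDefMap_entry.app2 2 0).graph id 1))) fun w => by simp
  have hHd : ∀ d : ZFSet.{u}, IsDefMap r fun v : Fin 1 → ZFSet.{u} => entry d (F (v 0)) :=
    fun d => IsDef.congr (P := fun w => ∃ x, x = d ∧ w 0 = smallCode _ (entry x (F (w 1))))
      (.ex (.and (IsDef.eq_const _ _)
      ((IsDefMap.app2 (h := fun d s => entry d (F s)) hH 0 2).graph id 1))) fun w => by simp
  let Φ : D → DefAlmostHom r := fun d => ofMap (fun s => entry d (F s)) (hHd d)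
  refine ⟨Φ, isDef_graph_rep (fun d s => entry d (F s)) hH hDc, fun n R a => ?_⟩
  have hval : ∀ (d : D), ∀ s ∈ FinOrd, (Φ d).value s = entry d (F s) := fun d s hs =>
    value_ofMap _ _ hs
  have hdef : IsDef r fun v : Fin 1 → ZFSet.{u} =>
      Structure.RelMap R fun i => (Φ (a i)).value (v 0) := isDef_values _ _
  have hInd : ∀ x, IsDef r fun v : Fin 1 → ZFSet.{u} => In x (v 0) := fun x =>
    IsDef.const_mem _ _
  -- Almost all `s` select the finitely many entries of `a` and the symbol `R`; at such `s` the copy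
  -- is faithful to `R` at `a`.
  have hev : U.Ev fun s => Structure.RelMap R a ↔
      Structure.RelMap R fun i => (Φ (a i)).value s := by
    have h1 : U.Ev fun s => ∀ i, In (a i) s := DefUltrafilter.ev_forall_finite
      (fun i => hInd (a i)) fun i => DefUltrafilter.ev_hat (ZFSet.isOrdinal_toZFSet _)
    have h2 : U.Ev fun s => In (c ⟨n, R⟩) s :=
      DefUltrafilter.ev_hat (ZFSet.isOrdinal_toZFSet _)
    refine (h1.and h2).mono ((IsDef.const _).iff hdef) fun s hs h => ?_
    rw [hGood_iff (hFG s (hex s hs)) R a h.2 h.1]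
    simp only [hval _ s hs]
  rw [relMap_mk]
  constructor
  · intro h
    obtain ⟨s, -, h1, h2⟩ := (hev.and h).exists
    exact h1.2 h2
  · exact fun h => hev.mono hdef fun s _ h' => h'.1 h

/-- Preserving the relation symbols suffices, because both structures are elementary extensions of
the reals, and each formula is equivalent to the same relation symbol in both
(`realize_iff_relMap`). -/
theorem exists_elementaryEmbedding [IsWellOrder ZFSet.{u} r] (U : DefUltrafilter r)
    {D : Set ZFSet.{u}} [fullLang.Structure D] (hD : IsDefStructure r fullLang D)
    (e : Eudoxus ↪ₑ[fullLang] D) :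
    ∃ (Φ : D → DefAlmostHom r) (j : D ↪ₑ[fullLang] Hyper U),
      IsDefFamily D Φ ∧ ∀ d, j d = mk U (Φ d) := by
  obtain ⟨Φ, hΦ, h⟩ := exists_family_relMap_iff U hD e
  refine ⟨Φ, ⟨fun d => mk U (Φ d), fun n φ x => ?_⟩, hΦ, fun d => rfl⟩
  -- The relation symbols for sets of tuples have positive arity. A dummy variable, interpreted by
  -- `e 0`, covers the case of sentences.
  let ψ : fullLang.Formula (Fin (n + 1)) := φ.relabel Fin.succ
  let x' : Fin (n + 1) → D := Fin.cons (e 0) x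
  have h1 : ψ.Realize x' ↔ φ.Realize x := by
    rw [Formula.realize_relabel]
    rfl
  have h2 : ψ.Realize (fun i => mk U (Φ (x' i))) ↔ φ.Realize fun i => mk U (Φ (x i)) := by
    rw [Formula.realize_relabel]
    rfl
  have h3 := h _ (FullRel.rel {y | ψ.Realize y}) x'
  rw [← realize_iff_relMap (embedding U), ← realize_iff_relMap e, h1, h2] at h3
  exact h3

end Hyper

end ClassHyperreal

open ClassHyperreal in
theorem theorem5 (r : ZFSet.{u} → ZFSet.{u} → Prop) [IsWellOrder ZFSet.{u} r] :
    Nonempty (DefUltrafilter r) ∧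
    ∀ U : DefUltrafilter r,
      IsHyperreal (Hyper U) ∧
      ¬ Small.{u} (Hyper U) ∧
      (∀ (X : Set ZFSet.{u}) (Φ : X → DefAlmostHom r), IsDefClass r X → IsDefFamily X Φ →
        IsDefNamed r fullLang X (fun a => Hyper.mk U (Φ a))) ∧
      ∀ (D : Set ZFSet.{u}) [fullLang.Structure D], IsDefStructure r fullLang D →
        IsHyperreal D →
        ∃ (Φ : D → DefAlmostHom r) (e : D ↪ₑ[fullLang] Hyper U),
          IsDefFamily D Φ ∧ ∀ d, e d = Hyper.mk U (Φ d) :=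
  ⟨exists_defUltrafilter r, fun U => ⟨Hyper.isHyperreal, Hyper.not_small,
    fun _ _ hX hΦ => Hyper.isDefNamed hX hΦ,
    fun _ _ hD hH => hH.2.elim fun e _ => Hyper.exists_elementaryEmbedding U hD e⟩⟩
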